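/- **Theorem 4.** Consider the bounded knapsack problem with a separable objective: given $n\ge 1$, $W\ge 2$, $w,u\in\mathbb Z_{>0}^n$ and $f(x)=f_1(x_1)+\dots+f_n(x_n)$ with $f_i:\mathbb Z\to\mathbb R$, optimize $f(x)$ (maximize or, equally, minimize) over all $x\in\mathbb Z^n$ with $w^\top x=W$ and $0\le x\le u$. To solve the problem means to return an optimal solution and its value, or to report that there is no feasible solution. Time is the number of elementary operations (arithmetic operations, comparisons, memory accesses, reading of input numbers, oracle calls) of a random access machine that has integers, used for control and addresses, and real values, which can be added, subtracted, multiplied and compared. For maximization and for minimization alike, each of the following problems is solved by a single program, with an absolute constant in the $O$-notation. 1. If every $f_i$ is piecewise linear with $p$ pieces on $\{0,\dots,u_i\}$ (that is, $f_i(x)=\alpha_{ik}x+\beta_{ik}$ for $t_{i,k}\le x<t_{i,k+1}$, $0\le k<p$, where $0=t_{i,0}\le\dots\le t_{i,p}$ are integers and $t_{i,p}>u_i$), given by the numbers $\alpha_{ik},\beta_{ik},t_{ik}$, the problem is solved in time $$O\bigl(p\cdot n\cdot W\cdot\log W\bigr).$$ 2. If every $f_i$ is concave on $\{0,\dots,u_i\}$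 and given by an oracle that returns $f_i(x)$ for $0\le x\le u_i$, the problem is solved in time $$O\bigl(n\cdot W^{4/3}\cdot\log^2 W\bigr),$$ and, if $w_i\le W$ for all $i$, this time is also $$O\Bigl(W+W^{4/3}\cdot\bigl(w_2^{-1/3}+w_3^{-1/3}+\dots+w_n^{-1/3}\bigr)\cdot\log^2 W\Bigr).$$ 3. If every $f_i$ is given on $\{0,\dots,u_i\}$ by the coefficients of a polynomial with integer coefficients of degree at most $d\ge1$, the problem is solved in time $$O\bigl(d^3\cdot n\cdot W^{1+\frac{\sigma-1}{\sigma}}\cdot\log^2 W\bigr),\qquad \sigma=\log_2 d+\frac1{1+\log_2 d},$$ and, if $w_i\le W$ for all $i$, this time is also $$O\Bigl(d^3\cdot\Bigl(W+W^{1+\frac{\sigma-1}{\sigma}}\cdot\bigl(w_2^{\frac{1-\sigma}{\sigma}}+w_3^{\frac{1-\sigma}{\sigma}}+\dots+w_n^{\frac{1-\sigma}{\sigma}}\bigr)\cdot\log^2 W\Bigr)\Bigr).$$ All computations are performed with numbers of size $O(\log W)$, provided that the input numbers are of this size. Precisely, there is an absolute constant $C$ with the following property. If $B$ is an upper bound for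 $W$, $n$, all $w_i$ and $u_i$, the parameter $p$ (in 1) or $d$ (in 3), and all $|t_{ik}|$ (in 1), then all integers (control, addresses) that arise in the computation are at most $B^C$ in absolute value. If, in addition, all $\alpha_{ik},\beta_{ik}$ (in 1), all values $f_i(x)$ with $0\le x\le u_i$ (in 2), or all coefficients (in 3) are integers of absolute value at most $B$, then all objective values and coefficients that arise are integers of absolute value at most $B^C$ (in 1 and 2) or $B^{Cd}$ (in 3). In particular, for $B=W^{O(1)}$ (and, in 3, fixed $d$) all numbers have $O(\log W)$ bits. -/

import Mathlib

namespace Knap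

noncomputable section

/-! ## The bounded knapsack problem with a separable objective -/

/-- Data of a bounded knapsack problem with `n` items: weights `w`, upper bounds `u`, the right-hand
side `W` and the summands `f i` of the objective. -/
structure Problem (n : ℕ) where
  /-- right-hand side -/
  W : ℕ
  /-- weights -/
  w : Fin n → ℕ
  /-- upper bounds of the variables -/
  u : Fin n → ℕ
  /-- summands of the objective -/
  f : Fin n → ℤ → ℝ
  W_pos : 0 < W
  w_pos : ∀ i, 0 < w i
  u_pos : ∀ i, 0 < u i

/-- Whether the objective is to be maximized or minimized. -/
inductive Sense where
  | max
  | min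

namespace Problem

variable {n : ℕ}

/-- `w^T x = W`, `0 ≤ x ≤ u`, `x` integral. -/
def Feasible (K : Problem n) (x : Fin n → ℤ) : Prop :=
  (∑ i, (K.w i : ℤ) * x i = (K.W : ℤ)) ∧ ∀ i, 0 ≤ x i ∧ x i ≤ (K.u i : ℤ)

/-- The separable objective `f(x) = f_1(x_1) + ... + f_n(x_n)`. -/
def objective (K : Problem n) (x : Fin n → ℤ) : ℝ := ∑ i, K.f i (x i)

/-- `x` is an optimal solution. -/
def IsOptimal (K : Problem n) (sense : Sense) (x : Fin n → ℤ) : Prop :=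
  K.Feasible x ∧ ∀ y, K.Feasible y →
    match sense with
    | Sense.max => K.objective y ≤ K.objective x
    | Sense.min => K.objective x ≤ K.objective y

/-- Every `f i` is concave on the integer points `0, ..., u i`. -/
def IsConcave (K : Problem n) : Prop :=
  ∀ i, ∀ x : ℤ, 0 < x → x < (K.u i : ℤ) →
    K.f i (x + 1) - K.f i x ≤ K.f i x - K.f i (x - 1)

end Problem

/-- Explicit description of `n` piecewise linear functions with `p` pieces each: the `k`-th piece
(`k < p`) of the `i`-th function is `α i k * x + β i k` on the interval `[t i k, t i (k + 1))`.
Only the entries with `k < p` (for `t`: `k ≤ p`) matter. -/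
structure PiecewiseLinear (n p : ℕ) where
  /-- slopes -/
  α : Fin n → ℕ → ℝ
  /-- constant terms -/
  β : Fin n → ℕ → ℝ
  /-- end points of the pieces -/
  t : Fin n → ℕ → ℤ

/-- The description `D` represents the summands of the objective of `K`: the `p` pieces cover
`0, ..., u i`, and `f i` is given by the `k`-th affine function on the `k`-th piece. -/
def PiecewiseLinear.Represents {n p : ℕ} (D : PiecewiseLinear n p) (K : Problem n) : Prop :=
  ∀ i, D.t i 0 = 0 ∧ (K.u i : ℤ) < D.t i p ∧
    ∀ k < p, D.t i k ≤ D.t i (k + 1) ∧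
      ∀ x : ℤ, x ≤ (K.u i : ℤ) → D.t i k ≤ x → x < D.t i (k + 1) →
        K.f i x = D.α i k * (x : ℝ) + D.β i k

/-- The integer polynomials `q i`, of degree at most `d`, represent the summands of the
objective of `K`. -/
def PolyRepresents {n : ℕ} (d : ℕ) (q : Fin n → Polynomial ℤ) (K : Problem n) : Prop :=
  ∀ i, (q i).natDegree ≤ d ∧
    ∀ x : ℤ, 0 ≤ x → x ≤ (K.u i : ℤ) → K.f i x = (((q i).eval x : ℤ) : ℝ)

/-- `σ = log₂ d + 1 / (1 + log₂ d)`. -/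
def sigma (d : ℕ) : ℝ := Real.logb 2 d + 1 / (1 + Real.logb 2 d)

/-! ## The machine model

A random access machine with two sorts of numbers: integers (used for control and as addresses) and
real values (objective values and coefficients).  It has finitely many registers of each sort and
finitely many unbounded arrays of each sort; these, and all constants, are fixed by the program.
Integers can be added, subtracted, multiplied, divided with remainder and compared; values can be
added, subtracted, multiplied and compared, and an integer can be converted to a value, but not
conversely. The input is given by read-only tables; a table of values may be an evaluation oracle.
Every operation, memory access, table access or oracle call costs one step. -/

/-- Input of the machine: three integers and two-dimensional read-only tables. -/
structure Input where
  /-- the number of items -/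
  n : ℤ
  /-- the right-hand side -/
  W : ℤ
  /-- the number of pieces or the degree, where there is one -/
  par : ℤ
  /-- tables of integers -/
  itab : ℕ → ℤ → ℤ → ℤ
  /-- tables of values -/
  vtab : ℕ → ℤ → ℤ → ℝ

/-- Memory of the machine. -/
structure State where
  /-- integer registers -/
  ireg : ℕ → ℤ
  /-- value registers -/
  vreg : ℕ → ℝ
  /-- integer arrays -/
  iarr : ℕ → ℤ → ℤ
  /-- value arrays -/
  varr : ℕ → ℤ → ℝ

/-- In the beginning, the registers `0, 1, 2` hold the three integers of the input, and all the
remaining memory is zero. -/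
def Input.init (inp : Input) : State where
  ireg := fun k => if k = 0 then inp.n else if k = 1 then inp.W else if k = 2 then inp.par else 0
  vreg := fun _ => 0
  iarr := fun _ _ => 0
  varr := fun _ _ => 0

/-- Expressions of integer sort. -/
inductive IExpr where
  | const (z : ℤ)
  | reg (k : ℕ)
  | get (a : ℕ) (i : IExpr)
  | input (a : ℕ) (i j : IExpr)
  | add (x y : IExpr)
  | sub (x y : IExpr)
  | mul (x y : IExpr)
  | div (x y : IExpr)
  | mod (x y : IExpr)

namespace IExpr

/-- The value of an expression. -/
def eval (inp : Input) (s : State) : IExpr → ℤ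
  | const z => z
  | reg k => s.ireg k
  | get a i => s.iarr a (i.eval inp s)
  | input a i j => inp.itab a (i.eval inp s) (j.eval inp s)
  | add x y => x.eval inp s + y.eval inp s
  | sub x y => x.eval inp s - y.eval inp s
  | mul x y => x.eval inp s * y.eval inp s
  | div x y => x.eval inp s / y.eval inp s
  | mod x y => x.eval inp s % y.eval inp s

/-- The number of operations of an expression. -/
def cost : IExpr → ℕ
  | const _ => 1
  | reg _ => 1
  | get _ i => 1 + i.cost
  | input _ i j => 1 + i.cost + j.cost
  | add x y => 1 + x.cost + y.cost
  | sub x y => 1 + x.cost + y.cost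
  | mul x y => 1 + x.cost + y.cost
  | div x y => 1 + x.cost + y.cost
  | mod x y => 1 + x.cost + y.cost

/-- All numbers that arise when the expression is evaluated satisfy `iok`. -/
def All (inp : Input) (s : State) (iok : ℤ → Prop) : IExpr → Prop
  | const z => iok z
  | reg k => iok (s.ireg k)
  | get a i => i.All inp s iok ∧ iok ((get a i).eval inp s)
  | input a i j => i.All inp s iok ∧ j.All inp s iok ∧ iok ((input a i j).eval inp s)
  | add x y => x.All inp s iok ∧ y.All inp s iok ∧ iok ((add x y).eval inp s)
  | sub x y => x.All inp s iok ∧ y.All inp s iok ∧ iok ((sub x y).eval inp s)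
  | mul x y => x.All inp s iok ∧ y.All inp s iok ∧ iok ((mul x y).eval inp s)
  | div x y => x.All inp s iok ∧ y.All inp s iok ∧ iok ((div x y).eval inp s)
  | mod x y => x.All inp s iok ∧ y.All inp s iok ∧ iok ((mod x y).eval inp s)

end IExpr

/-- Expressions of value sort. -/
inductive VExpr where
  | ofInt (e : IExpr)
  | reg (k : ℕ)
  | get (a : ℕ) (i : IExpr)
  | input (a : ℕ) (i j : IExpr)
  | add (x y : VExpr)
  | sub (x y : VExpr)
  | mul (x y : VExpr)

namespace VExpr

/-- The value of an expression. -/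
def eval (inp : Input) (s : State) : VExpr → ℝ
  | ofInt e => (e.eval inp s : ℝ)
  | reg k => s.vreg k
  | get a i => s.varr a (i.eval inp s)
  | input a i j => inp.vtab a (i.eval inp s) (j.eval inp s)
  | add x y => x.eval inp s + y.eval inp s
  | sub x y => x.eval inp s - y.eval inp s
  | mul x y => x.eval inp s * y.eval inp s

/-- The number of operations of an expression. -/
def cost : VExpr → ℕ
  | ofInt e => 1 + e.cost
  | reg _ => 1
  | get _ i => 1 + i.cost
  | input _ i j => 1 + i.cost + j.cost
  | add x y => 1 + x.cost + y.cost
  | sub x y => 1 + x.cost + y.cost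
  | mul x y => 1 + x.cost + y.cost

/-- All integers that arise when the expression is evaluated satisfy `iok`, and all values that
arise satisfy `vok`. -/
def All (inp : Input) (s : State) (iok : ℤ → Prop) (vok : ℝ → Prop) : VExpr → Prop
  | ofInt e => e.All inp s iok ∧ vok ((ofInt e).eval inp s)
  | reg k => vok (s.vreg k)
  | get a i => i.All inp s iok ∧ vok ((get a i).eval inp s)
  | input a i j => i.All inp s iok ∧ j.All inp s iok ∧ vok ((input a i j).eval inp s)
  | add x y => x.All inp s iok vok ∧ y.All inp s iok vok ∧ vok ((add x y).eval inp s)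
  | sub x y => x.All inp s iok vok ∧ y.All inp s iok vok ∧ vok ((sub x y).eval inp s)
  | mul x y => x.All inp s iok vok ∧ y.All inp s iok vok ∧ vok ((mul x y).eval inp s)

end VExpr

/-- Tests. -/
inductive Cond where
  | ile (x y : IExpr)
  | vle (x y : VExpr)
  | not (c : Cond)
  | and (c e : Cond)

namespace Cond

/-- The truth value of a test. -/
def Holds (inp : Input) (s : State) : Cond → Prop
  | ile x y => x.eval inp s ≤ y.eval inp s
  | vle x y => x.eval inp s ≤ y.eval inp s
  | not c => ¬ c.Holds inp s
  | and c e => c.Holds inp s ∧ e.Holds inp s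

/-- The number of operations of a test. -/
def cost : Cond → ℕ
  | ile x y => 1 + x.cost + y.cost
  | vle x y => 1 + x.cost + y.cost
  | not c => 1 + c.cost
  | and c e => 1 + c.cost + e.cost

/-- All numbers that arise when the test is evaluated satisfy `iok` and `vok`. -/
def All (inp : Input) (s : State) (iok : ℤ → Prop) (vok : ℝ → Prop) : Cond → Prop
  | ile x y => x.All inp s iok ∧ y.All inp s iok
  | vle x y => x.All inp s iok vok ∧ y.All inp s iok vok
  | not c => c.All inp s iok vok
  | and c e => c.All inp s iok vok ∧ e.All inp s iok vok

end Cond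

/-- Programs. -/
inductive Prog where
  | skip
  | setReg (k : ℕ) (e : IExpr)
  | setArr (a : ℕ) (i : IExpr) (e : IExpr)
  | setVReg (k : ℕ) (e : VExpr)
  | setVArr (a : ℕ) (i : IExpr) (e : VExpr)
  | seq (P Q : Prog)
  | ite (c : Cond) (P Q : Prog)
  | while (c : Cond) (P : Prog)

/-- `Exec inp iok vok P s T s'`: on the input `inp`, the program `P`, started with the memory `s`,
terminates after exactly `T` steps with the memory `s'`, and all integers and all values that arise
in the computation satisfy `iok` and `vok`, respectively. -/
inductive Exec (inp : Input) (iok : ℤ → Prop) (vok : ℝ → Prop) :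
    Prog → State → ℕ → State → Prop where
  | skip (s : State) : Exec inp iok vok Prog.skip s 1 s
  | setReg (k : ℕ) (e : IExpr) (s : State) (he : e.All inp s iok) :
      Exec inp iok vok (Prog.setReg k e) s (1 + e.cost)
        { s with ireg := Function.update s.ireg k (e.eval inp s) }
  | setArr (a : ℕ) (i e : IExpr) (s : State) (hi : i.All inp s iok) (he : e.All inp s iok) :
      Exec inp iok vok (Prog.setArr a i e) s (1 + i.cost + e.cost)
        { s with iarr :=
            Function.update s.iarr a (Function.update (s.iarr a) (i.eval inp s) (e.eval inp s)) }
  | setVReg (k : ℕ) (e : VExpr) (s : State) (he : e.All inp s iok vok) :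
      Exec inp iok vok (Prog.setVReg k e) s (1 + e.cost)
        { s with vreg := Function.update s.vreg k (e.eval inp s) }
  | setVArr (a : ℕ) (i : IExpr) (e : VExpr) (s : State) (hi : i.All inp s iok)
      (he : e.All inp s iok vok) :
      Exec inp iok vok (Prog.setVArr a i e) s (1 + i.cost + e.cost)
        { s with varr :=
            Function.update s.varr a (Function.update (s.varr a) (i.eval inp s) (e.eval inp s)) }
  | seq (P Q : Prog) (s s' s'' : State) (T T' : ℕ) (hP : Exec inp iok vok P s T s')
      (hQ : Exec inp iok vok Q s' T' s'') :
      Exec inp iok vok (Prog.seq P Q) s (T + T') s''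
  | iteTrue (c : Cond) (P Q : Prog) (s s' : State) (T : ℕ) (hc : c.All inp s iok vok)
      (h : c.Holds inp s) (hP : Exec inp iok vok P s T s') :
      Exec inp iok vok (Prog.ite c P Q) s (1 + c.cost + T) s'
  | iteFalse (c : Cond) (P Q : Prog) (s s' : State) (T : ℕ) (hc : c.All inp s iok vok)
      (h : ¬ c.Holds inp s) (hQ : Exec inp iok vok Q s T s') :
      Exec inp iok vok (Prog.ite c P Q) s (1 + c.cost + T) s'
  | whileFalse (c : Cond) (P : Prog) (s : State) (hc : c.All inp s iok vok)
      (h : ¬ c.Holds inp s) :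
      Exec inp iok vok (Prog.while c P) s (1 + c.cost) s
  | whileTrue (c : Cond) (P : Prog) (s s' s'' : State) (T T' : ℕ) (hc : c.All inp s iok vok)
      (h : c.Holds inp s) (hP : Exec inp iok vok P s T s')
      (hW : Exec inp iok vok (Prog.while c P) s' T' s'') :
      Exec inp iok vok (Prog.while c P) s (1 + c.cost + T + T') s''

/-! ## Inputs, outputs and number sizes -/

/-- The table with the rows `g i 0, ..., g i (len i - 1)` for `i < n`, and zero elsewhere. -/
def table {n : ℕ} {R : Type} [Zero R] (len : Fin n → ℕ) (g : Fin n → ℕ → R) (i j : ℤ) : R :=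
  if h : 0 ≤ i ∧ i < (n : ℤ) then
    if 0 ≤ j ∧ j < (len ⟨i.toNat, by omega⟩ : ℤ) then g ⟨i.toNat, by omega⟩ j.toNat else 0
  else 0

variable {n : ℕ}

/-- Piecewise linear objective: the input consists of `n`, `W`, `p`, the tables of the weights, of
the upper bounds and of the end points of the pieces, and the tables of the slopes and of the
constant terms. -/
def plinInput {p : ℕ} (K : Problem n) (D : PiecewiseLinear n p) : Input where
  n := n
  W := K.W
  par := p
  itab := fun a =>
    if a = 0 then table (fun _ => 1) (fun i _ => (K.w i : ℤ))
    else if a = 1 then table (fun _ => 1) (fun i _ => (K.u i : ℤ))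
    else if a = 2 then table (fun _ => p + 1) D.t
    else fun _ _ => 0
  vtab := fun a =>
    if a = 0 then table (fun _ => p) D.α
    else if a = 1 then table (fun _ => p) D.β
    else fun _ _ => 0

/-- Objective given by an evaluation oracle: the input consists of `n`, `W` and the tables of the
weights and of the upper bounds; `f i x` can be queried for `0 ≤ x ≤ u i`. -/
def oracleInput (K : Problem n) : Input where
  n := n
  W := K.W
  par := 0
  itab := fun a =>
    if a = 0 then table (fun _ => 1) (fun i _ => (K.w i : ℤ))
    else if a = 1 then table (fun _ => 1) (fun i _ => (K.u i : ℤ))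
    else fun _ _ => 0
  vtab := fun a =>
    if a = 0 then table (fun i => K.u i + 1) (fun i x => K.f i (x : ℤ))
    else fun _ _ => 0

/-- Polynomial objective: the input consists of `n`, `W`, `d`, the tables of the weights and of the
upper bounds, and the table of the coefficients of the polynomials. -/
def polyInput (K : Problem n) (d : ℕ) (q : Fin n → Polynomial ℤ) : Input where
  n := n
  W := K.W
  par := d
  itab := fun a =>
    if a = 0 then table (fun _ => 1) (fun i _ => (K.w i : ℤ))
    else if a = 1 then table (fun _ => 1) (fun i _ => (K.u i : ℤ))
    else fun _ _ => 0
  vtab := fun a =>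
    if a = 0 then table (fun _ => d + 1) (fun i k => (((q i).coeff k : ℤ) : ℝ))
    else fun _ _ => 0

/-- The final memory holds the correct answer: either the integer register `0` holds `1`, the
integer array `0` holds an optimal solution and the value register `0` its objective value, or the
integer register `0` holds `0` and there is no feasible solution. -/
def IsAnswer (K : Problem n) (sense : Sense) (s : State) : Prop :=
  (s.ireg 0 = 1 ∧ K.IsOptimal sense (fun i => s.iarr 0 ((i : ℕ) : ℤ)) ∧
      s.vreg 0 = K.objective (fun i => s.iarr 0 ((i : ℕ) : ℤ))) ∨
    (s.ireg 0 = 0 ∧ ¬ ∃ x, K.Feasible x)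

/-- `n`, `W`, the parameter `m`, all weights and all upper bounds are at most `B`. -/
def Problem.IntsLE (K : Problem n) (m B : ℕ) : Prop :=
  n ≤ B ∧ K.W ≤ B ∧ m ≤ B ∧ ∀ i, K.w i ≤ B ∧ K.u i ≤ B

/-- The absolute values of the end points of the pieces are at most `B`. -/
def PiecewiseLinear.EndsLE {p : ℕ} (D : PiecewiseLinear n p) (B : ℕ) : Prop :=
  ∀ i, ∀ k ≤ p, |D.t i k| ≤ (B : ℤ)

/-- The real number `v` is an integer of absolute value at most `B`. -/
def IsIntLE (B : ℕ) (v : ℝ) : Prop := ∃ z : ℤ, v = (z : ℝ) ∧ |z| ≤ (B : ℤ)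

/-- All slopes and constant terms are integers of absolute value at most `B`. -/
def PiecewiseLinear.CoeffsLE {p : ℕ} (D : PiecewiseLinear n p) (B : ℕ) : Prop :=
  ∀ i, ∀ k < p, IsIntLE B (D.α i k) ∧ IsIntLE B (D.β i k)

/-- All values `f i x`, where `0 ≤ x ≤ u i`, are integers of absolute value at most `B`. -/
def Problem.ValuesLE (K : Problem n) (B : ℕ) : Prop :=
  ∀ i, ∀ x : ℤ, 0 ≤ x → x ≤ (K.u i : ℤ) → IsIntLE B (K.f i x)

/-- All coefficients are at most `B` in absolute value. -/
def PolyCoeffsLE (q : Fin n → Polynomial ℤ) (B : ℕ) : Prop :=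
  ∀ i k, |(q i).coeff k| ≤ (B : ℤ)

end

end Knap

/-! The algorithm is dynamic programming over the items. Layer `i` holds, for every attainable sum
`0 ≤ y ≤ W`, the best value of the items `0, ..., i` with total weight `y` and a number of items of
kind `i` that attains it; an optimal solution is read off backwards. Minimization is maximization of
the negated objective.

For an item of weight `w`, sums interact only within a residue class modulo `w`. Sorting the sums by
residue and then by size (`sumPos`) turns the use of `t` items into a shift by `t` positions. A
layer is then an upper envelope of functions `p ↦ A (x - 1) + F (p - x + 1)`, one for each sum
attained before, where `A` is the preceding layer and `F` the summand.

If `F` is convex or concave on a range of arguments, the difference of two such functions is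
monotone on their common domain (`singleCrossing_of_piece`), so they cross at most once. The
envelope is kept in a segment tree with at most one function per node. A newcomer is compared with
the resident in the middle of the node; the winner stays, and the loser can be better on one half
only, to which it descends (`Pending.left`, `Pending.right`) or is discarded (`Pending.drop`). The
domain of a function is an interval, hence covered by `O(log W)` nodes, and a descent has `O(log W)`
steps. One piece of `F` thus costs `O(W log² W)`; if it is affine, differences are constant
(`noCrossing_of_piece`), no descent goes beyond one step, and the cost is `O(W log W)`.

Piecewise linear summands have `p` affine pieces. A concave summand is a single piece, convex after
a change of sign. The second difference of a polynomial of degree at most `d` is again such a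
polynomial, so it has few sign changes (`fewTurns_of_eval`), and a greedy scan finds at most `d + 1`
pieces (`ScanInv.np_le`).

The resulting times, `O(n W log² W)` for concave summands and `O(d n W log² W)` for polynomials,
imply the claimed ones: `W ≤ W ^ (1 + e) * w ^ (-e)` for `0 < w ≤ W` and `e ≥ 0`
(`le_rpow_mul_rpow`), applied with `e = 1 / 3` and `e = (σ - 1) / σ`, where `σ ≥ 1`. The first layer
needs no envelope and no logarithms, which is why the sums over the weights may omit the first item.

The sizes of numbers are controlled along with the time: stored numbers obey fixed bounds, and every
expression in the programs has cost at most `40` and constants at most `2`, so that intermediate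
results are at most the 40th power of these bounds. -/

namespace Knap

noncomputable section

/-! ## A weakest precondition calculus with costs -/

namespace State

/-- Assignment to an integer register. -/
def setI (s : State) (k : ℕ) (z : ℤ) : State := { s with ireg := Function.update s.ireg k z }

/-- Assignment to an entry of an integer array. -/
def setIA (s : State) (a : ℕ) (i z : ℤ) : State :=
  { s with iarr := Function.update s.iarr a (Function.update (s.iarr a) i z) }

/-- Assignment to a value register. -/
def setV (s : State) (k : ℕ) (v : ℝ) : State := { s with vreg := Function.update s.vreg k v }

/-- Assignment to an entry of a value array. -/
def setVA (s : State) (a : ℕ) (i : ℤ) (v : ℝ) : State :=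
  { s with varr := Function.update s.varr a (Function.update (s.varr a) i v) }

variable (s : State) (k a : ℕ) (i z : ℤ) (v : ℝ)

theorem setI_ireg (j : ℕ) : (s.setI k z).ireg j = if j = k then z else s.ireg j := by
  simp [setI, Function.update_apply]
theorem setI_iarr : (s.setI k z).iarr = s.iarr := rfl
theorem setI_vreg : (s.setI k z).vreg = s.vreg := rfl
theorem setI_varr : (s.setI k z).varr = s.varr := rfl
theorem setIA_ireg : (s.setIA a i z).ireg = s.ireg := rfl
theorem setIA_iarr (c : ℕ) :
    (s.setIA a i z).iarr c = if c = a then Function.update (s.iarr a) i z else s.iarr c := by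
  simp [setIA, Function.update_apply]
theorem setIA_vreg : (s.setIA a i z).vreg = s.vreg := rfl
theorem setIA_varr : (s.setIA a i z).varr = s.varr := rfl
theorem setV_ireg : (s.setV k v).ireg = s.ireg := rfl
theorem setV_iarr : (s.setV k v).iarr = s.iarr := rfl
theorem setV_vreg (j : ℕ) : (s.setV k v).vreg j = if j = k then v else s.vreg j := by
  simp [setV, Function.update_apply]
theorem setV_varr : (s.setV k v).varr = s.varr := rfl
theorem setVA_ireg : (s.setVA a i v).ireg = s.ireg := rfl
theorem setVA_iarr : (s.setVA a i v).iarr = s.iarr := rfl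
theorem setVA_vreg : (s.setVA a i v).vreg = s.vreg := rfl
theorem setVA_varr (c : ℕ) :
    (s.setVA a i v).varr c = if c = a then Function.update (s.varr a) i v else s.varr c := by
  simp [setVA, Function.update_apply]

end State

/-- The input of a computation, a bound `b` for the stored integers, and a set `V` of bounds for
the stored values. -/
structure Env where
  /-- the input -/
  inp : Input
  /-- bound for the stored integers -/
  b : ℕ
  /-- bounds for the stored values -/
  V : Set ℕ

namespace Env

variable (E : Env)

/-- The value `v` may be stored. -/
def VOk (v : ℝ) : Prop := ∀ m ∈ E.V, IsIntLE m v

/-- Integers that may arise in the evaluation of expressions. -/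
def iok (z : ℤ) : Prop := |z| ≤ (E.b : ℤ) ^ 40

/-- Values that may arise in the evaluation of expressions. -/
def vok (v : ℝ) : Prop := ∀ m ∈ E.V, IsIntLE (m ^ 40) v

/-- All stored numbers obey the bounds. -/
structure Good (s : State) : Prop where
  ireg : ∀ k, |s.ireg k| ≤ (E.b : ℤ)
  iarr : ∀ a i, |s.iarr a i| ≤ (E.b : ℤ)
  vreg : ∀ k, E.VOk (s.vreg k)
  varr : ∀ a i, E.VOk (s.varr a i)

/-- All input numbers obey the bounds. -/
structure Valid : Prop where
  two_le : 2 ≤ E.b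
  itab : ∀ a i j, |E.inp.itab a i j| ≤ (E.b : ℤ)
  vtab : ∀ a i j, E.VOk (E.inp.vtab a i j)
  b_le : ∀ m ∈ E.V, E.b ≤ m

end Env

/-- All constants of the expression are at most `2` in absolute value. -/
def IExpr.small : IExpr → Bool
  | const z => z.natAbs ≤ 2
  | reg _ => true
  | get _ i => i.small
  | input _ i j => i.small && j.small
  | add x y => x.small && y.small
  | sub x y => x.small && y.small
  | mul x y => x.small && y.small
  | div x y => x.small && y.small
  | mod x y => x.small && y.small

/-- All constants of the expression are at most `2` in absolute value. -/
def VExpr.small : VExpr → Bool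
  | ofInt e => e.small
  | reg _ => true
  | get _ i => i.small
  | input _ i j => i.small && j.small
  | add x y => x.small && y.small
  | sub x y => x.small && y.small
  | mul x y => x.small && y.small

/-- Constants and cost of the expression are small. -/
def IExpr.ok (e : IExpr) : Bool := e.small && decide (e.cost ≤ 40)

/-- Constants and cost of the expression are small. -/
def VExpr.ok (e : VExpr) : Bool := e.small && decide (e.cost ≤ 40)

/-- Constants and costs of all expressions of the test are small. -/
def Cond.ok : Cond → Bool
  | ile x y => x.ok && y.ok
  | vle x y => x.ok && y.ok
  | not c => c.ok
  | and c e => c.ok && e.ok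

theorem IExpr.cost_pos (e : IExpr) : 1 ≤ e.cost := by
  cases e <;> simp only [IExpr.cost] <;> omega

theorem VExpr.cost_pos (e : VExpr) : 1 ≤ e.cost := by
  cases e <;> simp only [VExpr.cost] <;> omega

/-- The exponent `1 + k + l` is the cost of an operation whose operands cost `k` and `l`; this lets
the cost of an expression serve as the exponent of its size bound. -/
theorem pow_add_pow_le {b : ℤ} (hb : 2 ≤ b) (k l : ℕ) : b ^ k + b ^ l ≤ b ^ (1 + k + l) := by
  have h1 : (1 : ℤ) ≤ b ^ k := one_le_pow₀ (by omega)
  have h2 : (1 : ℤ) ≤ b ^ l := one_le_pow₀ (by omega)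
  rw [pow_add, pow_add, pow_one]
  nlinarith [mul_nonneg (sub_nonneg.2 h1) (sub_nonneg.2 h2),
    mul_le_mul_of_nonneg_right hb (mul_nonneg (by positivity : (0 : ℤ) ≤ b ^ k)
      (by positivity : (0 : ℤ) ≤ b ^ l))]

theorem pow_mul_pow_le {b : ℤ} (hb : 2 ≤ b) (k l : ℕ) : b ^ k * b ^ l ≤ b ^ (1 + k + l) := by
  rw [← pow_add]
  exact pow_le_pow_right₀ (by omega) (by omega)

/-! ### Sizes of the values of expressions -/

namespace IExpr

variable {E : Env} {s : State}

/-- Induction on the expression. Constants are at most `2 ≤ b`, stored and input numbers at most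
`b`, and each operation fits into the exponent that its cost provides. -/
theorem abs_eval_le (hE : E.Valid) (hs : E.Good s) (e : IExpr) (he : e.small = true) :
    |e.eval E.inp s| ≤ (E.b : ℤ) ^ e.cost := by
  have hb : (2 : ℤ) ≤ E.b := by exact_mod_cast hE.two_le
  have hself : ∀ k : ℕ, 1 ≤ k → (E.b : ℤ) ≤ (E.b : ℤ) ^ k := fun k hk =>
    le_self_pow₀ (by omega) (by omega)
  induction e with
  | const z =>
    simp only [small, decide_eq_true_eq] at he
    simp only [eval, cost, pow_one]
    rw [Int.abs_eq_natAbs]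
    omega
  | reg k => simpa [eval, cost] using hs.ireg k
  | get a i _ => exact (hs.iarr _ _).trans (hself _ (cost_pos _))
  | input a i j _ _ => exact (hE.itab _ _ _).trans (hself _ (cost_pos _))
  | add x y hx hy =>
    simp only [small, Bool.and_eq_true] at he
    exact (abs_add_le _ _).trans ((add_le_add (hx he.1) (hy he.2)).trans (pow_add_pow_le hb _ _))
  | sub x y hx hy =>
    simp only [small, Bool.and_eq_true] at he
    exact (abs_sub _ _).trans ((add_le_add (hx he.1) (hy he.2)).trans (pow_add_pow_le hb _ _))
  | mul x y hx hy =>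
    simp only [small, Bool.and_eq_true] at he
    simp only [eval, cost, abs_mul]
    exact (mul_le_mul (hx he.1) (hy he.2) (abs_nonneg _) (by positivity)).trans
      (pow_mul_pow_le hb _ _)
  | div x y hx hy =>
    simp only [small, Bool.and_eq_true] at he
    have h : |x.eval E.inp s / y.eval E.inp s| ≤ |x.eval E.inp s| := by
      rw [Int.abs_eq_natAbs, Int.abs_eq_natAbs]
      exact_mod_cast Int.natAbs_ediv_le_natAbs (x.eval E.inp s) (y.eval E.inp s)
    exact h.trans ((hx he.1).trans (pow_le_pow_right₀ (by omega) (by simp only [cost]; omega)))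
  | mod x y hx hy =>
    simp only [small, Bool.and_eq_true] at he
    have h : |x.eval E.inp s % y.eval E.inp s| ≤ |x.eval E.inp s| + |y.eval E.inp s| := by
      -- The remainder modulo `0` is the dividend itself.
      rcases eq_or_ne (y.eval E.inp s) 0 with h0 | h0
      · simp [h0]
      · have h1 := Int.emod_nonneg (x.eval E.inp s) h0
        have h2 := Int.emod_lt_abs (x.eval E.inp s) h0
        rw [abs_of_nonneg h1]
        have := abs_nonneg (x.eval E.inp s)
        omega
    exact h.trans ((add_le_add (hx he.1) (hy he.2)).trans (pow_add_pow_le hb _ _))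

theorem iok_eval (hE : E.Valid) (hs : E.Good s) (e : IExpr) (he : e.small = true)
    (hc : e.cost ≤ 40) : E.iok (e.eval E.inp s) :=
  (abs_eval_le hE hs e he).trans
    (pow_le_pow_right₀ (by have := hE.two_le; omega) hc)

theorem all_of_small (hE : E.Valid) (hs : E.Good s) (e : IExpr) (he : e.small = true)
    (hc : e.cost ≤ 40) : e.All E.inp s E.iok := by
  have hev := iok_eval hE hs e he hc
  induction e with
  | const z => exact hev
  | reg k => exact hev
  | get a i ih =>
    simp only [small, cost] at he hc
    exact ⟨ih he (by omega) (iok_eval hE hs i he (by omega)), hev⟩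
  | input a i j ih jh =>
    simp only [small, cost, Bool.and_eq_true] at he hc
    exact ⟨ih he.1 (by omega) (iok_eval hE hs i he.1 (by omega)),
      jh he.2 (by omega) (iok_eval hE hs j he.2 (by omega)), hev⟩
  | add i j ih jh | sub i j ih jh | mul i j ih jh | div i j ih jh | mod i j ih jh =>
    simp only [small, cost, Bool.and_eq_true] at he hc
    exact ⟨ih he.1 (by omega) (iok_eval hE hs i he.1 (by omega)),
      jh he.2 (by omega) (iok_eval hE hs j he.2 (by omega)), hev⟩

theorem all_of_ok (hE : E.Valid) (hs : E.Good s) {e : IExpr} (he : e.ok = true) :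
    e.All E.inp s E.iok := by
  simp only [ok, Bool.and_eq_true, decide_eq_true_eq] at he
  exact all_of_small hE hs e he.1 he.2

end IExpr

theorem IsIntLE.mono {m k : ℕ} {v : ℝ} (h : IsIntLE m v) (hmk : m ≤ k) : IsIntLE k v := by
  obtain ⟨z, hz, hm⟩ := h
  exact ⟨z, hz, hm.trans (by exact_mod_cast hmk)⟩

theorem IsIntLE.add {m k : ℕ} {v w : ℝ} (h : IsIntLE m v) (h' : IsIntLE k w) :
    IsIntLE (m + k) (v + w) := by
  obtain ⟨z, rfl, hm⟩ := h
  obtain ⟨y, rfl, hk⟩ := h'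
  exact ⟨z + y, by push_cast; ring, (abs_add_le _ _).trans (by push_cast; omega)⟩

theorem IsIntLE.neg {m : ℕ} {v : ℝ} (h : IsIntLE m v) : IsIntLE m (-v) := by
  obtain ⟨z, rfl, hm⟩ := h
  exact ⟨-z, by push_cast; ring, by rwa [abs_neg]⟩

theorem IsIntLE.sub {m k : ℕ} {v w : ℝ} (h : IsIntLE m v) (h' : IsIntLE k w) :
    IsIntLE (m + k) (v - w) := by
  rw [sub_eq_add_neg]
  exact h.add h'.neg

theorem IsIntLE.mul {m k : ℕ} {v w : ℝ} (h : IsIntLE m v) (h' : IsIntLE k w) :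
    IsIntLE (m * k) (v * w) := by
  obtain ⟨z, rfl, hm⟩ := h
  obtain ⟨y, rfl, hk⟩ := h'
  refine ⟨z * y, by push_cast; ring, ?_⟩
  rw [abs_mul]
  push_cast
  exact mul_le_mul hm hk (abs_nonneg _) (by positivity)

theorem IsIntLE.zero (m : ℕ) : IsIntLE m 0 := ⟨0, by simp, by simp⟩

theorem IsIntLE.intCast {m : ℕ} {z : ℤ} (h : |z| ≤ (m : ℤ)) : IsIntLE m (z : ℝ) := ⟨z, rfl, h⟩

namespace VExpr

variable {E : Env} {s : State}

/-- The integers that are converted to values are covered because `E.b ≤ m`. Each `m ∈ E.V` is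
treated separately; in particular, an empty `E.V` leaves the values arbitrary reals. -/
theorem isIntLE_eval (hE : E.Valid) (hs : E.Good s) (e : VExpr) (he : e.small = true) {m : ℕ}
    (hm : m ∈ E.V) : IsIntLE (m ^ e.cost) (e.eval E.inp s) := by
  have hbm := hE.b_le m hm
  have hm2 : 2 ≤ m := hE.two_le.trans hbm
  have hself : ∀ k : ℕ, 1 ≤ k → m ≤ m ^ k := fun k hk => le_self_pow₀ (by omega) (by omega)
  have hadd : ∀ k l : ℕ, m ^ k + m ^ l ≤ m ^ (1 + k + l) := fun k l => by
    exact_mod_cast pow_add_pow_le (b := (m : ℤ)) (by exact_mod_cast hm2) k l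
  have hmul : ∀ k l : ℕ, m ^ k * m ^ l ≤ m ^ (1 + k + l) := fun k l => by
    exact_mod_cast pow_mul_pow_le (b := (m : ℤ)) (by exact_mod_cast hm2) k l
  induction e with
  | ofInt e =>
    refine IsIntLE.intCast ((IExpr.abs_eval_le hE hs e he).trans ?_)
    have h1 : E.b ^ e.cost ≤ m ^ (ofInt e).cost :=
      (Nat.pow_le_pow_left hbm _).trans
        (Nat.pow_le_pow_right (by omega) (by simp only [cost]; omega))
    exact_mod_cast h1
  | reg k => exact (hs.vreg k m hm).mono (hself _ (cost_pos _))
  | get a i => exact (hs.varr _ _ m hm).mono (hself _ (cost_pos _))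
  | input a i j => exact (hE.vtab _ _ _ m hm).mono (hself _ (cost_pos _))
  | add x y hx hy =>
    simp only [small, Bool.and_eq_true] at he
    exact ((hx he.1).add (hy he.2)).mono (hadd _ _)
  | sub x y hx hy =>
    simp only [small, Bool.and_eq_true] at he
    exact ((hx he.1).sub (hy he.2)).mono (hadd _ _)
  | mul x y hx hy =>
    simp only [small, Bool.and_eq_true] at he
    exact ((hx he.1).mul (hy he.2)).mono (hmul _ _)

theorem vok_eval (hE : E.Valid) (hs : E.Good s) (e : VExpr) (he : e.small = true)
    (hc : e.cost ≤ 40) : E.vok (e.eval E.inp s) := fun m hm =>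
  (isIntLE_eval hE hs e he hm).mono
    (Nat.pow_le_pow_right (by have := hE.two_le; have := hE.b_le m hm; omega) hc)

theorem all_of_small (hE : E.Valid) (hs : E.Good s) (e : VExpr) (he : e.small = true)
    (hc : e.cost ≤ 40) : e.All E.inp s E.iok E.vok := by
  have hev := vok_eval hE hs e he hc
  induction e with
  | ofInt e =>
    simp only [small, cost] at he hc
    exact ⟨IExpr.all_of_small hE hs e he (by omega), hev⟩
  | reg k => exact hev
  | get a i =>
    simp only [small, cost] at he hc
    exact ⟨IExpr.all_of_small hE hs i he (by omega), hev⟩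
  | input a i j =>
    simp only [small, cost, Bool.and_eq_true] at he hc
    exact ⟨IExpr.all_of_small hE hs i he.1 (by omega),
      IExpr.all_of_small hE hs j he.2 (by omega), hev⟩
  | add i j ih jh | sub i j ih jh | mul i j ih jh =>
    simp only [small, cost, Bool.and_eq_true] at he hc
    exact ⟨ih he.1 (by omega) (vok_eval hE hs i he.1 (by omega)),
      jh he.2 (by omega) (vok_eval hE hs j he.2 (by omega)), hev⟩

theorem all_of_ok (hE : E.Valid) (hs : E.Good s) {e : VExpr} (he : e.ok = true) :
    e.All E.inp s E.iok E.vok := by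
  simp only [ok, Bool.and_eq_true, decide_eq_true_eq] at he
  exact all_of_small hE hs e he.1 he.2

end VExpr

theorem Cond.all_of_ok {E : Env} {s : State} (hE : E.Valid) (hs : E.Good s) {c : Cond}
    (hc : c.ok = true) : c.All E.inp s E.iok E.vok := by
  induction c with
  | ile x y =>
    simp only [ok, Bool.and_eq_true] at hc
    exact ⟨IExpr.all_of_ok hE hs hc.1, IExpr.all_of_ok hE hs hc.2⟩
  | vle x y =>
    simp only [ok, Bool.and_eq_true] at hc
    exact ⟨VExpr.all_of_ok hE hs hc.1, VExpr.all_of_ok hE hs hc.2⟩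
  | not c ih => exact ih hc
  | and c e ihc ihe =>
    simp only [ok, Bool.and_eq_true] at hc
    exact ⟨ihc hc.1, ihe hc.2⟩

namespace Env.Good

variable {E : Env} {s : State}

theorem setI (hs : E.Good s) {k : ℕ} {z : ℤ} (hz : |z| ≤ (E.b : ℤ)) : E.Good (s.setI k z) :=
  ⟨fun j => by rw [State.setI_ireg]; split_ifs; exacts [hz, hs.ireg j],
    hs.iarr, hs.vreg, hs.varr⟩

theorem setIA (hs : E.Good s) {a : ℕ} {i z : ℤ} (hz : |z| ≤ (E.b : ℤ)) :
    E.Good (s.setIA a i z) :=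
  ⟨hs.ireg, fun c j => by
    rw [State.setIA_iarr]
    split_ifs
    · rw [Function.update_apply]
      split_ifs
      exacts [hz, hs.iarr _ _]
    · exact hs.iarr _ _, hs.vreg, hs.varr⟩

theorem setV (hs : E.Good s) {k : ℕ} {v : ℝ} (hv : E.VOk v) : E.Good (s.setV k v) :=
  ⟨hs.ireg, hs.iarr,
    fun j => by rw [State.setV_vreg]; split_ifs; exacts [hv, hs.vreg j], hs.varr⟩

theorem setVA (hs : E.Good s) {a : ℕ} {i : ℤ} {v : ℝ} (hv : E.VOk v) :
    E.Good (s.setVA a i v) :=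
  ⟨hs.ireg, hs.iarr, hs.vreg, fun c j => by
    rw [State.setVA_varr]
    split_ifs
    · rw [Function.update_apply]
      split_ifs
      exacts [hv, hs.varr _ _]
    · exact hs.varr _ _⟩

end Env.Good

/-- Started in `s`, the program terminates after `T` steps in a state `s'` with `Q T s'`, and
stays within the bounds. -/
def Terminates (E : Env) (P : Prog) (s : State) (Q : ℕ → State → Prop) : Prop :=
  E.Good s → ∃ T s', Exec E.inp E.iok E.vok P s T s' ∧ E.Good s' ∧ Q T s'

/-- A sufficient condition for `Terminates`, computed along the program up to loops. -/
def wp (E : Env) : Prog → State → (ℕ → State → Prop) → Prop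
  | .skip, s, Q => Q 1 s
  | .setReg k e, s, Q => e.ok = true ∧ (E.Good s → |e.eval E.inp s| ≤ (E.b : ℤ)) ∧
      Q (1 + e.cost) (s.setI k (e.eval E.inp s))
  | .setArr a i e, s, Q => (i.ok && e.ok) = true ∧ (E.Good s → |e.eval E.inp s| ≤ (E.b : ℤ)) ∧
      Q (1 + i.cost + e.cost) (s.setIA a (i.eval E.inp s) (e.eval E.inp s))
  | .setVReg k e, s, Q => e.ok = true ∧ (E.Good s → E.VOk (e.eval E.inp s)) ∧
      Q (1 + e.cost) (s.setV k (e.eval E.inp s))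
  | .setVArr a i e, s, Q => (i.ok && e.ok) = true ∧ (E.Good s → E.VOk (e.eval E.inp s)) ∧
      Q (1 + i.cost + e.cost) (s.setVA a (i.eval E.inp s) (e.eval E.inp s))
  | .seq P P', s, Q => wp E P s fun T s' => wp E P' s' fun T' s'' => Q (T + T') s''
  | .ite c P P', s, Q => c.ok = true ∧
      (c.Holds E.inp s → wp E P s fun T s' => Q (1 + c.cost + T) s') ∧
      (¬ c.Holds E.inp s → wp E P' s fun T s' => Q (1 + c.cost + T) s')
  | .while c P, s, Q => Terminates E (.while c P) s Q

variable {E : Env}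

theorem Terminates.mono {P : Prog} {s : State} {Q Q' : ℕ → State → Prop}
    (h : Terminates E P s Q) (hQ : ∀ T s', Q T s' → Q' T s') : Terminates E P s Q' := by
  intro hs
  obtain ⟨T, s', h1, h2, h3⟩ := h hs
  exact ⟨T, s', h1, h2, hQ _ _ h3⟩

/-- The bounds for intermediate results follow from the syntactic check `ok` and the invariant
`Good`, so only assigned numbers carry a proof obligation in `wp`. -/
theorem terminates_of_wp (hE : E.Valid) {P : Prog} {s : State} {Q : ℕ → State → Prop}
    (h : wp E P s Q) : Terminates E P s Q := by
  induction P generalizing s Q with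
  | skip => exact fun hs => ⟨_, _, .skip s, hs, h⟩
  | setReg k e =>
    exact fun hs => ⟨_, _, .setReg k e s (IExpr.all_of_ok hE hs h.1), hs.setI (h.2.1 hs), h.2.2⟩
  | setArr a i e =>
    intro hs
    obtain ⟨h1, h2, h3⟩ := h
    rw [Bool.and_eq_true] at h1
    exact ⟨_, _, .setArr a i e s (IExpr.all_of_ok hE hs h1.1) (IExpr.all_of_ok hE hs h1.2),
      hs.setIA (h2 hs), h3⟩
  | setVReg k e =>
    exact fun hs => ⟨_, _, .setVReg k e s (VExpr.all_of_ok hE hs h.1), hs.setV (h.2.1 hs), h.2.2⟩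
  | setVArr a i e =>
    intro hs
    obtain ⟨h1, h2, h3⟩ := h
    rw [Bool.and_eq_true] at h1
    exact ⟨_, _, .setVArr a i e s (IExpr.all_of_ok hE hs h1.1) (VExpr.all_of_ok hE hs h1.2),
      hs.setVA (h2 hs), h3⟩
  | seq P P' ih ih' =>
    intro hs
    obtain ⟨T, s', h1, h2, h3⟩ := ih h hs
    obtain ⟨T', s'', h1', h2', h3'⟩ := ih' h3 h2
    exact ⟨_, _, .seq _ _ _ _ _ _ _ h1 h1', h2', h3'⟩
  | ite c P P' ih ih' =>
    intro hs
    obtain ⟨h0, ht, hf⟩ := h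
    by_cases hc : c.Holds E.inp s
    · obtain ⟨T, s', h1, h2, h3⟩ := ih (ht hc) hs
      exact ⟨_, _, .iteTrue _ _ _ _ _ _ (Cond.all_of_ok hE hs h0) hc h1, h2, h3⟩
    · obtain ⟨T, s', h1, h2, h3⟩ := ih' (hf hc) hs
      exact ⟨_, _, .iteFalse _ _ _ _ _ _ (Cond.all_of_ok hE hs h0) hc h1, h2, h3⟩
  | _ => exact h

theorem wp_mono {P : Prog} {s : State} {Q Q' : ℕ → State → Prop}
    (h : wp E P s Q) (hQ : ∀ T s', Q T s' → Q' T s') : wp E P s Q' := by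
  induction P generalizing s Q Q' with
  | skip => exact hQ _ _ h
  | setReg k e | setVReg k e | setArr a i e | setVArr a i e => exact ⟨h.1, h.2.1, hQ _ _ h.2.2⟩
  | seq P P' ih ih' => exact ih h fun T s' h' => ih' h' fun _ _ => hQ _ _
  | ite c P P' ih ih' =>
    exact ⟨h.1, fun hc => ih (h.2.1 hc) fun _ _ => hQ _ _,
      fun hc => ih' (h.2.2 hc) fun _ _ => hQ _ _⟩
  | _ => exact Terminates.mono h hQ

/-- The program may assign to the integer register `k`. -/
def Prog.writesI (k : ℕ) : Prog → Bool
  | .setReg j _ => k == j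
  | .seq P P' => P.writesI k || P'.writesI k
  | .ite _ P P' => P.writesI k || P'.writesI k
  | .while _ P => P.writesI k
  | _ => false

/-- The program may assign to the integer array `k`. -/
def Prog.writesIA (k : ℕ) : Prog → Bool
  | .setArr j _ _ => k == j
  | .seq P P' => P.writesIA k || P'.writesIA k
  | .ite _ P P' => P.writesIA k || P'.writesIA k
  | .while _ P => P.writesIA k
  | _ => false

/-- The program may assign to the value array `k`. -/
def Prog.writesVA (k : ℕ) : Prog → Bool
  | .setVArr j _ _ => k == j
  | .seq P P' => P.writesVA k || P'.writesVA k
  | .ite _ P P' => P.writesVA k || P'.writesVA k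
  | .while _ P => P.writesVA k
  | _ => false

/-- The states agree on everything that the program does not assign to. -/
structure Frame (P : Prog) (s s' : State) : Prop where
  ireg : ∀ k, P.writesI k = false → s'.ireg k = s.ireg k
  iarr : ∀ k, P.writesIA k = false → s'.iarr k = s.iarr k
  varr : ∀ k, P.writesVA k = false → s'.varr k = s.varr k

/-! ### Parts of the memory that a program leaves unchanged -/

namespace Frame

variable {P P' : Prog} {s s' s'' : State}

theorem refl (P : Prog) (s : State) : Frame P s s :=
  ⟨fun _ _ => rfl, fun _ _ => rfl, fun _ _ => rfl⟩

theorem trans (h : Frame P s s') (h' : Frame P s' s'') : Frame P s s'' :=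
  ⟨fun k hk => (h'.1 k hk).trans (h.1 k hk), fun k hk => (h'.2 k hk).trans (h.2 k hk),
    fun k hk => (h'.3 k hk).trans (h.3 k hk)⟩

theorem seq (h : Frame P s s') (h' : Frame P' s' s'') : Frame (.seq P P') s s'' := by
  constructor <;> intro k hk <;>
    simp only [Prog.writesI, Prog.writesIA, Prog.writesVA, Bool.or_eq_false_iff] at hk
  exacts [(h'.1 k hk.2).trans (h.1 k hk.1), (h'.2 k hk.2).trans (h.2 k hk.1),
    (h'.3 k hk.2).trans (h.3 k hk.1)]

theorem ite_left (c : Cond) (h : Frame P s s') : Frame (.ite c P P') s s' := by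
  constructor <;> intro k hk <;>
    simp only [Prog.writesI, Prog.writesIA, Prog.writesVA, Bool.or_eq_false_iff] at hk
  exacts [h.1 k hk.1, h.2 k hk.1, h.3 k hk.1]

theorem ite_right (c : Cond) (h : Frame P' s s') : Frame (.ite c P P') s s' := by
  constructor <;> intro k hk <;>
    simp only [Prog.writesI, Prog.writesIA, Prog.writesVA, Bool.or_eq_false_iff] at hk
  exacts [h.1 k hk.2, h.2 k hk.2, h.3 k hk.2]

theorem of_exec {inp : Input} {iok : ℤ → Prop} {vok : ℝ → Prop} {T : ℕ}
    (h : Exec inp iok vok P s T s') : Frame P s s' := by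
  induction h with
  | skip s => exact refl _ _
  | setReg k e s _ | setArr k i e s _ _ | setVReg k e s _ | setVArr k i e s _ _ =>
    refine ⟨fun j hj => ?_, fun j hj => ?_, fun j hj => ?_⟩ <;>
      simp only [Prog.writesI, Prog.writesIA, Prog.writesVA, beq_eq_false_iff_ne] at hj <;>
      first
      | rfl
      | exact Function.update_of_ne hj _ _
  | seq P Q s s' s'' T T' _ _ h1 h2 => exact h1.seq h2
  | iteTrue c P Q s s' T _ _ _ h => exact h.ite_left c
  | iteFalse c P Q s s' T _ _ _ h => exact h.ite_right c
  | whileFalse c P s _ _ => exact refl _ _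
  | whileTrue c P s s' s'' T T' _ _ _ _ h1 h2 => exact trans ⟨h1.1, h1.2, h1.3⟩ h2

end Frame

/-- Thanks to this, a specification mentions only what a program changes; that everything else
persists is decided from its syntax. -/
theorem wp_frame {P : Prog} {s : State} {Q : ℕ → State → Prop} (h : wp E P s Q) :
    wp E P s fun T s' => Q T s' ∧ Frame P s s' := by
  induction P generalizing s Q with
  | skip => exact ⟨h, Frame.refl _ _⟩
  | setReg k e | setVReg k e | setArr a i e | setVArr a i e =>
    refine ⟨h.1, h.2.1, h.2.2, ?_⟩
    refine ⟨fun j hj => ?_, fun j hj => ?_, fun j hj => ?_⟩ <;>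
      simp only [Prog.writesI, Prog.writesIA, Prog.writesVA, beq_eq_false_iff_ne] at hj <;>
      first
      | rfl
      | exact Function.update_of_ne hj _ _
  | seq P P' ih ih' =>
    exact wp_mono (P := P) (ih h) fun T s' h' => wp_mono (ih' h'.1) fun T' s'' h'' =>
      ⟨h''.1, h'.2.seq h''.2⟩
  | ite c P P' ih ih' =>
    exact ⟨h.1, fun hc => wp_mono (ih (h.2.1 hc)) fun T s' h' => ⟨h'.1, h'.2.ite_left c⟩,
      fun hc => wp_mono (ih' (h.2.2 hc)) fun T s' h' => ⟨h'.1, h'.2.ite_right c⟩⟩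
  | _ =>
    intro hs
    obtain ⟨T, s', h1, h2, h3⟩ := h hs
    exact ⟨T, s', h1, h2, h3, Frame.of_exec h1⟩

/-- Use of a specification of a part of a program. -/
theorem wp_call {P : Prog} {s : State} {R Q : ℕ → State → Prop} (h : wp E P s R)
    (hQ : ∀ T s', R T s' → Frame P s s' → Q T s') : wp E P s Q :=
  wp_mono (wp_frame h) fun T s' h' => hQ T s' h'.1 h'.2

/-- Loops: `ρ` bounds the number of the remaining iterations, `t` the cost of the body. -/
theorem wp_while (hE : E.Valid) {c : Cond} {P : Prog} (t : ℕ) (Inv : ℕ → State → Prop) {ρ : ℕ}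
    {s : State} (hc : c.ok = true) (hs : Inv ρ s)
    (hP : ∀ ρ s', Frame P s s' → E.Good s' → Inv ρ s' → c.Holds E.inp s' →
      wp E P s' fun T s'' => T ≤ t ∧ 1 ≤ ρ ∧ Inv (ρ - 1) s'') :
    wp E (.while c P) s fun T s' =>
      T ≤ ρ * (t + 1 + c.cost) + 1 + c.cost ∧ ¬ c.Holds E.inp s' ∧ ∃ ρ', Inv ρ' s' := by
  -- The induction runs over all later states of the loop, while the frame stays relative to the
  -- state at its start.
  suffices H : ∀ ρ s', Frame P s s' → Inv ρ s' → Terminates E (.while c P) s' fun T s' =>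
      T ≤ ρ * (t + 1 + c.cost) + 1 + c.cost ∧ ¬ c.Holds E.inp s' ∧ ∃ ρ', Inv ρ' s' from
    H ρ s (Frame.refl _ _) hs
  intro ρ
  induction ρ with
  | zero =>
    intro s' hf hs' hg
    by_cases h : c.Holds E.inp s'
    -- With no iteration left, executing the body would yield `1 ≤ 0`.
    · obtain ⟨T, s'', _, _, _, h4, _⟩ := terminates_of_wp hE (hP 0 s' hf hg hs' h) hg
      omega
    · exact ⟨_, s', .whileFalse _ _ _ (Cond.all_of_ok hE hg hc) h, hg, by omega, h, 0, hs'⟩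
  | succ ρ ih =>
    intro s' hf hs' hg
    by_cases h : c.Holds E.inp s'
    · obtain ⟨T, s'', h1, h2, h3, _, h5⟩ := terminates_of_wp hE (hP _ s' hf hg hs' h) hg
      obtain ⟨T', s₃, g1, g2, g3, g4⟩ := ih s'' (hf.trans (Frame.of_exec h1)) h5 h2
      refine ⟨_, s₃, .whileTrue _ _ _ _ _ _ _ (Cond.all_of_ok hE hg hc) h h1 g1, g2, ?_, g4⟩
      rw [Nat.succ_mul]
      omega
    · exact ⟨_, s', .whileFalse _ _ _ (Cond.all_of_ok hE hg hc) h, hg,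
        by have := Nat.zero_le ((ρ + 1) * (t + 1 + c.cost)); omega, h, _, hs'⟩

theorem IExpr.All.mono {inp : Input} {s : State} {iok iok' : ℤ → Prop}
    (hi : ∀ z, iok z → iok' z) : ∀ {e : IExpr}, e.All inp s iok → e.All inp s iok'
  | .const _, h => hi _ h
  | .reg _, h => hi _ h
  | .get _ _, h => ⟨h.1.mono hi, hi _ h.2⟩
  | .input _ _ _, h => ⟨h.1.mono hi, h.2.1.mono hi, hi _ h.2.2⟩
  | .add _ _, h => ⟨h.1.mono hi, h.2.1.mono hi, hi _ h.2.2⟩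
  | .sub _ _, h => ⟨h.1.mono hi, h.2.1.mono hi, hi _ h.2.2⟩
  | .mul _ _, h => ⟨h.1.mono hi, h.2.1.mono hi, hi _ h.2.2⟩
  | .div _ _, h => ⟨h.1.mono hi, h.2.1.mono hi, hi _ h.2.2⟩
  | .mod _ _, h => ⟨h.1.mono hi, h.2.1.mono hi, hi _ h.2.2⟩

theorem VExpr.All.mono {inp : Input} {s : State} {iok iok' : ℤ → Prop} {vok vok' : ℝ → Prop}
    (hi : ∀ z, iok z → iok' z) (hv : ∀ v, vok v → vok' v) :
    ∀ {e : VExpr}, e.All inp s iok vok → e.All inp s iok' vok'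
  | .ofInt _, h => ⟨h.1.mono hi, hv _ h.2⟩
  | .reg _, h => hv _ h
  | .get _ _, h => ⟨h.1.mono hi, hv _ h.2⟩
  | .input _ _ _, h => ⟨h.1.mono hi, h.2.1.mono hi, hv _ h.2.2⟩
  | .add _ _, h => ⟨h.1.mono hi hv, h.2.1.mono hi hv, hv _ h.2.2⟩
  | .sub _ _, h => ⟨h.1.mono hi hv, h.2.1.mono hi hv, hv _ h.2.2⟩
  | .mul _ _, h => ⟨h.1.mono hi hv, h.2.1.mono hi hv, hv _ h.2.2⟩

theorem Cond.All.mono {inp : Input} {s : State} {iok iok' : ℤ → Prop} {vok vok' : ℝ → Prop}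
    (hi : ∀ z, iok z → iok' z) (hv : ∀ v, vok v → vok' v) :
    ∀ c : Cond, c.All inp s iok vok → c.All inp s iok' vok'
  | .ile _ _, h => ⟨h.1.mono hi, h.2.mono hi⟩
  | .vle _ _, h => ⟨h.1.mono hi hv, h.2.mono hi hv⟩
  | .not c, h => Cond.All.mono hi hv c h
  | .and c e, h => ⟨Cond.All.mono hi hv c h.1, Cond.All.mono hi hv e h.2⟩

/-- Passes from the bounds of an `Env` to those of the final statement, which refer to all
admissible `B`. -/
theorem Exec.mono {inp : Input} {iok iok' : ℤ → Prop} {vok vok' : ℝ → Prop}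
    (hi : ∀ z, iok z → iok' z) (hv : ∀ v, vok v → vok' v) {P : Prog} {s s' : State} {T : ℕ}
    (h : Exec inp iok vok P s T s') : Exec inp iok' vok' P s T s' := by
  induction h with
  | skip s => exact .skip s
  | setReg k e s h => exact .setReg k e s (h.mono hi)
  | setArr k i e s h h' => exact .setArr k i e s (h.mono hi) (h'.mono hi)
  | setVReg k e s h => exact .setVReg k e s (h.mono hi hv)
  | setVArr k i e s h h' => exact .setVArr k i e s (h.mono hi) (h'.mono hi hv)
  | seq P Q s s' s'' T T' _ _ h1 h2 => exact .seq _ _ _ _ _ _ _ h1 h2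
  | iteTrue c P Q s s' T hc h _ ih => exact .iteTrue _ _ _ _ _ _ (hc.mono hi hv _) h ih
  | iteFalse c P Q s s' T hc h _ ih => exact .iteFalse _ _ _ _ _ _ (hc.mono hi hv _) h ih
  | whileFalse c P s hc h => exact .whileFalse _ _ _ (hc.mono hi hv _) h
  | whileTrue c P s s' s'' T T' hc h _ _ h1 h2 =>
    exact .whileTrue _ _ _ _ _ _ _ (hc.mono hi hv _) h h1 h2

end

end Knap

namespace Knap

noncomputable section

/-! ## Notation for programs -/

infixl:65 " +ᵢ " => IExpr.add
infixl:65 " -ᵢ " => IExpr.sub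
infixl:70 " *ᵢ " => IExpr.mul
infixl:70 " /ᵢ " => IExpr.div
infixl:70 " %ᵢ " => IExpr.mod
infixl:65 " +ʳ " => VExpr.add
infixl:65 " -ʳ " => VExpr.sub
infixl:70 " *ʳ " => VExpr.mul
infix:50 " ≤ᵢ " => Cond.ile
infix:50 " ≤ʳ " => Cond.vle
infixr:30 " ;; " => Prog.seq

section

variable {E : Env} {s : State} {Q : ℕ → State → Prop}

@[simp] theorem wp_skip : wp E .skip s Q ↔ Q 1 s := Iff.rfl
@[simp] theorem wp_setReg {k : ℕ} {e : IExpr} : wp E (.setReg k e) s Q ↔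
    e.ok = true ∧ (E.Good s → |e.eval E.inp s| ≤ (E.b : ℤ)) ∧
      Q (1 + e.cost) (s.setI k (e.eval E.inp s)) := Iff.rfl
@[simp] theorem wp_setArr {a : ℕ} {i e : IExpr} : wp E (.setArr a i e) s Q ↔
    (i.ok && e.ok) = true ∧ (E.Good s → |e.eval E.inp s| ≤ (E.b : ℤ)) ∧
      Q (1 + i.cost + e.cost) (s.setIA a (i.eval E.inp s) (e.eval E.inp s)) := Iff.rfl
@[simp] theorem wp_setVReg {k : ℕ} {e : VExpr} : wp E (.setVReg k e) s Q ↔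
    e.ok = true ∧ (E.Good s → E.VOk (e.eval E.inp s)) ∧
      Q (1 + e.cost) (s.setV k (e.eval E.inp s)) := Iff.rfl
@[simp] theorem wp_setVArr {a : ℕ} {i : IExpr} {e : VExpr} : wp E (.setVArr a i e) s Q ↔
    (i.ok && e.ok) = true ∧ (E.Good s → E.VOk (e.eval E.inp s)) ∧
      Q (1 + i.cost + e.cost) (s.setVA a (i.eval E.inp s) (e.eval E.inp s)) := Iff.rfl
@[simp] theorem wp_seq {P P' : Prog} : wp E (P ;; P') s Q ↔
    wp E P s fun T s' => wp E P' s' fun T' s'' => Q (T + T') s'' := Iff.rfl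
@[simp] theorem wp_ite {c : Cond} {P P' : Prog} : wp E (.ite c P P') s Q ↔
    c.ok = true ∧ (c.Holds E.inp s → wp E P s fun T s' => Q (1 + c.cost + T) s') ∧
      (¬ c.Holds E.inp s → wp E P' s fun T s' => Q (1 + c.cost + T) s') := Iff.rfl

end

attribute [simp] IExpr.eval IExpr.cost IExpr.ok IExpr.small VExpr.eval VExpr.cost VExpr.ok
  VExpr.small Cond.Holds Cond.cost Cond.ok State.setI_ireg State.setI_iarr State.setI_vreg
  State.setI_varr State.setIA_ireg State.setIA_iarr State.setIA_vreg State.setIA_varr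
  State.setV_ireg State.setV_iarr State.setV_vreg State.setV_varr State.setVA_ireg
  State.setVA_iarr State.setVA_vreg State.setVA_varr

/-! ## Trees of functions that cross at most once

The nodes of a binary tree over the positions `0, ..., 2 ^ K - 1` are numbered as in a heap; each
node stores the code `x ≥ 1` of a function `φ x` or no function. -/

/-- `v` is a node of height `j`. -/
def IsNode (K j : ℕ) (v : ℤ) : Prop := 2 ^ K ≤ v * 2 ^ j ∧ v * 2 ^ j + 2 ^ j ≤ 2 * 2 ^ K

/-- The position `p` lies below the node `v` of height `j`. -/
def InNode (K j : ℕ) (v p : ℤ) : Prop := v * 2 ^ j ≤ p + 2 ^ K ∧ p + 2 ^ K < v * 2 ^ j + 2 ^ j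

/-- The functions stored in the tree `T` are defined on all positions below their nodes. -/
def TreeSound (K : ℕ) (Dom : ℤ → ℤ → Prop) (T : ℤ → ℤ) : Prop :=
  ∀ j v p, IsNode K j v → 1 ≤ T v → InNode K j v p → Dom (T v) p

/-- Some function stored above the position `p` has at least the value `y` there. -/
def Covers (K : ℕ) (φ : ℤ → ℤ → ℝ) (T : ℤ → ℤ) (p : ℤ) (y : ℝ) : Prop :=
  ∃ j v, IsNode K j v ∧ InNode K j v p ∧ 1 ≤ T v ∧ y ≤ φ (T v) p

/-- Differences of the functions are monotone where both functions are defined. -/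
def SingleCrossing (φ : ℤ → ℤ → ℝ) (Dom : ℤ → ℤ → Prop) : Prop :=
  ∀ x y, (∀ p q, p ≤ q → Dom x p → Dom x q → Dom y p → Dom y q →
      φ x p - φ y p ≤ φ x q - φ y q) ∨
    (∀ p q, p ≤ q → Dom x p → Dom x q → Dom y p → Dom y q →
      φ x q - φ y q ≤ φ x p - φ y p)

/-- Differences of the functions are constant where both functions are defined. -/
def NoCrossing (φ : ℤ → ℤ → ℝ) (Dom : ℤ → ℤ → Prop) : Prop :=
  ∀ x y p q, Dom x p → Dom x q → Dom y p → Dom y q → φ x p - φ y p = φ x q - φ y q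

theorem IsNode.pos {K j : ℕ} {v : ℤ} (h : IsNode K j v) : 1 ≤ v := by
  by_contra hv
  have h1 : v * 2 ^ j ≤ 0 := mul_nonpos_of_nonpos_of_nonneg (by omega) (by positivity)
  have h2 : (0 : ℤ) < 2 ^ K := by positivity
  exact absurd h.1 (by omega)

theorem IsNode.height_le {K j : ℕ} {v : ℤ} (h : IsNode K j v) : j ≤ K := by
  have h1 : (2 : ℤ) ^ j ≤ 2 ^ K := by have := h.1; have := h.2; omega
  exact (pow_le_pow_iff_right₀ (by norm_num)).1 h1

theorem IsNode.lt {K j : ℕ} {v : ℤ} (h : IsNode K j v) : v < 2 * 2 ^ K := by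
  have h1 : (1 : ℤ) ≤ 2 ^ j := one_le_pow₀ (by norm_num)
  have := h.2
  nlinarith [h.pos]

/-- A node satisfies `2 ^ K ≤ v * 2 ^ j < 2 * 2 ^ K`, and raising `j` by one doubles the middle
term. Hence an entry of the tree belongs to one interval of positions only. -/
theorem IsNode.height_unique {K i j : ℕ} {v : ℤ} (hi : IsNode K i v) (hj : IsNode K j v) :
    i = j := by
  have key : ∀ {i j : ℕ}, IsNode K i v → IsNode K j v → ¬ i < j := by
    intro i j hi hj hij
    obtain ⟨d, rfl⟩ := Nat.exists_eq_add_of_lt hij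
    have h1 := hi.1
    have h2 := hj.2
    have h3 : (1 : ℤ) ≤ 2 ^ d := one_le_pow₀ (by norm_num)
    have h4 : (1 : ℤ) ≤ 2 ^ i := one_le_pow₀ (by norm_num)
    have h5 : (2 : ℤ) ^ (i + d + 1) = 2 * (2 ^ i * 2 ^ d) := by ring
    rw [h5] at h2
    have h6 : v * 2 ^ i ≤ v * (2 ^ i * 2 ^ d) :=
      mul_le_mul_of_nonneg_left (le_mul_of_one_le_right (by omega) h3) (by linarith [hi.pos])
    nlinarith
  exact le_antisymm (not_lt.1 (key hj hi)) (not_lt.1 (key hi hj))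

section Pure

variable {K j : ℕ} {φ : ℤ → ℤ → ℝ} {Dom : ℤ → ℤ → Prop} {T : ℤ → ℤ} {x v : ℤ}
  {Ob : ℤ → ℝ → Prop}

theorem TreeSound.update (hT : TreeSound K Dom T) (hv : IsNode K j v)
    (hx : ∀ p, InNode K j v p → Dom x p) : TreeSound K Dom (Function.update T v x) := by
  intro i v' p hv' hT' hp
  rw [Function.update_apply] at hT' ⊢
  split_ifs at hT' ⊢ with h
  · subst h
    rw [hv'.height_unique hv] at hp
    exact hx p hp
  · exact hT _ _ _ hv' hT' hp

theorem Covers.update_self {p : ℤ} {y : ℝ} (hv : IsNode K j v) (hp : InNode K j v p) (hx : 1 ≤ x)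
    (hy : y ≤ φ x p) : Covers K φ (Function.update T v x) p y :=
  ⟨j, v, hv, hp, by simpa using hx, by simpa using hy⟩

/-- Overwriting a node loses at most the contribution of its previous function; the second
alternative records it as a debt. -/
theorem Covers.update {p : ℤ} {y : ℝ} (h : Covers K φ T p y) (hv : IsNode K j v) (x : ℤ) :
    Covers K φ (Function.update T v x) p y ∨ (InNode K j v p ∧ 1 ≤ T v ∧ y ≤ φ (T v) p) := by
  obtain ⟨i, v', h1, h2, h3, h4⟩ := h
  by_cases hvv : v' = v
  · subst hvv
    rw [h1.height_unique hv] at h2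
    exact .inr ⟨h2, h3, h4⟩
  · exact .inl ⟨i, v', h1, h2, by simpa [hvv] using h3, by simpa [hvv] using h4⟩

/-- The function `x` still has to be inserted at the node `v` of height `j`, after which the
demands `Ob` are met. -/
structure Pending (K : ℕ) (φ : ℤ → ℤ → ℝ) (Dom : ℤ → ℤ → Prop) (Ob : ℤ → ℝ → Prop) (T : ℤ → ℤ)
    (x v : ℤ) (j : ℕ) : Prop where
  pos : 1 ≤ x
  isNode : IsNode K j v
  dom : ∀ p, InNode K j v p → Dom x p
  covers : ∀ p y, Ob p y → Covers K φ T p y ∨ (InNode K j v p ∧ y ≤ φ x p)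

theorem Pending.place (h : Pending K φ Dom Ob T x v j) (hv : T v ≤ 0) :
    ∀ p y, Ob p y → Covers K φ (Function.update T v x) p y := by
  intro p y hp
  rcases h.covers p y hp with h1 | h1
  · rcases h1.update h.isNode x with h2 | h2
    · exact h2
    · omega
  · exact Covers.update_self h.isNode h1.1 h.pos h1.2

/-- The debt that arises from the overwritten node is exactly what the displaced function pays when
it becomes the pending one. -/
theorem Pending.swap (hT : TreeSound K Dom T) (h : Pending K φ Dom Ob T x v j) (hv : 1 ≤ T v) :
    Pending K φ Dom Ob (Function.update T v x) (T v) v j := by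
  refine ⟨hv, h.isNode, fun p => hT _ _ _ h.isNode hv, fun p y hp => ?_⟩
  rcases h.covers p y hp with h1 | h1
  · rcases h1.update h.isNode x with h2 | h2
    · exact .inl h2
    · exact .inr ⟨h2.1, h2.2.2⟩
  · exact .inl (Covers.update_self h.isNode h1.1 h.pos h1.2)

/-- A monotone difference attains its maximum over the node at one of the two ends, so a newcomer
that wins at neither end wins nowhere. -/
theorem Pending.drop (hsc : SingleCrossing φ Dom) (hT : TreeSound K Dom T)
    (h : Pending K φ Dom Ob T x v j) (hv : 1 ≤ T v)
    (hl : φ x (v * 2 ^ j - 2 ^ K) ≤ φ (T v) (v * 2 ^ j - 2 ^ K))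
    (hr : φ x (v * 2 ^ j - 2 ^ K + 2 ^ j - 1) ≤ φ (T v) (v * 2 ^ j - 2 ^ K + 2 ^ j - 1)) :
    ∀ p y, Ob p y → Covers K φ T p y := by
  intro p y hp
  rcases h.covers p y hp with h1 | ⟨h1, h2⟩
  · exact h1
  refine ⟨j, v, h.isNode, h1, hv, h2.trans ?_⟩
  have h3 : (1 : ℤ) ≤ 2 ^ j := one_le_pow₀ (by norm_num)
  have hL : InNode K j v (v * 2 ^ j - 2 ^ K) := ⟨by omega, by omega⟩
  have hR : InNode K j v (v * 2 ^ j - 2 ^ K + 2 ^ j - 1) := ⟨by omega, by omega⟩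
  have d := h.dom
  have d' : ∀ p, InNode K j v p → Dom (T v) p := fun p => hT _ _ _ h.isNode hv
  rcases hsc x (T v) with hm | hm
  · have := hm p _ (by have := h1.2; omega) (d _ h1) (d _ hR) (d' _ h1) (d' _ hR)
    linarith
  · have := hm _ p (by have := h1.1; omega) (d _ hL) (d _ h1) (d' _ hL) (d' _ h1)
    linarith

/-- The newcomer wins at the left end but not in the middle, so the difference is decreasing and the
newcomer wins nowhere from the middle on. The middle is the first position of the right child, which
therefore can be given up entirely. -/
theorem Pending.left {i : ℕ} (hsc : SingleCrossing φ Dom) (hT : TreeSound K Dom T)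
    (h : Pending K φ Dom Ob T x v (i + 1)) (hv : 1 ≤ T v)
    (hm : φ x (v * 2 ^ (i + 1) - 2 ^ K + 2 ^ i) ≤ φ (T v) (v * 2 ^ (i + 1) - 2 ^ K + 2 ^ i))
    (hl : φ (T v) (v * 2 ^ (i + 1) - 2 ^ K) < φ x (v * 2 ^ (i + 1) - 2 ^ K)) :
    Pending K φ Dom Ob T x (2 * v) i := by
  have e1 : (2 : ℤ) ^ (i + 1) = 2 * 2 ^ i := by ring
  have e2 : v * 2 ^ (i + 1) = 2 * v * 2 ^ i := by ring
  have h3 : (1 : ℤ) ≤ 2 ^ i := one_le_pow₀ (by norm_num)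
  obtain ⟨h0, h1, d, hc⟩ := h
  have d' : ∀ p, InNode K (i + 1) v p → Dom (T v) p := fun p => hT _ _ _ h1 hv
  unfold IsNode at h1
  unfold InNode at d d' hc
  rw [e2] at h1 d d' hc hm hl
  rw [e1] at h1 d d' hc
  refine ⟨h0, ⟨by omega, by omega⟩, fun p hp => d p ⟨hp.1, by have := hp.2; omega⟩,
    fun p y hp => ?_⟩
  rcases hc p y hp with h' | ⟨⟨h4, h5⟩, h6⟩
  · exact .inl h'
  by_cases hlt : p + 2 ^ K < 2 * v * 2 ^ i + 2 ^ i
  · exact .inr ⟨⟨h4, hlt⟩, h6⟩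
  left
  refine ⟨i + 1, v, ⟨by rw [e2]; omega, by rw [e2, e1]; omega⟩,
    ⟨by rw [e2]; omega, by rw [e2, e1]; omega⟩, hv, h6.trans ?_⟩
  have dl := d (2 * v * 2 ^ i - 2 ^ K) ⟨by omega, by omega⟩
  have dl' := d' (2 * v * 2 ^ i - 2 ^ K) ⟨by omega, by omega⟩
  have dm := d (2 * v * 2 ^ i - 2 ^ K + 2 ^ i) ⟨by omega, by omega⟩
  have dm' := d' (2 * v * 2 ^ i - 2 ^ K + 2 ^ i) ⟨by omega, by omega⟩
  have dp := d p ⟨by omega, by omega⟩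
  have dp' := d' p ⟨by omega, by omega⟩
  rcases hsc x (T v) with hs | hs
  · have := hs _ _ (by omega) dl dm dl' dm'
    linarith
  · have := hs _ _ (by omega) dm dp dm' dp'
    linarith

/-- Mirror image of `Pending.left`: the difference is increasing and not positive in the middle,
hence not positive on the whole left child. -/
theorem Pending.right {i : ℕ} (hsc : SingleCrossing φ Dom) (hT : TreeSound K Dom T)
    (h : Pending K φ Dom Ob T x v (i + 1)) (hv : 1 ≤ T v)
    (hm : φ x (v * 2 ^ (i + 1) - 2 ^ K + 2 ^ i) ≤ φ (T v) (v * 2 ^ (i + 1) - 2 ^ K + 2 ^ i))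
    (hr : φ (T v) (v * 2 ^ (i + 1) - 2 ^ K + 2 ^ (i + 1) - 1) <
      φ x (v * 2 ^ (i + 1) - 2 ^ K + 2 ^ (i + 1) - 1)) :
    Pending K φ Dom Ob T x (2 * v + 1) i := by
  have e1 : (2 : ℤ) ^ (i + 1) = 2 * 2 ^ i := by ring
  have e2 : v * 2 ^ (i + 1) = 2 * v * 2 ^ i := by ring
  have e3 : (2 * v + 1) * 2 ^ i = 2 * v * 2 ^ i + 2 ^ i := by ring
  have h3 : (1 : ℤ) ≤ 2 ^ i := one_le_pow₀ (by norm_num)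
  obtain ⟨h0, h1, d, hc⟩ := h
  have d' : ∀ p, InNode K (i + 1) v p → Dom (T v) p := fun p => hT _ _ _ h1 hv
  unfold IsNode at h1
  unfold InNode at d d' hc
  rw [e2] at h1 d d' hc hm hr
  rw [e1] at h1 d d' hc hr
  refine ⟨h0, ⟨by rw [e3]; omega, by rw [e3]; omega⟩, fun p hp => d p ?_, fun p y hp => ?_⟩
  · unfold InNode at hp
    rw [e3] at hp
    omega
  rcases hc p y hp with h' | ⟨⟨h4, h5⟩, h6⟩
  · exact .inl h'
  by_cases hlt : 2 * v * 2 ^ i + 2 ^ i ≤ p + 2 ^ K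
  · exact .inr ⟨⟨by rw [e3]; exact hlt, by rw [e3]; omega⟩, h6⟩
  left
  refine ⟨i + 1, v, ⟨by rw [e2]; omega, by rw [e2, e1]; omega⟩,
    ⟨by rw [e2]; omega, by rw [e2, e1]; omega⟩, hv, h6.trans ?_⟩
  have dl := d (2 * v * 2 ^ i - 2 ^ K + 2 * 2 ^ i - 1) ⟨by omega, by omega⟩
  have dl' := d' (2 * v * 2 ^ i - 2 ^ K + 2 * 2 ^ i - 1) ⟨by omega, by omega⟩
  have dm := d (2 * v * 2 ^ i - 2 ^ K + 2 ^ i) ⟨by omega, by omega⟩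
  have dm' := d' (2 * v * 2 ^ i - 2 ^ K + 2 ^ i) ⟨by omega, by omega⟩
  have dp := d p ⟨by omega, by omega⟩
  have dp' := d' p ⟨by omega, by omega⟩
  rcases hsc x (T v) with hs | hs
  · have := hs _ _ (by omega) dp dm dp' dm'
    linarith
  · have := hs _ _ (by omega) dm dl dm' dl'
    linarith

end Pure

/-- The value at the position `p` of the function with the code `x`: the entry `x - 1` of the value
array `2` plus the entry `p - x + 1` of the value array `1`. -/
def treeFun (x p : IExpr) : VExpr := .get 2 (x -ᵢ .const 1) +ʳ .get 1 (p -ᵢ x +ᵢ .const 1)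

/-- Exchange of the function `r20` and the function stored at `r21` if the former is better in the
middle. -/
def pushCompare : Prog :=
  .setReg 23 (.reg 21 *ᵢ .reg 22 -ᵢ .reg 4) ;;
  .setReg 24 (.get 3 (.reg 21)) ;;
  .ite (treeFun (.reg 20) (.reg 23 +ᵢ .reg 22 /ᵢ .const 2) ≤ʳ
      treeFun (.reg 24) (.reg 23 +ᵢ .reg 22 /ᵢ .const 2))
    .skip
    (.setArr 3 (.reg 21) (.reg 20) ;; .setReg 20 (.reg 24) ;; .setReg 24 (.get 3 (.reg 21)))

/-- The function `r20`, not better in the middle than `r24`, moves on to the child of `r21` where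
it is better, if there is one. -/
def pushDescend : Prog :=
  .ite (treeFun (.reg 20) (.reg 23) ≤ʳ treeFun (.reg 24) (.reg 23))
    (.ite (treeFun (.reg 20) (.reg 23 +ᵢ .reg 22 -ᵢ .const 1) ≤ʳ
        treeFun (.reg 24) (.reg 23 +ᵢ .reg 22 -ᵢ .const 1))
      (.setReg 20 (.const 0))
      (.setReg 21 (.const 2 *ᵢ .reg 21 +ᵢ .const 1) ;; .setReg 22 (.reg 22 /ᵢ .const 2)))
    (.setReg 21 (.const 2 *ᵢ .reg 21) ;; .setReg 22 (.reg 22 /ᵢ .const 2))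

/-- One step of the descent of the function with the code `r20` from the node `r21`, below which
there are `r22` positions. -/
def pushStep : Prog :=
  .ite (.get 3 (.reg 21) ≤ᵢ .const 0)
    (.setArr 3 (.reg 21) (.reg 20) ;; .setReg 20 (.const 0))
    (pushCompare ;; pushDescend)

/-- Insertion of the function with the code `r20` at the node `r21`. -/
def push : Prog := .while (.const 1 ≤ᵢ .reg 20) pushStep

variable {E : Env}

/-- Invariant of `push`. -/
def PushInv (K : ℕ) (φ : ℤ → ℤ → ℝ) (Dom : ℤ → ℤ → Prop) (Ob : ℤ → ℝ → Prop) (ρ : ℕ)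
    (s : State) : Prop :=
  TreeSound K Dom (s.iarr 3) ∧
    ((s.ireg 20 = 0 ∧ ∀ p y, Ob p y → Covers K φ (s.iarr 3) p y) ∨
      (1 ≤ ρ ∧ ∃ j, s.ireg 22 = 2 ^ j ∧ (j + 1 ≤ ρ ∨ NoCrossing φ Dom) ∧
        Pending K φ Dom Ob (s.iarr 3) (s.ireg 20) (s.ireg 21) j))

theorem two_pow_succ_ediv (i : ℕ) : (2 : ℤ) ^ (i + 1) / 2 = 2 ^ i := by
  rw [pow_succ]
  exact Int.mul_ediv_cancel _ (by norm_num)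

variable {K : ℕ} {φ : ℤ → ℤ → ℝ} {Dom : ℤ → ℤ → Prop} {Ob : ℤ → ℝ → Prop} {s : State}

theorem pushCompare_spec {j : ℕ} (hg : E.Good s) (hK : s.ireg 4 = 2 ^ K)
    (hb : 2 * 2 ^ K ≤ (E.b : ℤ))
    (hφ : ∀ x p, φ x p = s.varr 2 (x - 1) + s.varr 1 (p - x + 1))
    (hT : TreeSound K Dom (s.iarr 3)) (hj : s.ireg 22 = 2 ^ j)
    (hp : Pending K φ Dom Ob (s.iarr 3) (s.ireg 20) (s.ireg 21) j)
    (hv : 1 ≤ s.iarr 3 (s.ireg 21)) :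
    wp E pushCompare s fun T s' => T ≤ 60 ∧ TreeSound K Dom (s'.iarr 3) ∧
      s'.ireg 23 = s.ireg 21 * 2 ^ j - 2 ^ K ∧ s'.ireg 24 = s'.iarr 3 (s.ireg 21) ∧
      1 ≤ s'.iarr 3 (s.ireg 21) ∧
      Pending K φ Dom Ob (s'.iarr 3) (s'.ireg 20) (s.ireg 21) j ∧
      φ (s'.ireg 20) (s'.ireg 23 + 2 ^ j / 2) ≤ φ (s'.ireg 24) (s'.ireg 23 + 2 ^ j / 2) := by
  have hvb := hp.isNode
  have h20 := hg.ireg 20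
  have hTb := hg.iarr 3 (s.ireg 21)
  have hbd : |s.ireg 21 * 2 ^ j - 2 ^ K| ≤ (E.b : ℤ) := by
    have := hvb.1; have := hvb.2
    have : (0 : ℤ) < 2 ^ j := by positivity
    rw [abs_of_nonneg (by omega)]
    omega
  have hp1 := hp.pos
  simp [pushCompare, treeFun, hK, hj, hbd, hTb, h20, hφ]
  refine ⟨fun h => ⟨hT, hv, hp, h⟩, fun h => ⟨hT.update hp.isNode hp.dom, hp1,
    hp.swap hT hv, h.le⟩⟩

/-- The two ends of the node decide among `Pending.drop`, `Pending.right` and `Pending.left`. A real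
descent happens only if the loser of the comparison in the middle wins strictly somewhere. -/
theorem pushDescend_spec {j ρ : ℕ} (hb : 2 * 2 ^ K ≤ (E.b : ℤ))
    (hφ : ∀ x p, φ x p = s.varr 2 (x - 1) + s.varr 1 (p - x + 1)) (hsc : SingleCrossing φ Dom)
    (hT : TreeSound K Dom (s.iarr 3)) (hj : s.ireg 22 = 2 ^ j)
    (hp : Pending K φ Dom Ob (s.iarr 3) (s.ireg 20) (s.ireg 21) j)
    (hv : 1 ≤ s.iarr 3 (s.ireg 21)) (h23 : s.ireg 23 = s.ireg 21 * 2 ^ j - 2 ^ K)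
    (h24 : s.ireg 24 = s.iarr 3 (s.ireg 21))
    (hm : φ (s.ireg 20) (s.ireg 23 + 2 ^ j / 2) ≤ φ (s.ireg 24) (s.ireg 23 + 2 ^ j / 2))
    (hjρ : j + 1 ≤ ρ ∨ NoCrossing φ Dom) (hρ : 1 ≤ ρ) :
    wp E pushDescend s fun T s' => T ≤ 80 ∧ PushInv K φ Dom Ob (ρ - 1) s' := by
  have hvb := hp.isNode
  have h1j : (1 : ℤ) ≤ 2 ^ j := one_le_pow₀ (by norm_num)
  have h2 : |(2 : ℤ) ^ j / 2| ≤ (E.b : ℤ) := by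
    rw [abs_of_nonneg (by positivity)]
    have := hvb.1; have := hvb.2
    omega
  have hL : InNode K j (s.ireg 21) (s.ireg 23) := by
    rw [h23]; exact ⟨by omega, by omega⟩
  have hM : InNode K j (s.ireg 21) (s.ireg 23 + 2 ^ j / 2) := by
    rw [h23]; exact ⟨by omega, by omega⟩
  have hR : InNode K j (s.ireg 21) (s.ireg 23 + 2 ^ j - 1) := by
    rw [h23]; exact ⟨by omega, by omega⟩
  have d := hp.dom
  have d' : ∀ p, InNode K j (s.ireg 21) p → Dom (s.ireg 24) p :=
    fun p => h24 ▸ hT _ _ _ hp.isNode hv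
  simp [pushDescend, treeFun, hj, h2]
  simp only [← hφ]
  have hchild : ∀ p, InNode K j (s.ireg 21) p → φ (s.ireg 24) p < φ (s.ireg 20) p →
      2 * s.ireg 21 + 1 ≤ (E.b : ℤ) ∧
        ∃ i, j = i + 1 ∧ (2 : ℤ) ^ j / 2 = 2 ^ i ∧ 1 ≤ ρ - 1 ∧ i + 1 ≤ ρ - 1 := by
    intro p hpn hlt
    -- If differences are constant, the comparison in the middle decides the whole node, and a
    -- strict win elsewhere is impossible.
    have hlin : j + 1 ≤ ρ := by
      refine hjρ.resolve_right fun hn => ?_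
      have := hn _ _ _ _ (d _ hM) (d _ hpn) (d' _ hM) (d' _ hpn)
      linarith
    rcases j with _ | i
    · exfalso
      -- A leaf has a single position, and this is its middle because `2 ^ 0 / 2 = 0`.
      have hpM : p = s.ireg 23 + 2 ^ 0 / 2 := by
        have := hpn.1; have := hpn.2; rw [h23]; norm_num at *; omega
      rw [hpM] at hlt
      linarith
    · refine ⟨?_, i, rfl, two_pow_succ_ediv i, by omega, by omega⟩
      have := hvb.2
      have e1 : s.ireg 21 * 2 ^ (i + 1) + 2 ^ (i + 1) = (2 * s.ireg 21 + 2) * 2 ^ i := by ring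
      have h1i : (1 : ℤ) ≤ 2 ^ i := one_le_pow₀ (by norm_num)
      nlinarith [hvb.pos]
  have hv1 := hvb.pos
  refine ⟨fun hl => ⟨fun hr => ⟨hT, ?_⟩, fun hr => ?_⟩, fun hl => ?_⟩
  · left
    simp only [State.setI_ireg, State.setI_iarr, if_true, true_and]
    rw [h24, h23] at hl hr
    exact hp.drop hsc hT hv hl hr
  · obtain ⟨hb', i, rfl, hi, h1, h2⟩ := hchild _ hR hr
    refine ⟨fun _ => by rw [abs_of_nonneg (by omega)]; exact hb', hT, .inr ⟨h1, i, ?_, .inl h2, ?_⟩⟩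
    · simpa using hi
    · rw [hi, h24, h23] at hm
      rw [h24, h23] at hr
      simpa using hp.right hsc hT hv hm hr
  · obtain ⟨hb', i, rfl, hi, h1, h2⟩ := hchild _ hL hl
    refine ⟨fun _ => by rw [abs_of_nonneg (by omega)]; omega, hT, .inr ⟨h1, i, ?_, .inl h2, ?_⟩⟩
    · simpa using hi
    · rw [hi, h24, h23] at hm
      rw [h24, h23] at hl
      simpa using hp.left hsc hT hv hm hl

theorem pushStep_spec {ρ : ℕ} (hg : E.Good s) (hK : s.ireg 4 = 2 ^ K)
    (hb : 2 * 2 ^ K ≤ (E.b : ℤ))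
    (hφ : ∀ x p, φ x p = s.varr 2 (x - 1) + s.varr 1 (p - x + 1)) (hsc : SingleCrossing φ Dom)
    (hs : PushInv K φ Dom Ob ρ s) (hc : 1 ≤ s.ireg 20) :
    wp E pushStep s fun T s' => T ≤ 150 ∧ 1 ≤ ρ ∧ PushInv K φ Dom Ob (ρ - 1) s' := by
  obtain ⟨hT, ⟨h0, _⟩ | ⟨hρ, j, hj, hjρ, hp⟩⟩ := hs
  · omega
  have h20 := hg.ireg 20
  simp [pushStep, h20, hρ]
  refine ⟨fun h => ⟨?_, .inl ⟨by simp, ?_⟩⟩, fun h => ?_⟩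
  · simpa using hT.update hp.isNode hp.dom
  · simpa using hp.place h
  · refine wp_call (pushCompare_spec hg hK hb hφ hT hj hp h) ?_
    rintro T s' ⟨c1, c2, c3, c4, c5, c6, c7⟩ hf
    have e21 : s'.ireg 21 = s.ireg 21 := hf.ireg 21 rfl
    have e22 : s'.ireg 22 = s.ireg 22 := hf.ireg 22 rfl
    have e1 : s'.varr 1 = s.varr 1 := hf.varr 1 rfl
    have e2 : s'.varr 2 = s.varr 2 := hf.varr 2 rfl
    rw [← e21] at c3 c4 c5 c6
    refine wp_mono (pushDescend_spec hb (by rwa [e1, e2]) hsc c2 (e22.trans hj) c6 c5 c3 c4 c7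
      hjρ hρ) fun T' s'' h' => ⟨by omega, h'.2⟩

/-- Every step of the descent lowers the height, which gives at most `K + 1` steps; without
crossings one step suffices. The number `δ` unites both cases. -/
theorem push_spec (hE : E.Valid) {j δ : ℕ} (hK : s.ireg 4 = 2 ^ K)
    (hb : 2 * 2 ^ K ≤ (E.b : ℤ))
    (hφ : ∀ x p, φ x p = s.varr 2 (x - 1) + s.varr 1 (p - x + 1)) (hsc : SingleCrossing φ Dom)
    (hT : TreeSound K Dom (s.iarr 3)) (hj : s.ireg 22 = 2 ^ j)
    (hv : IsNode K j (s.ireg 21)) (hx : 1 ≤ s.ireg 20)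
    (hdom : ∀ p, InNode K j (s.ireg 21) p → Dom (s.ireg 20) p)
    (hδ : K + 1 ≤ δ ∨ NoCrossing φ Dom) (hδ1 : 1 ≤ δ) :
    wp E push s fun T s' => T ≤ 160 * δ ∧ TreeSound K Dom (s'.iarr 3) ∧
      (∀ p y, Covers K φ (s.iarr 3) p y → Covers K φ (s'.iarr 3) p y) ∧
      ∀ p, InNode K j (s.ireg 21) p → Covers K φ (s'.iarr 3) p (φ (s.ireg 20) p) := by
  -- The demands are everything that was covered before, together with the new function on its node.
  refine wp_mono (wp_while hE 150 (PushInv K φ Dom (fun p y => Covers K φ (s.iarr 3) p y ∨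
    (InNode K j (s.ireg 21) p ∧ y ≤ φ (s.ireg 20) p))) (ρ := δ) rfl
    ⟨hT, .inr ⟨hδ1, j, hj, hδ.imp_left fun h => by have := hv.height_le; omega,
      hx, hv, hdom, fun _ _ h => h⟩⟩ ?_) ?_
  · intro ρ s' hf hg hs' hc
    have e1 : s'.varr 1 = s.varr 1 := hf.varr 1 rfl
    have e2 : s'.varr 2 = s.varr 2 := hf.varr 2 rfl
    have e4 : s'.ireg 4 = s.ireg 4 := hf.ireg 4 rfl
    exact pushStep_spec hg (e4.trans hK) hb (by rwa [e1, e2]) hsc hs' (by simpa using hc)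
  · rintro T s' ⟨h1, h2, ρ', h3, h4⟩
    simp at h1 h2
    rcases h4 with ⟨_, h4⟩ | ⟨_, _, _, _, h4⟩
    · exact ⟨by omega, h3, fun p y h => h4 p y (.inl h), fun p h => h4 p _ (.inr ⟨h, le_rfl⟩)⟩
    · have := h4.pos
      omega

end

end Knap

/-! ### Insertion of a function on an interval of positions -/

namespace Knap

noncomputable section

variable {E : Env} {K : ℕ} {φ : ℤ → ℤ → ℝ} {Dom : ℤ → ℤ → Prop} {s : State}

/-- Removal of all functions from the tree. -/
def clearTree : Prog :=
  .setReg 18 (.const 1) ;;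
  .while (.reg 18 +ᵢ .const 1 ≤ᵢ .const 2 *ᵢ .reg 4)
    (.setArr 3 (.reg 18) (.const 0) ;; .setReg 18 (.reg 18 +ᵢ .const 1))

theorem clearTree_spec (hE : E.Valid) (hK : s.ireg 4 = 2 ^ K) (hb : 2 * 2 ^ K ≤ (E.b : ℤ)) :
    wp E clearTree s fun T s' => T ≤ 50 * 2 ^ K ∧ ∀ v, 1 ≤ v → v < 2 * 2 ^ K → s'.iarr 3 v = 0 := by
  have hb2 := hE.two_le
  have hK1 : (1 : ℤ) ≤ 2 ^ K := one_le_pow₀ (by norm_num)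
  have hK1' : 1 ≤ 2 ^ K := Nat.one_le_two_pow
  simp only [clearTree, wp_seq, wp_setReg]
  refine ⟨rfl, fun _ => by simp; omega, ?_⟩
  refine wp_call (wp_while hE 8 (fun ρ s' => 1 ≤ s'.ireg 18 ∧ 2 * 2 ^ K = ρ + s'.ireg 18 ∧
    ∀ v, 1 ≤ v → v < s'.ireg 18 → s'.iarr 3 v = 0) (ρ := 2 * 2 ^ K - 1) rfl ?_ ?_) ?_
  · refine ⟨by simp, ?_, fun v h1 h2 => ?_⟩
    · have : 1 ≤ 2 * 2 ^ K := by omega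
      push_cast [Nat.cast_sub this]
      simp
    · simp at h2
      omega
  · intro ρ s' hf hg ⟨h1, h2, h3⟩ hc
    have e4 : s'.ireg 4 = 2 ^ K := (hf.ireg 4 rfl).trans hK
    simp [e4] at hc
    simp
    refine ⟨fun _ => by rw [abs_of_nonneg (by omega)]; omega, by omega, by omega, by omega, ?_⟩
    intro v hv1 hv2
    rw [Function.update_apply]
    split_ifs with h
    · rfl
    · exact h3 v hv1 (by omega)
  · rintro T s' ⟨h1, h2, ρ', h3, h4, h5⟩ hf
    have e4 : s'.ireg 4 = 2 ^ K := (hf.ireg 4 rfl).trans hK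
    simp [e4] at h1 h2 ⊢
    refine ⟨?_, fun v hv1 hv2 => h5 v hv1 (by omega)⟩
    omega

/-- Insertion of the function with the code `r19` at the node `v`, below which there are `r17`
positions. -/
def pushAt (v : IExpr) : Prog :=
  .setReg 20 (.reg 19) ;; .setReg 21 v ;; .setReg 22 (.reg 17) ;; push

theorem pushAt_spec (hE : E.Valid) {j δ : ℕ} {v : IExpr} {x z : ℤ}
    (hxb : |x| ≤ (E.b : ℤ)) (hK : s.ireg 4 = 2 ^ K) (hb : 2 * 2 ^ K ≤ (E.b : ℤ))
    (hφ : ∀ x p, φ x p = s.varr 2 (x - 1) + s.varr 1 (p - x + 1)) (hsc : SingleCrossing φ Dom)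
    (hT : TreeSound K Dom (s.iarr 3)) (h19 : s.ireg 19 = x) (hx : 1 ≤ x)
    (hj : s.ireg 17 = 2 ^ j) (hvok : v.ok = true) (hvc : v.cost ≤ 5)
    (hvz : v.eval E.inp (s.setI 20 x) = z) (hz : IsNode K j z)
    (hdom : ∀ p, InNode K j z p → Dom x p)
    (hδ : K + 1 ≤ δ ∨ NoCrossing φ Dom) (hδ1 : 1 ≤ δ) :
    wp E (pushAt v) s fun T s' => T ≤ 160 * δ + 10 ∧ TreeSound K Dom (s'.iarr 3) ∧
      (∀ p y, Covers K φ (s.iarr 3) p y → Covers K φ (s'.iarr 3) p y) ∧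
      ∀ p, InNode K j z p → Covers K φ (s'.iarr 3) p (φ x p) := by
  have h17 : |(2 : ℤ) ^ j| ≤ (E.b : ℤ) := by
    rw [abs_of_nonneg (by positivity)]
    have := hz.1; have := hz.2
    omega
  have hzb : |z| ≤ (E.b : ℤ) := by
    rw [abs_of_nonneg (by have := hz.pos; omega)]
    exact hz.lt.le.trans hb
  simp only [pushAt, wp_seq, wp_setReg, IExpr.eval, h19, hvz, State.setI_ireg, hj]
  refine ⟨rfl, fun _ => hxb, hvok, fun _ => hzb, rfl, fun _ => h17, ?_⟩
  refine wp_mono (push_spec hE (j := j) (δ := δ) (φ := φ) (Dom := Dom) (K := K) (by simpa using hK)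
      hb (by simpa using hφ) hsc (by simpa using hT) (by simp) (by simpa using hz)
      (by simpa using hx) (by simpa using hdom) hδ hδ1) ?_
  rintro T s' ⟨a1, a2, a3, a4⟩
  simp at a3 a4
  exact ⟨by simp; omega, a2, a3, a4⟩

/-- One level of `insertRange`. -/
def insertLevel : Prog :=
  pushAt (.reg 15) ;; pushAt (.reg 16 -ᵢ .const 1) ;;
  .setReg 15 ((.reg 15 +ᵢ .const 1) /ᵢ .const 2) ;; .setReg 16 (.reg 16 /ᵢ .const 2) ;;
  .setReg 17 (.const 2 *ᵢ .reg 17)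

/-- Insertion of the function with the code `r19` on the positions that correspond to the leaves
`r15, ..., r16 - 1`. -/
def insertRange : Prog :=
  .setReg 17 (.const 1) ;; .while (.reg 15 +ᵢ .const 1 ≤ᵢ .reg 16) insertLevel

/-- Invariant of `insertRange`. -/
def InsertInv (K : ℕ) (φ : ℤ → ℤ → ℝ) (Dom : ℤ → ℤ → Prop) (T₀ : ℤ → ℤ) (x l r : ℤ) (ρ : ℕ)
    (s : State) : Prop :=
  TreeSound K Dom (s.iarr 3) ∧ (∀ p y, Covers K φ T₀ p y → Covers K φ (s.iarr 3) p y) ∧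
    ∃ j, s.ireg 17 = 2 ^ j ∧ K + 1 ≤ ρ + j ∧ l + 2 ^ K ≤ s.ireg 15 * 2 ^ j ∧
      s.ireg 16 * 2 ^ j ≤ r + 2 ^ K ∧ ∀ p, l ≤ p → p < r → Covers K φ (s.iarr 3) p (φ x p) ∨
        (s.ireg 15 * 2 ^ j ≤ p + 2 ^ K ∧ p + 2 ^ K < s.ireg 16 * 2 ^ j)

/-- Bottom-up decomposition of an interval of nodes of width `P`. After both extreme nodes have been
served, the bounds are rounded inwards to the next level. Serving them regardless of parity is
harmless, since covering a position twice does no damage. -/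
theorem halving_bounds {L R P l r : ℤ} (hP : 1 ≤ P) (hl : l ≤ L * P) (hr : R * P ≤ r) :
    l ≤ (L + 1) / 2 * (2 * P) ∧ R / 2 * (2 * P) ≤ r ∧ ∀ p, L * P ≤ p → p < R * P →
      p < L * P + P ∨ (R - 1) * P ≤ p ∨
        ((L + 1) / 2 * (2 * P) ≤ p ∧ p < R / 2 * (2 * P)) := by
  have e : ∀ z : ℤ, z * (2 * P) = z * 2 * P := fun z => by ring
  have q1 : (L + 1) / 2 * 2 * P ≤ (L + 1) * P :=
    mul_le_mul_of_nonneg_right (by omega) (by omega)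
  have q2 : L * P ≤ (L + 1) / 2 * 2 * P := mul_le_mul_of_nonneg_right (by omega) (by omega)
  have q3 : R / 2 * 2 * P ≤ R * P := mul_le_mul_of_nonneg_right (by omega) (by omega)
  have q4 : (R - 1) * P ≤ R / 2 * 2 * P := mul_le_mul_of_nonneg_right (by omega) (by omega)
  have q5 : (L + 1) * P = L * P + P := by ring
  rw [e, e]
  refine ⟨by omega, by omega, fun p h1 h2 => ?_⟩
  omega

theorem insertLevel_spec (hE : E.Valid) {δ ρ : ℕ} {x l r : ℤ} {T₀ : ℤ → ℤ} (hxb : |x| ≤ (E.b : ℤ))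
    (hK : s.ireg 4 = 2 ^ K) (hb : 2 * 2 ^ K ≤ (E.b : ℤ))
    (hφ : ∀ x p, φ x p = s.varr 2 (x - 1) + s.varr 1 (p - x + 1)) (hsc : SingleCrossing φ Dom)
    (hx : 1 ≤ x) (h19 : s.ireg 19 = x) (hl : 0 ≤ l) (hr : r ≤ 2 ^ K)
    (hdom : ∀ p, l ≤ p → p < r → Dom x p) (hδ : K + 1 ≤ δ ∨ NoCrossing φ Dom) (hδ1 : 1 ≤ δ)
    (hs : InsertInv K φ Dom T₀ x l r ρ s) (hc : s.ireg 15 + 1 ≤ s.ireg 16) :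
    wp E insertLevel s fun T s' => T ≤ 320 * δ + 40 ∧ 1 ≤ ρ ∧
      InsertInv K φ Dom T₀ x l r (ρ - 1) s' := by
  obtain ⟨i1, i2, j, i3, i4, i5, i6, i7⟩ := hs
  generalize hL : s.ireg 15 = L at *
  generalize hR : s.ireg 16 = R at *
  have hj1 : (1 : ℤ) ≤ 2 ^ j := one_le_pow₀ (by norm_num)
  have hLR : L * 2 ^ j + 2 ^ j ≤ R * 2 ^ j := by nlinarith
  have hR1 : (R - 1) * 2 ^ j = R * 2 ^ j - 2 ^ j := by ring
  have nL : IsNode K j L := ⟨by omega, by omega⟩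
  have nR : IsNode K j (R - 1) := ⟨by omega, by omega⟩
  simp only [insertLevel, wp_seq, wp_setReg]
  refine wp_call (pushAt_spec hE hxb hK hb hφ hsc i1 h19 hx i3 rfl (by simp)
    (by simpa using hL) nL (fun p hp => hdom p (by have := hp.1; omega)
      (by have := hp.2; omega)) hδ hδ1) ?_
  rintro T1 s1 ⟨a1, a2, a3, a4⟩ f1
  have g4 : s1.ireg 4 = 2 ^ K := (f1.ireg 4 rfl).trans hK
  have g16 : s1.ireg 16 = R := (f1.ireg 16 rfl).trans hR
  have g17 : s1.ireg 17 = 2 ^ j := (f1.ireg 17 rfl).trans i3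
  have g19 : s1.ireg 19 = x := (f1.ireg 19 rfl).trans h19
  refine wp_call (pushAt_spec hE hxb g4 hb (by rwa [f1.varr 1 rfl, f1.varr 2 rfl]) hsc a2 g19 hx
    g17 rfl (by simp) (by simpa using g16) nR (fun p hp => hdom p (by have := hp.1; omega)
      (by have := hp.2; omega)) hδ hδ1) ?_
  rintro T2 s2 ⟨b1, b2, b3, b4⟩ f2
  have h15' : s2.ireg 15 = L := (f2.ireg 15 rfl).trans ((f1.ireg 15 rfl).trans hL)
  have h16' : s2.ireg 16 = R := (f2.ireg 16 rfl).trans g16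
  have h17' : s2.ireg 17 = 2 ^ j := (f2.ireg 17 rfl).trans g17
  have hRb := nR.lt
  have hRp := nR.pos
  have hLp := nL.pos
  have hLt := nL.lt
  have hjK := nL.height_le
  have ej : (2 : ℤ) ^ (j + 1) = 2 * 2 ^ j := by ring
  obtain ⟨q1, q2, q3⟩ := halving_bounds hj1 i5 i6
  simp [InsertInv, h15', h16', h17']
  refine ⟨fun _ => by rw [abs_of_nonneg (by omega)]; omega,
    fun _ => by rw [abs_of_nonneg (by omega)]; omega,
    fun _ => by have := nL.2; omega, by omega, by omega, b2,
    fun p y h => b3 p y (a3 p y (i2 p y h)), j + 1, by rw [ej], by omega, ?_, ?_, ?_⟩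
  · rwa [ej]
  · rwa [ej]
  · intro p hp1 hp2
    rw [ej]
    rcases i7 p hp1 hp2 with h | ⟨h1, h2⟩
    · exact .inl (b3 p _ (a3 p _ h))
    rcases q3 _ h1 h2 with h | h | h
    · exact .inl (b3 p _ (a4 p ⟨h1, h⟩))
    · exact .inl (b4 p ⟨h, by rw [hR1]; omega⟩)
    · exact .inr h

/-- At most `K + 1` levels with two pushes each: as long as the range is nonempty, its ends are
genuine nodes, whose height is at most `K`. -/
theorem insertRange_spec (hE : E.Valid) {δ : ℕ} {x l r : ℤ} (hK : s.ireg 4 = 2 ^ K)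
    (hb : 2 * 2 ^ K ≤ (E.b : ℤ))
    (hφ : ∀ x p, φ x p = s.varr 2 (x - 1) + s.varr 1 (p - x + 1)) (hsc : SingleCrossing φ Dom)
    (hT : TreeSound K Dom (s.iarr 3)) (hx : 1 ≤ x) (h19 : s.ireg 19 = x)
    (h15 : s.ireg 15 = l + 2 ^ K) (h16 : s.ireg 16 = r + 2 ^ K) (hl : 0 ≤ l) (hr : r ≤ 2 ^ K)
    (hdom : ∀ p, l ≤ p → p < r → Dom x p)
    (hδ : K + 1 ≤ δ ∨ NoCrossing φ Dom) (hδ1 : 1 ≤ δ) :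
    wp E insertRange s fun T s' => T ≤ 400 * ((K + 1) * δ) ∧ TreeSound K Dom (s'.iarr 3) ∧
      (∀ p y, Covers K φ (s.iarr 3) p y → Covers K φ (s'.iarr 3) p y) ∧
      ∀ p, l ≤ p → p < r → Covers K φ (s'.iarr 3) p (φ x p) := by
  have hb2 := hE.two_le
  simp only [insertRange, wp_seq, wp_setReg]
  refine ⟨rfl, fun _ => by simp; omega, ?_⟩
  refine wp_mono (wp_while hE (320 * δ + 40) (InsertInv K φ Dom (s.iarr 3) x l r)
    (ρ := K + 1) rfl ?_ ?_) ?_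
  · refine ⟨hT, fun _ _ h => h, 0, by simp, by simp, by simp [h15], by simp [h16], ?_⟩
    intro p h1 h2
    right
    simp [h15, h16]
    omega
  · intro ρ s' hf hg hs hc
    have e19 : s'.ireg 19 = x := (hf.ireg 19 rfl).trans h19
    exact insertLevel_spec hE (e19 ▸ hg.ireg 19) ((hf.ireg 4 rfl).trans hK) hb
      (by rw [hf.varr 1 rfl, hf.varr 2 rfl]; exact hφ) hsc hx e19 hl hr hdom hδ hδ1 hs hc
  · rintro T s' ⟨h1, h2, ρ', h3, h4, j, h5, h6, h7, h8, h9⟩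
    simp at h1 h2 ⊢
    refine ⟨?_, h3, h4, fun p hp1 hp2 => (h9 p hp1 hp2).resolve_right fun h => ?_⟩
    · have : K + 1 ≤ (K + 1) * δ := Nat.le_mul_of_pos_right _ hδ1
      have e : (K + 1) * (320 * δ + 40 + 1 + 5) = 320 * ((K + 1) * δ) + 46 * (K + 1) := by ring
      have : 1 ≤ K + 1 := by omega
      omega
    -- The remaining range is empty, so no position is still waiting.
    · have : s'.ireg 16 * 2 ^ j ≤ s'.ireg 15 * 2 ^ j :=
        mul_le_mul_of_nonneg_right (by omega) (by positivity)
      omega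

end

end Knap

namespace Knap

noncomputable section

/-! ## Positions of the sums -/

/-- The position of the sum `x`: the sums are sorted by their residues modulo `w`. -/
def sumPos (W w x : ℤ) : ℤ := x % w * (W / w + 1) + x / w

section Pos

variable {W w x y t : ℤ}

/-- Adding `t` items of weight `w` keeps the residue and raises the quotient by `t`. This is what
makes the functions of all sums translates of the same `F`. -/
theorem sumPos_add (hw : 1 ≤ w) : sumPos W w (x + t * w) = sumPos W w x + t := by
  rw [sumPos, sumPos, Int.add_mul_emod_self_right, Int.add_mul_ediv_right _ _ (by omega)]
  ring

theorem sumPos_nonneg (hw : 1 ≤ w) (hx : 0 ≤ x) (hxW : x ≤ W) : 0 ≤ sumPos W w x := by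
  have h1 : 0 ≤ x % w := Int.emod_nonneg _ (by omega)
  have h2 : 0 ≤ x / w := Int.ediv_nonneg hx (by omega)
  have h3 : 0 ≤ W / w := Int.ediv_nonneg (by omega) (by omega)
  unfold sumPos
  positivity

theorem le_sub_ediv (hw : 1 ≤ w) : t ≤ (W - x) / w ↔ x + t * w ≤ W := by
  rw [Int.le_ediv_iff_mul_le (by omega)]
  constructor <;> intro h <;> linarith

/-- There are `w` blocks of length `⌊W / w⌋ + 1`, hence at most `W + w ≤ 2 * W` positions if `w ≤
W`; if `w > W`, the position of `x` is `x`. As the bound does not depend on `w`, one tree size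
serves all items. -/
theorem sumPos_lt (hW : 2 ≤ W) (hw : 1 ≤ w) (hx : 0 ≤ x) (hxW : x ≤ W) :
    sumPos W w x < 2 * W := by
  have h1 : 0 ≤ x % w := Int.emod_nonneg _ (by omega)
  have h2 : x % w < w := Int.emod_lt_of_pos _ (by omega)
  have h3 : x / w ≤ W / w := Int.ediv_le_ediv (by omega) hxW
  have h4 : W / w * w ≤ W := Int.ediv_mul_le _ (by omega)
  have h5 : 0 ≤ W / w := Int.ediv_nonneg (by omega) (by omega)
  unfold sumPos
  by_cases hwW : w ≤ W
  · nlinarith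
  · have : W / w = 0 := Int.ediv_eq_zero_of_lt (by omega) (by omega)
    have : x % w = x := Int.emod_eq_of_lt hx (by omega)
    simp [*]
    have : x / w = 0 := Int.ediv_eq_zero_of_lt (by omega) (by omega)
    omega

theorem sumPos_add_ediv_lt (hW : 2 ≤ W) (hw : 1 ≤ w) (hx : 0 ≤ x) (hxW : x ≤ W) :
    sumPos W w x + (W - x) / w < 2 * W := by
  rw [← sumPos_add hw]
  have h0 : 0 ≤ (W - x) / w := Int.ediv_nonneg (by omega) (by omega)
  exact sumPos_lt hW hw (by positivity) ((le_sub_ediv hw).1 le_rfl)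

/-- The quotients do not exceed `⌊W / w⌋`, so residue and quotient are recovered from the position
by division by `⌊W / w⌋ + 1`. -/
theorem sumPos_injOn (hw : 1 ≤ w) (hx : 0 ≤ x) (hxW : x ≤ W) (hy : 0 ≤ y) (hyW : y ≤ W)
    (h : sumPos W w x = sumPos W w y) : x = y := by
  have a1 : x / w ≤ W / w := Int.ediv_le_ediv (by omega) hxW
  have a2 : y / w ≤ W / w := Int.ediv_le_ediv (by omega) hyW
  have a3 : 0 ≤ x / w := Int.ediv_nonneg hx (by omega)
  have a4 : 0 ≤ y / w := Int.ediv_nonneg hy (by omega)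
  unfold sumPos at h
  have h1 : x % w = y % w := by
    have e : ∀ z q : ℤ, 0 ≤ q → q ≤ W / w → (z * (W / w + 1) + q) / (W / w + 1) = z := by
      intro z q h0 h1
      rw [add_comm, Int.add_mul_ediv_right _ _ (by omega),
        Int.ediv_eq_zero_of_lt h0 (by omega), zero_add]
    rw [← e (x % w) _ a3 a1, h, e _ _ a4 a2]
  have h2 : x / w = y / w := by
    rw [h1] at h
    linarith
  rw [← Int.mul_ediv_add_emod x w, ← Int.mul_ediv_add_emod y w, h1, h2]

end Pos

/-! ## Convex and concave pieces -/

/-- `F` is convex on `a, ..., e - 1`. -/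
def ConvexPiece (F : ℤ → ℝ) (a e : ℤ) : Prop :=
  ∀ t t' d, a ≤ t → t ≤ t' → 0 ≤ d → t' + d < e → F t' - F t ≤ F (t' + d) - F (t + d)

/-- `F` is concave on `a, ..., e - 1`. -/
def ConcavePiece (F : ℤ → ℝ) (a e : ℤ) : Prop :=
  ∀ t t' d, a ≤ t → t ≤ t' → 0 ≤ d → t' + d < e → F (t' + d) - F (t + d) ≤ F t' - F t

/-- The function with the code `x` is defined on the positions that are reached from the sum with
the position `x - 1` with a number `t` of items, `a ≤ t < e`. Only the sums that satisfy `fl` have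
a function. -/
def ColDom (W w a e : ℤ) (fl : ℤ → Prop) (x p : ℤ) : Prop :=
  ∃ y, 0 ≤ y ∧ y ≤ W ∧ fl y ∧ x = sumPos W w y + 1 ∧
    ∃ t, a ≤ t ∧ t < e ∧ y + t * w ≤ W ∧ p = sumPos W w y + t

section Pieces

variable {W w a e : ℤ} {fl : ℤ → Prop} {A F : ℤ → ℝ} {φ : ℤ → ℤ → ℝ}

theorem colDom_range {x p : ℤ} (h : ColDom W w a e fl x p) :
    a ≤ p - x + 1 ∧ p - x + 1 < e := by
  obtain ⟨y, _, _, _, rfl, t, h1, h2, _, rfl⟩ := h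
  constructor <;> omega

/-- When the position moves from `p` to `q`, both functions change by an increment of `F` over the
same length `q - p`, the one with the smaller code starting at the larger argument. Convexity or
concavity compares the two increments, and the terms `A` cancel. -/
theorem singleCrossing_of_piece (hφ : ∀ x p, φ x p = A (x - 1) + F (p - x + 1))
    (hF : ConvexPiece F a e ∨ ConcavePiece F a e) :
    SingleCrossing φ (ColDom W w a e fl) := by
  intro x y
  have key : ∀ p q, p ≤ q → ColDom W w a e fl x p → ColDom W w a e fl x q →
      ColDom W w a e fl y p → ColDom W w a e fl y q →
      (a ≤ p - x + 1 ∧ 0 ≤ q - p ∧ p - x + 1 + (q - p) < e) ∧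
      (a ≤ p - y + 1 ∧ p - y + 1 + (q - p) < e) ∧
      q - x + 1 = p - x + 1 + (q - p) ∧ q - y + 1 = p - y + 1 + (q - p) := by
    intro p q hpq h1 h2 h3 h4
    have := colDom_range h1
    have := colDom_range h2
    have := colDom_range h3
    have := colDom_range h4
    omega
  rcases hF with hF | hF <;> rcases le_total x y with hxy | hxy
  · left
    intro p q hpq h1 h2 h3 h4
    obtain ⟨⟨k1, k2, k3⟩, ⟨k4, k5⟩, k6, k7⟩ := key p q hpq h1 h2 h3 h4
    have := hF (p - y + 1) (p - x + 1) (q - p) k4 (by omega) k2 k3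
    rw [hφ, hφ, hφ, hφ, k6, k7]
    linarith
  · right
    intro p q hpq h1 h2 h3 h4
    obtain ⟨⟨k1, k2, k3⟩, ⟨k4, k5⟩, k6, k7⟩ := key p q hpq h1 h2 h3 h4
    have := hF (p - x + 1) (p - y + 1) (q - p) k1 (by omega) k2 k5
    rw [hφ, hφ, hφ, hφ, k6, k7]
    linarith
  · right
    intro p q hpq h1 h2 h3 h4
    obtain ⟨⟨k1, k2, k3⟩, ⟨k4, k5⟩, k6, k7⟩ := key p q hpq h1 h2 h3 h4
    have := hF (p - y + 1) (p - x + 1) (q - p) k4 (by omega) k2 k3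
    rw [hφ, hφ, hφ, hφ, k6, k7]
    linarith
  · left
    intro p q hpq h1 h2 h3 h4
    obtain ⟨⟨k1, k2, k3⟩, ⟨k4, k5⟩, k6, k7⟩ := key p q hpq h1 h2 h3 h4
    have := hF (p - x + 1) (p - y + 1) (q - p) k1 (by omega) k2 k5
    rw [hφ, hφ, hφ, hφ, k6, k7]
    linarith

/-- On an affine piece the increments depend on their length only. -/
theorem noCrossing_of_piece (hφ : ∀ x p, φ x p = A (x - 1) + F (p - x + 1))
    (hF : ConvexPiece F a e) (hF' : ConcavePiece F a e) :
    NoCrossing φ (ColDom W w a e fl) := by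
  have key : ∀ t t' d, a ≤ t → a ≤ t' → 0 ≤ d → t + d < e → t' + d < e →
      F t' - F t = F (t' + d) - F (t + d) := by
    intro t t' d h1 h2 h3 h4 h5
    rcases le_total t t' with h | h
    · exact le_antisymm (hF _ _ _ h1 h h3 h5) (hF' _ _ _ h1 h h3 h5)
    · have := hF _ _ _ h2 h h3 h4
      have := hF' _ _ _ h2 h h3 h4
      linarith
  have main : ∀ x y p q, p ≤ q → ColDom W w a e fl x p → ColDom W w a e fl x q →
      ColDom W w a e fl y p → ColDom W w a e fl y q → φ x p - φ y p = φ x q - φ y q := by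
    intro x y p q hpq h1 h2 h3 h4
    have r1 := colDom_range h1
    have r2 := colDom_range h2
    have r3 := colDom_range h3
    have r4 := colDom_range h4
    have := key (p - y + 1) (p - x + 1) (q - p) (by omega) (by omega) (by omega) (by omega)
      (by omega)
    rw [hφ, hφ, hφ, hφ, show q - x + 1 = p - x + 1 + (q - p) by omega,
      show q - y + 1 = p - y + 1 + (q - p) by omega]
    linarith
  intro x y p q h1 h2 h3 h4
  rcases le_total p q with h | h
  · exact main x y p q h h1 h2 h3 h4
  · exact (main x y q p h h2 h1 h4 h3).symm

end Pieces

/-! ## One piece of the summand of one item -/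

variable {E : Env} {K : ℕ} {W w base : ℤ} {s s' : State}

/-- Contents of the registers during the treatment of one item. -/
structure ItemRegs (K : ℕ) (W w base : ℤ) (s : State) : Prop where
  r1 : s.ireg 1 = W
  r4 : s.ireg 4 = 2 ^ K
  r5 : s.ireg 5 = base
  r6 : s.ireg 6 = w
  r7 : s.ireg 7 = W / w + 1

theorem ItemRegs.of_frame {P : Prog} (h : ItemRegs K W w base s) (hf : Frame P s s')
    (hP : (P.writesI 1 || P.writesI 4 || P.writesI 5 || P.writesI 6 || P.writesI 7) = false) :
    ItemRegs K W w base s' := by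
  simp only [Bool.or_eq_false_iff] at hP
  exact ⟨(hf.ireg 1 hP.1.1.1.1).trans h.r1, (hf.ireg 4 hP.1.1.1.2).trans h.r4,
    (hf.ireg 5 hP.1.1.2).trans h.r5, (hf.ireg 6 hP.1.2).trans h.r6, (hf.ireg 7 hP.2).trans h.r7⟩

/-- Numerical assumptions during the treatment of one item. -/
structure ItemBounds (E : Env) (K : ℕ) (W w : ℤ) : Prop where
  two_le : 2 ≤ W
  one_le : 1 ≤ w
  le_pow : 2 * W ≤ 2 ^ K
  pow_le : 4 * 2 ^ K ≤ (E.b : ℤ)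

/-- The position of the sum `r13`. -/
def posExpr : IExpr := .reg 13 %ᵢ .reg 6 *ᵢ .reg 7 +ᵢ .reg 13 /ᵢ .reg 6

/-- The code of the function of the sum `r13` and the range of its positions. -/
def colRange : Prog :=
  .setReg 14 posExpr ;;
  .setReg 19 (.reg 14 +ᵢ .const 1) ;;
  .setReg 15 (.reg 14 +ᵢ .reg 11 +ᵢ .reg 4) ;;
  .ite ((.reg 1 -ᵢ .reg 13) /ᵢ .reg 6 +ᵢ .const 1 ≤ᵢ .reg 12)
    (.setReg 16 (.reg 14 +ᵢ ((.reg 1 -ᵢ .reg 13) /ᵢ .reg 6 +ᵢ .const 1) +ᵢ .reg 4))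
    (.setReg 16 (.reg 14 +ᵢ .reg 12 +ᵢ .reg 4))

/-- Insertion of the function of the sum `r13`, followed by an increment of `r13`. -/
def insertCol : Prog :=
  .ite (.const 1 ≤ᵢ .get 1 (.reg 5 -ᵢ .reg 1 -ᵢ .const 1 +ᵢ .reg 13))
    (colRange ;; insertRange) .skip ;;
  .setReg 13 (.reg 13 +ᵢ .const 1)

/-- The sum `y` is attained with the preceding items. -/
def PrevFlag (W base : ℤ) (fl : ℤ → ℤ) (y : ℤ) : Prop := 1 ≤ fl (base - W - 1 + y)

/-- The cut at `⌊(W - y) / w⌋ + 1` keeps the sums at most `W`, and hence the positions inside the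
residue block of `y`. -/
theorem colRange_spec {a e y : ℤ} (hB : ItemBounds E K W w) (hr : ItemRegs K W w base s)
    (ha : s.ireg 11 = a) (he : s.ireg 12 = e) (hy : s.ireg 13 = y) (ha0 : 0 ≤ a)
    (haW : a ≤ W + 1) (he0 : 0 ≤ e) (hy0 : 0 ≤ y) (hyW : y ≤ W) :
    wp E colRange s fun T s' => T ≤ 60 ∧ s'.ireg 19 = sumPos W w y + 1 ∧
      s'.ireg 15 = sumPos W w y + a + 2 ^ K ∧
      s'.ireg 16 = sumPos W w y + min e ((W - y) / w + 1) + 2 ^ K := by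
  obtain ⟨r1, r4, r5, r6, r7⟩ := hr
  obtain ⟨b1, b2, b3, b4⟩ := hB
  have p1 := sumPos_nonneg (W := W) b2 hy0 hyW
  have p2 := sumPos_add_ediv_lt b1 b2 hy0 hyW
  have p3 : 0 ≤ (W - y) / w := Int.ediv_nonneg (by omega) (by omega)
  have hpos : y % w * (W / w + 1) + y / w = sumPos W w y := rfl
  simp [colRange, posExpr, r1, r4, r6, r7, ha, he, hy, hpos]
  refine ⟨?_, ?_, ?_, fun h2 => ⟨?_, ?_⟩, fun h2 => ⟨?_, ?_⟩⟩
  · exact fun _ => by rw [abs_of_nonneg (by omega)]; omega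
  · exact fun _ => by rw [abs_of_nonneg (by omega)]; omega
  · exact fun _ => by rw [abs_of_nonneg (by omega)]; omega
  · exact fun _ => by rw [abs_of_nonneg (by omega)]; omega
  · omega
  · exact fun _ => by rw [abs_of_nonneg (by omega)]; omega
  · omega

theorem insertCol_spec (hE : E.Valid) {δ : ℕ} {a e y : ℤ} {φ : ℤ → ℤ → ℝ}
    (hB : ItemBounds E K W w) (hr : ItemRegs K W w base s) (ha : s.ireg 11 = a)
    (he : s.ireg 12 = e) (hy : s.ireg 13 = y) (ha0 : 0 ≤ a) (haW : a ≤ W + 1) (he0 : 0 ≤ e)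
    (hy0 : 0 ≤ y) (hyW : y ≤ W)
    (hφ : ∀ x p, φ x p = s.varr 2 (x - 1) + s.varr 1 (p - x + 1))
    (hsc : SingleCrossing φ (ColDom W w a e (PrevFlag W base (s.iarr 1))))
    (hT : TreeSound K (ColDom W w a e (PrevFlag W base (s.iarr 1))) (s.iarr 3))
    (hδ : K + 1 ≤ δ ∨ NoCrossing φ (ColDom W w a e (PrevFlag W base (s.iarr 1))))
    (hδ1 : 1 ≤ δ) :
    wp E insertCol s fun T s' => T ≤ 500 * ((K + 1) * δ) ∧
      TreeSound K (ColDom W w a e (PrevFlag W base (s.iarr 1))) (s'.iarr 3) ∧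
      (∀ p y, Covers K φ (s.iarr 3) p y → Covers K φ (s'.iarr 3) p y) ∧
      (PrevFlag W base (s.iarr 1) y → ∀ t, a ≤ t → t < e → y + t * w ≤ W →
        Covers K φ (s'.iarr 3) (sumPos W w y + t) (φ (sumPos W w y + 1) (sumPos W w y + t))) ∧
      s'.ireg 13 = y + 1 := by
  have b1 := hB.two_le
  have b2 := hB.one_le
  have b3 := hB.le_pow
  have b4 := hB.pow_le
  have p1 := sumPos_nonneg (W := W) b2 hy0 hyW
  have p2 := sumPos_add_ediv_lt b1 b2 hy0 hyW
  have hKδ : 1 ≤ (K + 1) * δ := Nat.mul_pos (by omega) hδ1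
  simp [insertCol, hr.r1, hr.r5, hy]
  refine ⟨fun h1 => ?_, fun h1 => ⟨?_, by omega, hT, fun h => ?_⟩⟩
  · refine wp_call (colRange_spec hB hr ha he hy ha0 haW he0 hy0 hyW) ?_
    rintro T1 s1 ⟨c1, c2, c3, c4⟩ f1
    refine wp_call (insertRange_spec hE (δ := δ) ((f1.ireg 4 rfl).trans hr.r4) (by omega)
      (by rw [f1.varr 1 rfl, f1.varr 2 rfl]; exact hφ) hsc
      (by rw [f1.iarr 3 rfl]; exact hT) (by omega) c2 c3 c4 (by omega) (by omega)
      (fun p hp1 hp2 => ?_) hδ hδ1) ?_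
    · refine ⟨y, hy0, hyW, h1, rfl, p - sumPos W w y, by omega, by omega, ?_, by omega⟩
      rw [← le_sub_ediv b2]
      omega
    · rintro T2 s2 ⟨d1, d2, d3, d4⟩ f2
      have e13 : s2.ireg 13 = y := (f2.ireg 13 rfl).trans ((f1.ireg 13 rfl).trans hy)
      rw [f1.iarr 3 rfl] at d3
      simp [e13]
      refine ⟨fun _ => by rw [abs_of_nonneg (by omega)]; omega, by omega, d2, d3,
        fun _ t t1 t2 t3 => d4 _ (by omega) ?_⟩
      rw [← le_sub_ediv b2] at t3
      omega
  · exact fun _ => by rw [abs_of_nonneg (by omega)]; omega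
  · unfold PrevFlag at h
    omega

/-- Insertion of the functions of all sums. -/
def insertCols : Prog :=
  .setReg 13 (.const 0) ;; .while (.reg 13 ≤ᵢ .reg 1) insertCol

theorem insertCols_spec (hE : E.Valid) {δ : ℕ} {a e : ℤ} {φ : ℤ → ℤ → ℝ}
    (hB : ItemBounds E K W w) (hr : ItemRegs K W w base s) (ha : s.ireg 11 = a)
    (he : s.ireg 12 = e) (ha0 : 0 ≤ a) (haW : a ≤ W + 1) (he0 : 0 ≤ e)
    (hφ : ∀ x p, φ x p = s.varr 2 (x - 1) + s.varr 1 (p - x + 1))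
    (hsc : SingleCrossing φ (ColDom W w a e (PrevFlag W base (s.iarr 1))))
    (hT : TreeSound K (ColDom W w a e (PrevFlag W base (s.iarr 1))) (s.iarr 3))
    (hδ : K + 1 ≤ δ ∨ NoCrossing φ (ColDom W w a e (PrevFlag W base (s.iarr 1))))
    (hδ1 : 1 ≤ δ) :
    wp E insertCols s fun T s' => T ≤ 600 * (2 ^ K * ((K + 1) * δ)) ∧
      TreeSound K (ColDom W w a e (PrevFlag W base (s.iarr 1))) (s'.iarr 3) ∧
      ∀ y t, 0 ≤ y → PrevFlag W base (s.iarr 1) y → a ≤ t → t < e → y + t * w ≤ W →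
        Covers K φ (s'.iarr 3) (sumPos W w y + t) (φ (sumPos W w y + 1) (sumPos W w y + t)) := by
  have b1 := hB.two_le
  have b2 := hB.one_le
  have b3 := hB.le_pow
  have b4 := hB.pow_le
  have hKδ : 1 ≤ (K + 1) * δ := Nat.mul_pos (by omega) hδ1
  simp only [insertCols, wp_seq, wp_setReg]
  refine ⟨rfl, fun _ => by simp, ?_⟩
  refine wp_call (wp_while hE (500 * ((K + 1) * δ)) (fun ρ s' =>
    0 ≤ s'.ireg 13 ∧ W + 1 = ρ + s'.ireg 13 ∧
    TreeSound K (ColDom W w a e (PrevFlag W base (s.iarr 1))) (s'.iarr 3) ∧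
      ∀ y t, 0 ≤ y → y < s'.ireg 13 → PrevFlag W base (s.iarr 1) y → a ≤ t → t < e →
        y + t * w ≤ W → Covers K φ (s'.iarr 3) (sumPos W w y + t)
          (φ (sumPos W w y + 1) (sumPos W w y + t))) (ρ := (W + 1).toNat) rfl ?_ ?_) ?_
  · refine ⟨by simp, by simp; omega, hT, fun y t h1 h2 => ?_⟩
    simp at h2
    omega
  · rintro ρ s' hf hg ⟨i1, i2, i3, i4⟩ hc
    have hr' := (⟨hr.r1, hr.r4, hr.r5, hr.r6, hr.r7⟩ :
      ItemRegs K W w base (s.setI 13 0)).of_frame hf rfl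
    simp only [Cond.Holds, IExpr.eval, hr'.r1] at hc
    have e1 : s'.iarr 1 = s.iarr 1 := hf.iarr 1 rfl
    rw [← e1] at i3 hsc hδ
    refine wp_mono (insertCol_spec hE (y := s'.ireg 13) hB hr' ((hf.ireg 11 rfl).trans ha)
      ((hf.ireg 12 rfl).trans he) rfl ha0 haW he0 i1 hc
      (by rw [hf.varr 1 rfl, hf.varr 2 rfl]; exact hφ) hsc i3 hδ hδ1) ?_
    rintro T s'' ⟨d1, d2, d3, d4, d5⟩
    rw [e1] at d2 d4
    refine ⟨d1, by omega, by omega, by omega, d2, fun y t h0 h1 h2 h3 h4 h5 => ?_⟩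
    rcases lt_or_eq_of_le (show y ≤ s'.ireg 13 by omega) with h | rfl
    · exact d3 _ _ (i4 y t h0 h h2 h3 h4 h5)
    · exact d4 h2 t h3 h4 h5
  · rintro T s' ⟨h1, h2, ρ', h3, h4, h5, h6⟩ hf
    have e1 : s'.ireg 1 = W := (hf.ireg 1 rfl).trans hr.r1
    simp [e1] at h1 h2 ⊢
    refine ⟨?_, h5, fun y t h0 h1 h2 h3 h4 => h6 y t h0 ?_ h1 h2 h3 h4⟩
    · have hW : (W + 1).toNat ≤ 2 ^ K := by zify; omega
      have := Nat.mul_le_mul_right (500 * ((K + 1) * δ) + 1 + 3) hW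
      have hK1 : 1 ≤ 2 ^ K := Nat.one_le_two_pow
      have h7 : 2 ^ K ≤ 2 ^ K * ((K + 1) * δ) := Nat.le_mul_of_pos_right _ hKδ
      rw [show 2 ^ K * (500 * ((K + 1) * δ) + 1 + 3) =
        500 * (2 ^ K * ((K + 1) * δ)) + 4 * 2 ^ K by ring] at this
      omega
    · have : 0 ≤ t * w := mul_nonneg (by omega) (by omega)
      omega

end

end Knap

/-! ### Evaluation of the tree at the sums -/

namespace Knap

noncomputable section

variable {E : Env} {K : ℕ} {W w base : ℤ} {s s' s'' : State}

/-- The entry `z` of the layers is empty, or its choice and its value satisfy `R`. -/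
def RowSound (R : ℤ → ℝ → Prop) (z : ℤ) (s : State) : Prop :=
  s.iarr 1 z = 0 ∨ (s.iarr 1 z = 1 ∧ R (s.iarr 2 z) (s.varr 0 z))

/-- The entry `z` of the layers has at least the value `v`. -/
def RowGe (z : ℤ) (v : ℝ) (s : State) : Prop := s.iarr 1 z = 1 ∧ v ≤ s.varr 0 z

/-- The layers agree in the entry `z`. -/
def RowEq (s s' : State) (z : ℤ) : Prop :=
  s'.iarr 1 z = s.iarr 1 z ∧ s'.iarr 2 z = s.iarr 2 z ∧ s'.varr 0 z = s.varr 0 z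

theorem RowEq.refl (s : State) (z : ℤ) : RowEq s s z := ⟨rfl, rfl, rfl⟩

theorem RowEq.trans {z : ℤ} (h : RowEq s s' z) (h' : RowEq s' s'' z) : RowEq s s'' z :=
  ⟨h'.1.trans h.1, h'.2.1.trans h.2.1, h'.2.2.trans h.2.2⟩

theorem RowEq.of_frame {P : Prog} (hf : Frame P s s')
    (hP : (P.writesIA 1 || P.writesIA 2 || P.writesVA 0) = false) (z : ℤ) : RowEq s s' z := by
  simp only [Bool.or_eq_false_iff] at hP
  exact ⟨by rw [hf.iarr 1 hP.1.1], by rw [hf.iarr 2 hP.1.2], by rw [hf.varr 0 hP.2]⟩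

theorem RowSound.congr {R : ℤ → ℝ → Prop} {z : ℤ} (h : RowSound R z s) (he : RowEq s s' z) :
    RowSound R z s' := by
  unfold RowSound at h ⊢
  rwa [he.1, he.2.1, he.2.2]

theorem RowGe.congr {v : ℝ} {z : ℤ} (h : RowGe z v s) (he : RowEq s s' z) : RowGe z v s' := by
  unfold RowGe at h ⊢
  rwa [he.1, he.2.2]

/-- The function stored at the node `r18` competes for the entry of the sum `r13`, which has the
position `r14`. -/
def queryNode : Prog :=
  .ite (.const 1 ≤ᵢ .get 3 (.reg 18))
    (.setReg 19 (.get 3 (.reg 18)) ;;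
     .ite (.and (.const 1 ≤ᵢ .get 1 (.reg 5 +ᵢ .reg 13))
         (treeFun (.reg 19) (.reg 14) ≤ʳ .get 0 (.reg 5 +ᵢ .reg 13)))
       .skip
       (.setArr 1 (.reg 5 +ᵢ .reg 13) (.const 1) ;;
        .setArr 2 (.reg 5 +ᵢ .reg 13) (.reg 14 -ᵢ .reg 19 +ᵢ .const 1) ;;
        .setVArr 0 (.reg 5 +ᵢ .reg 13) (treeFun (.reg 19) (.reg 14))))
    .skip ;;
  .setReg 18 (.reg 18 /ᵢ .const 2)

/-- An entry is overwritten only if it is empty or strictly smaller, so lower bounds that were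
reached before survive. -/
theorem queryNode_spec (hE : E.Valid) {y p v : ℤ} {φ : ℤ → ℤ → ℝ} {R : ℤ → ℝ → Prop}
    (hg : E.Good s) (h5 : s.ireg 5 = base) (h13 : s.ireg 13 = y) (h14 : s.ireg 14 = p)
    (h18 : s.ireg 18 = v) (hv : 0 ≤ v) (hb : v ≤ (E.b : ℤ))
    (hφ : ∀ x p, φ x p = s.varr 2 (x - 1) + s.varr 1 (p - x + 1))
    (hX : 1 ≤ s.iarr 3 v → R (p - s.iarr 3 v + 1) (φ (s.iarr 3 v) p) ∧
      E.VOk (φ (s.iarr 3 v) p) ∧ |p - s.iarr 3 v + 1| ≤ (E.b : ℤ))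
    (hs : RowSound R (base + y) s) :
    wp E queryNode s fun T s' => T ≤ 70 ∧ RowSound R (base + y) s' ∧
      (∀ u, RowGe (base + y) u s → RowGe (base + y) u s') ∧
      (1 ≤ s.iarr 3 v → RowGe (base + y) (φ (s.iarr 3 v) p) s') ∧
      (∀ z, z ≠ base + y → RowEq s s' z) ∧ s'.ireg 18 = v / 2 := by
  have hb2 := hE.two_le
  have hv2 : |v / 2| ≤ (E.b : ℤ) := by rw [abs_of_nonneg (by omega)]; omega
  have hTb := hg.iarr 3 v
  simp [queryNode, treeFun, h5, h13, h14, h18, hTb, hv2]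
  simp only [← hφ]
  refine ⟨fun h => ⟨fun h1 h2 => ⟨hs, fun _ h => h, fun _ => ⟨?_, h2⟩,
    fun z _ => ⟨rfl, rfl, rfl⟩⟩, fun h1 => ?_⟩, fun h => ?_⟩
  · rcases hs with h0 | h0
    · omega
    · exact h0.1
  · obtain ⟨x1, x2, x3⟩ := hX h
    simp only [RowSound, RowGe, RowEq]
    simp
    refine ⟨by omega, fun _ => x3, fun _ => x2, x1, fun u hu1 hu2 => ?_,
      fun z hz => by simp [hz]⟩
    exact hu2.trans (h1 (by omega)).le
  · exact ⟨hs, fun _ h => h, fun h' => by omega, fun z _ => ⟨rfl, rfl, rfl⟩⟩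

/-- Identifies the numbers met on the way up from a leaf: `v ≥ 1` excludes heights above `K`,
because then `v * 2 ^ j ≥ 2 * 2 ^ K` would exceed the leaf number. -/
theorem isNode_of_inNode {j : ℕ} {v p : ℤ} (h : InNode K j v p) (hv : 1 ≤ v) (hp0 : 0 ≤ p)
    (hp : p < 2 ^ K) : IsNode K j v := by
  obtain ⟨h1, h2⟩ := h
  have hj1 : (1 : ℤ) ≤ 2 ^ j := one_le_pow₀ (by norm_num)
  have hjK : j ≤ K := by
    by_contra hjK
    obtain ⟨d, rfl⟩ := Nat.exists_eq_add_of_lt (not_le.1 hjK)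
    have h3 : (2 : ℤ) ^ (K + d + 1) = 2 * (2 ^ K * 2 ^ d) := by ring
    have h4 : (1 : ℤ) ≤ 2 ^ d := one_le_pow₀ (by norm_num)
    have h5 : (2 : ℤ) ^ K ≤ 2 ^ K * 2 ^ d := le_mul_of_one_le_right (by positivity) h4
    rw [h3] at h1
    nlinarith
  obtain ⟨d, rfl⟩ := Nat.exists_eq_add_of_le hjK
  rw [pow_add] at *
  have h3 : (2 : ℤ) ^ d < v + 1 := by
    by_contra h
    have := mul_le_mul_of_nonneg_left (not_lt.1 h) (by omega : (0 : ℤ) ≤ 2 ^ j)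
    linarith
  have h4 : v < 2 * 2 ^ d := by
    by_contra h
    have := mul_le_mul_of_nonneg_left (not_lt.1 h) (by omega : (0 : ℤ) ≤ 2 ^ j)
    linarith
  constructor
  · rw [pow_add]
    nlinarith [mul_le_mul_of_nonneg_left (show (2 : ℤ) ^ d ≤ v by omega)
      (by omega : (0 : ℤ) ≤ 2 ^ j)]
  · rw [pow_add]
    nlinarith [mul_le_mul_of_nonneg_left (show v + 1 ≤ 2 * (2 : ℤ) ^ d by omega)
      (by omega : (0 : ℤ) ≤ 2 ^ j)]

theorem InNode.unique {j : ℕ} {v v' p : ℤ} (h : InNode K j v p) (h' : InNode K j v' p) :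
    v = v' := by
  have key : ∀ {v v' : ℤ}, InNode K j v p → InNode K j v' p → v ≤ v' := by
    intro v v' h h'
    by_contra hlt
    have : (v' + 1) * 2 ^ j ≤ v * 2 ^ j :=
      mul_le_mul_of_nonneg_right (by omega) (by positivity)
    have e : (v' + 1) * (2 : ℤ) ^ j = v' * 2 ^ j + 2 ^ j := by ring
    have := h.1
    have := h'.2
    omega
  exact le_antisymm (key h h') (key h' h)

theorem InNode.parent {j : ℕ} {v p : ℤ} (h : InNode K j v p) : InNode K (j + 1) (v / 2) p := by
  obtain ⟨h1, h2⟩ := h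
  have e : (2 : ℤ) ^ (j + 1) = 2 * 2 ^ j := by ring
  have q1 : v / 2 * 2 * 2 ^ j ≤ v * (2 : ℤ) ^ j :=
    mul_le_mul_of_nonneg_right (by omega) (by positivity)
  have q2 : (v + 1) * (2 : ℤ) ^ j ≤ (v / 2 * 2 + 2) * 2 ^ j :=
    mul_le_mul_of_nonneg_right (by omega) (by positivity)
  constructor <;> rw [e] <;> linarith

/-- The functions stored above the position of the sum `r13` compete for its entry; then `r13` is
increased. -/
def queryRow : Prog :=
  .setReg 14 posExpr ;;
  .setReg 18 (.reg 14 +ᵢ .reg 4) ;;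
  .while (.const 1 ≤ᵢ .reg 18) queryNode ;;
  .setReg 13 (.reg 13 +ᵢ .const 1)

/-- All functions that can cover a position are stored on the path from its leaf to the root, which
has `K + 1` nodes. -/
theorem queryRow_spec (hE : E.Valid) {y : ℤ} {φ : ℤ → ℤ → ℝ} {Dom : ℤ → ℤ → Prop}
    {R : ℤ → ℝ → Prop}
    (hB : ItemBounds E K W w) (hr : ItemRegs K W w base s) (hy : s.ireg 13 = y)
    (hy0 : 0 ≤ y) (hyW : y ≤ W)
    (hφ : ∀ x p, φ x p = s.varr 2 (x - 1) + s.varr 1 (p - x + 1))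
    (hT : TreeSound K Dom (s.iarr 3))
    (hX : ∀ x, Dom x (sumPos W w y) → R (sumPos W w y - x + 1) (φ x (sumPos W w y)) ∧
      E.VOk (φ x (sumPos W w y)) ∧ |sumPos W w y - x + 1| ≤ (E.b : ℤ))
    (hs : RowSound R (base + y) s) :
    wp E queryRow s fun T s' => T ≤ 120 * (K + 1) ∧ RowSound R (base + y) s' ∧
      (∀ u, RowGe (base + y) u s → RowGe (base + y) u s') ∧
      (∀ u, Covers K φ (s.iarr 3) (sumPos W w y) u → RowGe (base + y) u s') ∧
      (∀ z, z ≠ base + y → RowEq s s' z) ∧ s'.ireg 13 = y + 1 := by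
  obtain ⟨r1, r4, r5, r6, r7⟩ := hr
  obtain ⟨b1, b2, b3, b4⟩ := hB
  have p1 := sumPos_nonneg (W := W) b2 hy0 hyW
  have p2 := sumPos_lt b1 b2 hy0 hyW
  have hpos : y % w * (W / w + 1) + y / w = sumPos W w y := rfl
  generalize hP : sumPos W w y = P at *
  simp only [queryRow, wp_seq, wp_setReg]
  simp [posExpr, r4, r6, r7, hy, hpos]
  refine ⟨fun _ => by rw [abs_of_nonneg (by omega)]; omega,
    fun _ => by rw [abs_of_nonneg (by omega)]; omega, ?_⟩
  refine wp_call (wp_while hE 70 (fun ρ s' => RowSound R (base + y) s' ∧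
    (∀ u, RowGe (base + y) u s → RowGe (base + y) u s') ∧ (∀ z, z ≠ base + y → RowEq s s' z) ∧
    0 ≤ s'.ireg 18 ∧ ∃ j : ℕ, InNode K j (s'.ireg 18) P ∧ K + 1 ≤ ρ + j ∧
      ∀ i < j, ∀ v, IsNode K i v → InNode K i v P → 1 ≤ s.iarr 3 v →
        RowGe (base + y) (φ (s.iarr 3 v) P) s') (ρ := K + 1) rfl ?_ ?_) ?_
  · refine ⟨hs, fun _ h => h, fun z _ => ⟨rfl, rfl, rfl⟩, by simp; omega, 0, ?_, by omega,
      fun i hi => by omega⟩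
    constructor <;> simp
  · rintro ρ s' hf hg ⟨i1, i2, i3, i4, j, i5, i6, i7⟩ hc
    simp only [Cond.Holds, IExpr.eval] at hc
    have nv := isNode_of_inNode i5 hc p1 (by omega)
    have e3 : s'.iarr 3 = s.iarr 3 := hf.iarr 3 rfl
    have hjK := nv.height_le
    refine wp_mono (queryNode_spec hE hg ((hf.ireg 5 rfl).trans r5) ((hf.ireg 13 rfl).trans hy)
      (hf.ireg 14 rfl) rfl i4 (by have := nv.lt; omega)
      (by rw [hf.varr 1 rfl, hf.varr 2 rfl]; exact hφ)
      (fun h => ?_) i1) ?_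
    · rw [e3] at h ⊢
      exact hX _ (hT _ _ _ nv h i5)
    · rintro T s'' ⟨d1, d2, d3, d4, d5, d6⟩
      refine ⟨d1, by omega, d2, fun u h => d3 u (i2 u h), fun z hz => (i3 z hz).trans (d5 z hz),
        by omega, j + 1, d6 ▸ i5.parent, by omega, fun i hi v hv1 hv2 hv3 => ?_⟩
      rcases Nat.lt_succ_iff_lt_or_eq.1 hi with h | rfl
      · exact d3 _ (i7 i h v hv1 hv2 hv3)
      · obtain rfl := hv2.unique i5
        rw [e3] at d4
        exact d4 hv3
  · rintro T s' ⟨h1, h2, ρ', h3, h4, h5, h6, j, h7, h8, h9⟩ hf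
    have e13 : s'.ireg 13 = y := (hf.ireg 13 rfl).trans hy
    simp at h1 h2
    simp [e13]
    refine ⟨fun _ => by rw [abs_of_nonneg (by omega)]; omega, by omega, h3, h4, fun u hu => ?_,
      fun z hz => h5 z hz⟩
    obtain ⟨i, v, v1, v2, v3, v4⟩ := hu
    have : RowGe (base + y) (φ (s.iarr 3 v) P) s' := by
      refine h9 i ?_ v v1 v2 v3
      -- Otherwise the walk has reached the number `0` at height `j`, so that `P + 2 ^ K < 2 ^ j`,
      -- although a node of height `i ≥ j` lies above `P`.
      by_contra hij
      have e0 : s'.ireg 18 = 0 := by omega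
      have h10 := h7.2
      rw [e0] at h10
      have h11 : (2 : ℤ) ^ j ≤ 2 ^ i := pow_le_pow_right₀ (by norm_num) (by omega)
      have h12 := v2.1
      have h13 : (2 : ℤ) ^ i ≤ v * 2 ^ i := le_mul_of_one_le_left (by positivity) v1.pos
      omega
    exact ⟨this.1, v4.trans this.2⟩

end

end Knap

/-! ### A layer as an envelope of the preceding one -/

namespace Knap

noncomputable section

variable {E : Env} {K : ℕ} {W w base : ℤ} {s s' s'' : State}

/-- Evaluation of the tree at all sums. -/
def queryRows : Prog :=
  .setReg 13 (.const 0) ;; .while (.reg 13 ≤ᵢ .reg 1) queryRow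

theorem ItemRegs.setI {k : ℕ} {z : ℤ} (h : ItemRegs K W w base s)
    (hk : k ≠ 1 ∧ k ≠ 4 ∧ k ≠ 5 ∧ k ≠ 6 ∧ k ≠ 7) : ItemRegs K W w base (s.setI k z) := by
  obtain ⟨h1, h2, h3, h4, h5⟩ := hk
  constructor
  · rw [State.setI_ireg, if_neg h1.symm, h.r1]
  · rw [State.setI_ireg, if_neg h2.symm, h.r4]
  · rw [State.setI_ireg, if_neg h3.symm, h.r5]
  · rw [State.setI_ireg, if_neg h4.symm, h.r6]
  · rw [State.setI_ireg, if_neg h5.symm, h.r7]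

theorem queryRows_spec (hE : E.Valid) {φ : ℤ → ℤ → ℝ} {Dom : ℤ → ℤ → Prop}
    {R : ℤ → ℤ → ℝ → Prop}
    (hB : ItemBounds E K W w) (hr : ItemRegs K W w base s)
    (hφ : ∀ x p, φ x p = s.varr 2 (x - 1) + s.varr 1 (p - x + 1))
    (hT : TreeSound K Dom (s.iarr 3))
    (hX : ∀ y, 0 ≤ y → y ≤ W → ∀ x, Dom x (sumPos W w y) →
      R y (sumPos W w y - x + 1) (φ x (sumPos W w y)) ∧
      E.VOk (φ x (sumPos W w y)) ∧ |sumPos W w y - x + 1| ≤ (E.b : ℤ))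
    (hs : ∀ y, 0 ≤ y → y ≤ W → RowSound (R y) (base + y) s) :
    wp E queryRows s fun T s' => T ≤ 130 * (2 ^ K * (K + 1)) ∧
      (∀ y, 0 ≤ y → y ≤ W → RowSound (R y) (base + y) s') ∧
      (∀ y u, RowGe (base + y) u s → RowGe (base + y) u s') ∧
      (∀ y, 0 ≤ y → y ≤ W → ∀ u, Covers K φ (s.iarr 3) (sumPos W w y) u →
        RowGe (base + y) u s') ∧
      (∀ z, z < base ∨ base + W < z → RowEq s s' z) := by
  have b1 := hB.two_le
  have b2 := hB.one_le
  have b3 := hB.le_pow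
  have b4 := hB.pow_le
  simp only [queryRows, wp_seq, wp_setReg]
  refine ⟨rfl, fun _ => by simp, ?_⟩
  have hr0 : ItemRegs K W w base (s.setI 13 0) := hr.setI (by decide)
  refine wp_call (wp_while hE (120 * (K + 1)) (fun ρ s' =>
    0 ≤ s'.ireg 13 ∧ W + 1 = ρ + s'.ireg 13 ∧
    (∀ y, 0 ≤ y → y ≤ W → RowSound (R y) (base + y) s') ∧
    (∀ y u, RowGe (base + y) u s → RowGe (base + y) u s') ∧
    (∀ y, 0 ≤ y → y < s'.ireg 13 → ∀ u, Covers K φ (s.iarr 3) (sumPos W w y) u →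
        RowGe (base + y) u s') ∧
    (∀ z, z < base ∨ base + W < z → RowEq s s' z)) (ρ := (W + 1).toNat) rfl ?_ ?_) ?_
  · refine ⟨by simp, by simp; omega, hs, fun _ _ h => h, fun y h1 h2 => ?_, fun z _ => .refl _ _⟩
    simp at h2
    omega
  · rintro ρ s' hf hg ⟨i1, i2, i3, i4, i5, i6⟩ hc
    have hr' := hr0.of_frame hf rfl
    simp only [Cond.Holds, IExpr.eval, hr'.r1] at hc
    have e3 : s'.iarr 3 = s.iarr 3 := hf.iarr 3 rfl
    refine wp_mono (queryRow_spec hE (y := s'.ireg 13) (Dom := Dom) (R := R (s'.ireg 13)) hB hr'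
      rfl i1 hc (by rw [hf.varr 1 rfl, hf.varr 2 rfl]; exact hφ) (by rwa [e3])
      (hX _ i1 hc) (i3 _ i1 hc)) ?_
    rintro T s'' ⟨d1, d2, d3, d4, d5, d6⟩
    rw [e3] at d4
    have heq : ∀ y, y ≠ s'.ireg 13 → RowEq s' s'' (base + y) := fun y hy => d5 _ (by omega)
    refine ⟨d1, by omega, by omega, by omega, fun y h1 h2 => ?_, fun y u h => ?_,
      fun y h1 h2 u h => ?_, fun z hz => (i6 z hz).trans (d5 z (by omega))⟩
    · rcases eq_or_ne y (s'.ireg 13) with rfl | hy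
      · exact d2
      · exact (i3 y h1 h2).congr (heq y hy)
    · rcases eq_or_ne y (s'.ireg 13) with rfl | hy
      · exact d3 u (i4 _ u h)
      · exact (i4 y u h).congr (heq y hy)
    · rcases eq_or_ne y (s'.ireg 13) with rfl | hy
      · exact d4 u h
      · exact (i5 y h1 (by omega) u h).congr (heq y hy)
  · rintro T s' ⟨h1, h2, ρ', h3, h4, h5, h6, h7, h8⟩ hf
    have e1 : s'.ireg 1 = W := (hf.ireg 1 rfl).trans hr0.r1
    simp [e1] at h1 h2 ⊢
    refine ⟨?_, h5, h6, fun y hy0 hy u hu => h7 y hy0 (by omega) u hu, h8⟩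
    have hW : (W + 1).toNat ≤ 2 ^ K := by zify; omega
    have := Nat.mul_le_mul_right (120 * (K + 1) + 1 + 3) hW
    rw [show 2 ^ K * (120 * (K + 1) + 1 + 3) =
      120 * (2 ^ K * (K + 1)) + 4 * 2 ^ K by ring] at this
    have hK1 : 1 ≤ 2 ^ K := Nat.one_le_two_pow
    have h9 : 2 ^ K ≤ 2 ^ K * (K + 1) := Nat.le_mul_of_pos_right _ (by omega)
    omega

/-- The sum `y` is reached with `t` items of the current kind, and the objective value is `v`.
The data of the preceding layer and the values of the summand (for `t < X`) are taken from the
memory. -/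
def Step (W w base X : ℤ) (s : State) (y t : ℤ) (v : ℝ) : Prop :=
  0 ≤ t ∧ t < X ∧ 0 ≤ y - t * w ∧ PrevFlag W base (s.iarr 1) (y - t * w) ∧
    v = s.varr 0 (base - W - 1 + (y - t * w)) + s.varr 1 t

/-- Candidates read only entries below `base`, as `y - t * w ≤ W`; writing to the current layer does
not change them. -/
theorem step_congr {X y : ℤ} (hw : 1 ≤ w) (hy : y ≤ W) (h : ∀ z < base, RowEq s s' z)
    (hF : s'.varr 1 = s.varr 1) : Step W w base X s' y = Step W w base X s y := by
  funext t v
  simp only [Step, PrevFlag, hF]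
  refine propext ⟨?_, ?_⟩ <;> rintro ⟨h1, h2, h3, h4, h5⟩ <;>
    have := mul_nonneg h1 (by omega : 0 ≤ w) <;>
    obtain ⟨e1, _, e3⟩ := h (base - W - 1 + (y - t * w)) (by omega)
  · exact ⟨h1, h2, h3, by rwa [e1] at h4, by rwa [e3] at h5⟩
  · exact ⟨h1, h2, h3, by rwa [e1], by rwa [e3]⟩

/-- The part of the layer that belongs to the piece `r11, ..., r12 - 1`. -/
def convPiece : Prog := clearTree ;; insertCols ;; queryRows

/-- Soundness comes from the domains of the functions in the tree, optimality on the piece from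
`Covers`. The bounds `hV` are needed for genuine candidates only, since nothing else is ever
written. -/
theorem convPiece_spec (hE : E.Valid) {δ : ℕ} {a e X : ℤ}
    (hB : ItemBounds E K W w) (hr : ItemRegs K W w base s) (ha : s.ireg 11 = a)
    (he : s.ireg 12 = e) (ha0 : 0 ≤ a) (haW : a ≤ W + 1) (he0 : 0 ≤ e) (heX : e ≤ X)
    (hX : X ≤ W + 1)
    (hA : ∀ y, 0 ≤ y → y ≤ W → s.varr 2 (sumPos W w y) = s.varr 0 (base - W - 1 + y))
    (hp : ConvexPiece (s.varr 1) a e ∨ ConcavePiece (s.varr 1) a e)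
    (hδ : K + 1 ≤ δ ∨ (ConvexPiece (s.varr 1) a e ∧ ConcavePiece (s.varr 1) a e))
    (hδ1 : 1 ≤ δ)
    (hV : ∀ y t v, 0 ≤ y → y ≤ W → Step W w base X s y t v → E.VOk v)
    (hs : ∀ y, 0 ≤ y → y ≤ W → RowSound (Step W w base X s y) (base + y) s) :
    wp E convPiece s fun T s' => T ≤ 800 * (2 ^ K * ((K + 1) * δ)) ∧
      (∀ y, 0 ≤ y → y ≤ W → RowSound (Step W w base X s y) (base + y) s') ∧
      (∀ y u, RowGe (base + y) u s → RowGe (base + y) u s') ∧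
      (∀ y, 0 ≤ y → y ≤ W → ∀ t v, a ≤ t → t < e → Step W w base X s y t v →
        RowGe (base + y) v s') ∧
      (∀ z, z < base ∨ base + W < z → RowEq s s' z) := by
  have b1 := hB.two_le
  have b2 := hB.one_le
  have b3 := hB.le_pow
  have b4 := hB.pow_le
  simp only [convPiece, wp_seq]
  refine wp_call (clearTree_spec hE hr.r4 (by omega)) ?_
  rintro T1 s1 ⟨c1, c2⟩ f1
  have hr1 := hr.of_frame f1 rfl
  have e1 : s1.iarr 1 = s.iarr 1 := f1.iarr 1 rfl
  set φ : ℤ → ℤ → ℝ := fun x p => s.varr 2 (x - 1) + s.varr 1 (p - x + 1) with hφ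
  have hφ' : ∀ x p, φ x p = s.varr 2 (x - 1) + s.varr 1 (p - x + 1) := fun _ _ => rfl
  refine wp_call (insertCols_spec hE (δ := δ) (φ := φ) hB hr1 ((f1.ireg 11 rfl).trans ha)
    ((f1.ireg 12 rfl).trans he) ha0 haW he0
    (by rw [f1.varr 1 rfl, f1.varr 2 rfl]; exact hφ') (singleCrossing_of_piece hφ' hp)
    (fun j v p hv hv1 _ => ?_) (hδ.imp_right fun h => noCrossing_of_piece hφ' h.1 h.2) hδ1) ?_
  · rw [c2 v hv.pos hv.lt] at hv1
    omega
  rintro T2 s2 ⟨d1, d2, d3⟩ f2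
  rw [e1] at d2 d3
  have hr2 := hr1.of_frame f2 rfl
  have q1 : ∀ z, RowEq s s2 z := fun z => (RowEq.of_frame f1 rfl z).trans (.of_frame f2 rfl z)
  refine wp_mono (queryRows_spec hE (φ := φ) (R := fun y => Step W w base X s y) hB hr2
    (by rw [f2.varr 1 rfl, f2.varr 2 rfl, f1.varr 1 rfl, f1.varr 2 rfl]; exact hφ') d2
    (fun y hy0 hyW x hx => ?_) (fun y hy0 hyW => (hs y hy0 hyW).congr (q1 _))) ?_
  · obtain ⟨y', y1, y2, y3, rfl, t, t1, t2, t3, t4⟩ := hx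
    rw [← sumPos_add b2] at t4
    have htw : 0 ≤ t * w := mul_nonneg (by omega) (by omega)
    -- A position determines its sum, so the function of `y'` enters the entry of `y' + t * w`, and
    -- there with exactly `t` items.
    obtain rfl := sumPos_injOn b2 hy0 hyW (by omega) t3 t4
    have e5 : sumPos W w (y' + t * w) - (sumPos W w y' + 1) + 1 = t := by
      rw [sumPos_add b2]; ring
    have hst : Step W w base X s (y' + t * w) t
        (φ (sumPos W w y' + 1) (sumPos W w (y' + t * w))) := by
      refine ⟨by omega, by omega, by omega, by rwa [add_sub_cancel_right], ?_⟩
      rw [hφ', e5, add_sub_cancel_right, add_sub_cancel_right, hA y' y1 y2]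
    rw [e5]
    exact ⟨hst, hV _ _ _ hy0 hyW hst, by rw [abs_of_nonneg (by omega)]; omega⟩
  · rintro T3 s3 ⟨g1, g2, g3, g4, g5⟩
    refine ⟨?_, g2, fun y u h => g3 y u (h.congr (q1 _)), fun y hy0 hyW t v t1 t2 ht => ?_,
      fun z hz => (q1 z).trans (g5 z hz)⟩
    · have h1 : 2 ^ K * (K + 1) ≤ 2 ^ K * ((K + 1) * δ) :=
        Nat.mul_le_mul_left _ (Nat.le_mul_of_pos_right _ hδ1)
      have h2 : 2 ^ K ≤ 2 ^ K * (K + 1) := Nat.le_mul_of_pos_right _ (by omega)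
      omega
    · obtain ⟨k1, k2, k3, k4, rfl⟩ := ht
      have htw : 0 ≤ t * w := mul_nonneg k1 (by omega)
      refine g4 y hy0 hyW _ ?_
      -- Conversely, the candidate with `t` items is a value of the function that belongs to the sum
      -- `y - t * w`.
      have := d3 (y - t * w) t k3 k4 t1 t2 (by omega)
      rw [← sumPos_add b2, sub_add_cancel] at this
      convert this using 1
      rw [hφ', add_sub_cancel_right, hA _ k3 (by omega)]
      congr 2
      have := sumPos_add (W := W) (w := w) (x := y - t * w) (t := t) b2
      rw [sub_add_cancel] at this
      omega

/-- The values of the preceding layer, sorted by positions. -/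
def sortLayer : Prog :=
  .setReg 13 (.const 0) ;;
  .while (.reg 13 ≤ᵢ .reg 1)
    (.setVArr 2 posExpr (.get 0 (.reg 5 -ᵢ .reg 1 -ᵢ .const 1 +ᵢ .reg 13)) ;;
     .setReg 13 (.reg 13 +ᵢ .const 1))

theorem sortLayer_spec (hE : E.Valid) (hB : ItemBounds E K W w) (hr : ItemRegs K W w base s) :
    wp E sortLayer s fun T s' => T ≤ 40 * 2 ^ K ∧
      ∀ y, 0 ≤ y → y ≤ W → s'.varr 2 (sumPos W w y) = s.varr 0 (base - W - 1 + y) := by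
  have b1 := hB.two_le
  have b2 := hB.one_le
  have b3 := hB.le_pow
  have b4 := hB.pow_le
  simp only [sortLayer, wp_seq, wp_setReg]
  refine ⟨rfl, fun _ => by simp, ?_⟩
  have hr0 : ItemRegs K W w base (s.setI 13 0) := hr.setI (by decide)
  refine wp_call (wp_while hE 24 (fun ρ s' => 0 ≤ s'.ireg 13 ∧ W + 1 = ρ + s'.ireg 13 ∧
    ∀ y, 0 ≤ y → y < s'.ireg 13 → s'.varr 2 (sumPos W w y) = s.varr 0 (base - W - 1 + y))
    (ρ := (W + 1).toNat) rfl ?_ ?_) ?_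
  · refine ⟨by simp, by simp; omega, fun y h1 h2 => ?_⟩
    simp at h2
    omega
  · rintro ρ s' hf hg ⟨i1, i2, i3⟩ hc
    obtain ⟨r1, r4, r5, r6, r7⟩ := hr0.of_frame hf rfl
    have e0 : s'.varr 0 = s.varr 0 := hf.varr 0 rfl
    have hv := hg.varr 0 (base - W - 1 + s'.ireg 13)
    simp [r1] at hc
    have hpos : s'.ireg 13 % w * (W / w + 1) + s'.ireg 13 / w = sumPos W w (s'.ireg 13) := rfl
    simp [posExpr, r1, r5, r6, r7, hpos, hv]
    refine ⟨fun _ => by rw [abs_of_nonneg (by omega)]; omega, by omega, by omega, by omega,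
      fun y h1 h2 => ?_⟩
    rw [Function.update_apply]
    split_ifs with h
    · rw [e0, sumPos_injOn b2 h1 (by omega) i1 hc h]
    · refine i3 y h1 (lt_of_le_of_ne (by omega) fun h' => h (by rw [h']))
  · rintro T s' ⟨h1, h2, ρ', h3, h4, h5⟩ hf
    have e1 : s'.ireg 1 = W := (hf.ireg 1 rfl).trans hr0.r1
    simp [e1] at h1 h2 ⊢
    refine ⟨?_, fun y hy0 hy => h5 y hy0 (by omega)⟩
    have hW : (W + 1).toNat ≤ 2 ^ K := by zify; omega
    have hK1 : 1 ≤ 2 ^ K := Nat.one_le_two_pow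
    omega

/-- The end points `tb 0, ..., tb np` divide `0, ..., X - 1` into pieces where `F` is convex or
concave (affine, if `lin` holds). -/
structure IsPartition (F : ℤ → ℝ) (X np : ℤ) (tb : ℤ → ℤ) (lin : Prop) : Prop where
  nonneg : 0 ≤ np
  zero : tb 0 = 0
  last : tb np = X
  mem : ∀ k, 0 ≤ k → k ≤ np → 0 ≤ tb k ∧ tb k ≤ X
  piece : ∀ k, 0 ≤ k → k < np →
    ConvexPiece F (tb k) (tb (k + 1)) ∨ ConcavePiece F (tb k) (tb (k + 1))
  affine : lin → ∀ k, 0 ≤ k → k < np →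
    ConvexPiece F (tb k) (tb (k + 1)) ∧ ConcavePiece F (tb k) (tb (k + 1))

/-- One step of `convItem`. -/
def convStep : Prog :=
  .setReg 11 (.get 4 (.reg 10)) ;; .setReg 12 (.get 4 (.reg 10 +ᵢ .const 1)) ;; convPiece ;;
    .setReg 10 (.reg 10 +ᵢ .const 1)

/-- Computation of a layer from the preceding one. -/
def convItem : Prog :=
  sortLayer ;; .setReg 10 (.const 0) ;; .while (.reg 10 +ᵢ .const 1 ≤ᵢ .reg 9) convStep

/-- Each piece of the summand gets a fresh tree, while the entries of the layer persist and only
improve. In the end they are maxima over all pieces. -/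
theorem convItem_spec (hE : E.Valid) {δ : ℕ} {X np : ℤ} {lin : Prop}
    (hB : ItemBounds E K W w) (hr : ItemRegs K W w base s) (hX : X ≤ W + 1)
    (h9 : s.ireg 9 = np) (hnb : np ≤ (E.b : ℤ))
    (hp : IsPartition (s.varr 1) X np (s.iarr 4) lin)
    (hδ : K + 1 ≤ δ ∨ lin) (hδ1 : 1 ≤ δ)
    (hV : ∀ y t v, 0 ≤ y → y ≤ W → Step W w base X s y t v → E.VOk v)
    (hs : ∀ y, 0 ≤ y → y ≤ W → s.iarr 1 (base + y) = 0) :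
    wp E convItem s fun T s' => T ≤ 900 * ((np.toNat + 1) * (2 ^ K * ((K + 1) * δ))) ∧
      (∀ y, 0 ≤ y → y ≤ W → RowSound (Step W w base X s y) (base + y) s') ∧
      (∀ y, 0 ≤ y → y ≤ W → ∀ t v, Step W w base X s y t v → RowGe (base + y) v s') ∧
      (∀ z, z < base ∨ base + W < z → RowEq s s' z) := by
  have b1 := hB.two_le
  have b2 := hB.one_le
  have b3 := hB.le_pow
  have b4 := hB.pow_le
  simp only [convItem, wp_seq, wp_setReg]
  refine wp_call (sortLayer_spec hE hB hr) ?_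
  rintro T1 s1 ⟨c1, c2⟩ f1
  refine ⟨rfl, fun _ => by simp, ?_⟩
  have hr1 : ItemRegs K W w base (s1.setI 10 0) := (hr.of_frame f1 rfl).setI (by decide)
  have q1 : ∀ z, RowEq s (s1.setI 10 0) z := fun z =>
    (RowEq.of_frame f1 rfl z).trans ⟨rfl, rfl, rfl⟩
  refine wp_call (wp_while hE (800 * (2 ^ K * ((K + 1) * δ)) + 20) (fun ρ s' =>
    0 ≤ s'.ireg 10 ∧ s'.ireg 10 + ρ = np ∧
    (∀ y, 0 ≤ y → y ≤ W → RowSound (Step W w base X s y) (base + y) s') ∧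
    (∀ y, 0 ≤ y → y ≤ W → ∀ t v, t < s'.iarr 4 (s'.ireg 10) → Step W w base X s y t v →
      RowGe (base + y) v s') ∧
    (∀ z, z < base ∨ base + W < z → RowEq s s' z)) (ρ := np.toNat) rfl ?_ ?_) ?_
  · refine ⟨by simp, by have := hp.nonneg; simp; omega,
      fun y h1 h2 => RowSound.congr (.inl (hs y h1 h2)) (q1 _), fun y _ _ t v h1 h2 => ?_,
      fun z _ => q1 z⟩
    have h3 := h2.1
    simp [f1.iarr 4 rfl, hp.zero] at h1
    omega
  · rintro ρ s' hf hg ⟨i1, i2, i3, i4, i5⟩ hc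
    have hr' := hr1.of_frame hf rfl
    have e9 : s'.ireg 9 = np := (hf.ireg 9 rfl).trans ((f1.ireg 9 rfl).trans h9)
    have e4 : s'.iarr 4 = s.iarr 4 := (hf.iarr 4 rfl).trans (f1.iarr 4 rfl)
    have ev1 : s'.varr 1 = s.varr 1 := (hf.varr 1 rfl).trans (f1.varr 1 rfl)
    have ev2 : s'.varr 2 = s1.varr 2 := hf.varr 2 rfl
    generalize hk : s'.ireg 10 = k at *
    simp only [Cond.Holds, IExpr.eval, e9, hk] at hc
    obtain ⟨m1, m2⟩ := hp.mem k i1 (by omega)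
    obtain ⟨m3, m4⟩ := hp.mem (k + 1) (by omega) (by omega)
    simp [convStep, hk, e4]
    refine ⟨fun _ => by rw [abs_of_nonneg (by omega)]; omega,
      fun _ => by rw [abs_of_nonneg (by omega)]; omega, ?_⟩
    -- The pieces treated so far have written only to the current layer, so the candidates are still
    -- those of the initial state.
    have hst : ∀ y, y ≤ W → Step W w base X ((s'.setI 11 (s.iarr 4 k)).setI 12 (s.iarr 4 (k + 1)))
        y = Step W w base X s y := fun y hy =>
      step_congr b2 hy (fun z hz => (i5 z (.inl hz)).trans ⟨rfl, rfl, rfl⟩) ev1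
    refine wp_call (convPiece_spec hE (δ := δ) (X := X) hB
      ((hr'.setI (by decide)).setI (by decide)) (a := s.iarr 4 k) (e := s.iarr 4 (k + 1)) (by simp)
      (by simp) m1 (by omega) m3 m4 hX (fun y hy0 hyW => ?_) ?_ ?_ hδ1 (fun y t v hy0 hyW h => ?_)
      (fun y hy0 hyW => ?_)) ?_
    · simp [ev2]
      rw [c2 y hy0 hyW, (i5 _ (by omega)).2.2]
    · simpa [ev1] using hp.piece k i1 (by omega)
    · simpa [ev1] using hδ.imp_right fun h => hp.affine h k i1 (by omega)
    · rw [hst y hyW] at h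
      exact hV y t v hy0 hyW h
    · rw [hst y hyW]
      exact (i3 y hy0 hyW).congr ⟨rfl, rfl, rfl⟩
    · rintro T s'' ⟨d1, d2, d3, d4, d5⟩ f''
      have e10 : s''.ireg 10 = k := (f''.ireg 10 rfl).trans (by simpa using hk)
      have e4' : s''.iarr 4 = s.iarr 4 := (f''.iarr 4 rfl).trans (by simpa using e4)
      simp [e10, e4']
      refine ⟨fun _ => by rw [abs_of_nonneg (by omega)]; omega, by omega, by omega, by omega,
        by omega, fun y hy0 hyW => ?_, fun y hy0 hyW t v ht h => ?_, fun z hz => ?_⟩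
      · have := d2 y hy0 hyW
        rw [hst y hyW] at this
        exact this.congr ⟨rfl, rfl, rfl⟩
      · rcases lt_or_ge t (s.iarr 4 k) with h' | h'
        · exact (d3 y v ((i4 y hy0 hyW t v (by rwa [e4]) h).congr ⟨rfl, rfl, rfl⟩)).congr
            ⟨rfl, rfl, rfl⟩
        · exact (d4 y hy0 hyW t v h' ht (by rwa [hst y hyW])).congr ⟨rfl, rfl, rfl⟩
      · exact (i5 z hz).trans (RowEq.trans ⟨rfl, rfl, rfl⟩ ((d5 z hz).trans ⟨rfl, rfl, rfl⟩))
  · rintro T s' ⟨h1, h2, ρ', h3, h4, h5, h6, h7⟩ hf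
    have e9 : s'.ireg 9 = np := (hf.ireg 9 rfl).trans ((f1.ireg 9 rfl).trans h9)
    have e4 : s'.iarr 4 = s.iarr 4 := (hf.iarr 4 rfl).trans (f1.iarr 4 rfl)
    simp [e9] at h1 h2 ⊢
    have hk : s'.ireg 10 = np := by omega
    refine ⟨?_, h5, fun y hy0 hyW t v h => h6 y hy0 hyW t v ?_ h, h7⟩
    · have h8 : 1 ≤ (K + 1) * δ := Nat.mul_pos (by omega) hδ1
      have h9 : 2 ^ K ≤ 2 ^ K * ((K + 1) * δ) := Nat.le_mul_of_pos_right _ h8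
      have hK1 : 4 ≤ 2 ^ K := by zify; omega
      rw [show np.toNat * (800 * (2 ^ K * ((K + 1) * δ)) + 20 + 1 + 5) =
        800 * (np.toNat * (2 ^ K * ((K + 1) * δ))) + np.toNat * 26 by ring] at h1
      have h10 : np.toNat * 26 ≤ 100 * (np.toNat * (2 ^ K * ((K + 1) * δ))) := by
        have := Nat.mul_le_mul_left np.toNat
          (show 26 ≤ 100 * (2 ^ K * ((K + 1) * δ)) by omega)
        rwa [Nat.mul_left_comm] at this
      rw [Nat.add_mul, Nat.one_mul]
      omega
    · rw [hk, e4, hp.last]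
      exact h.2.1

end

end Knap

namespace Knap

noncomputable section

/-! ## Layers -/

variable {E : Env} {K : ℕ} {s s' : State} {W : ℤ} {w u : ℕ → ℤ} {g : ℕ → ℤ → ℝ} {M : Set ℕ}

/-- The sum `y` is reached with `t` items of kind `i` and items of smaller kinds, and `v` is the
value. -/
def Link (W : ℤ) (w u : ℕ → ℤ) (g : ℕ → ℤ → ℝ) (s : State) : ℕ → ℤ → ℤ → ℝ → Prop
  | 0, y, t, v => 0 ≤ t ∧ t ≤ u 0 ∧ y = t * w 0 ∧ v = g 0 t
  | i + 1, y, t, v => 0 ≤ t ∧ t ≤ u (i + 1) ∧ 0 ≤ y - t * w (i + 1) ∧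
      s.iarr 1 (i * (W + 1) + (y - t * w (i + 1))) = 1 ∧
      v = s.varr 0 (i * (W + 1) + (y - t * w (i + 1))) + g (i + 1) t

/-- The numbers `x 0, ..., x i` of items yield the sum `y`. -/
def PartFeasible (w u : ℕ → ℤ) (i : ℕ) (y : ℤ) (x : ℕ → ℤ) : Prop :=
  (∀ j ≤ i, 0 ≤ x j ∧ x j ≤ u j) ∧ ∑ j ∈ Finset.range (i + 1), w j * x j = y

/-- The layer of the items `0, ..., i` is correct. -/
structure LayerOk (W : ℤ) (w u : ℕ → ℤ) (g : ℕ → ℤ → ℝ) (M : Set ℕ) (i : ℕ) (s : State) :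
    Prop where
  sound : ∀ y, 0 ≤ y → y ≤ W → RowSound (Link W w u g s i y) (i * (W + 1) + y) s
  ge : ∀ y x, 0 ≤ y → y ≤ W → PartFeasible w u i y x →
    RowGe (i * (W + 1) + y) (∑ j ∈ Finset.range (i + 1), g j (x j)) s
  int : ∀ y, 0 ≤ y → y ≤ W → s.iarr 1 (i * (W + 1) + y) = 1 → ∀ m ∈ M,
    IsIntLE ((i + 1) * m) (s.varr 0 (i * (W + 1) + y))

/-- The layer and its links refer to entries up to the end of the layer only; the computation of
later layers preserves it. -/
theorem LayerOk.congr {i : ℕ} (hw : ∀ j ≤ i, 1 ≤ w j) (h : LayerOk W w u g M i s)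
    (he : ∀ z < (i + 1) * (W + 1), RowEq s s' z) : LayerOk W w u g M i s' := by
  have e : ((i : ℤ) + 1) * (W + 1) = i * (W + 1) + W + 1 := by ring
  refine ⟨fun y h0 h1 => ?_, fun y x h0 h1 h2 => (h.ge y x h0 h1 h2).congr (he _ (by omega)),
    fun y h0 h1 h2 => ?_⟩
  · rcases (h.sound y h0 h1).congr (he _ (by omega)) with h2 | ⟨h2, h3⟩
    · exact .inl h2
    refine .inr ⟨h2, ?_⟩
    rcases i with _ | i
    · exact h3
    · obtain ⟨k1, k2, k3, k4, k5⟩ := h3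
      have := mul_nonneg k1 (by have := hw (i + 1) le_rfl; omega : 0 ≤ w (i + 1))
      have e' : ((i + 1 : ℕ) : ℤ) * (W + 1) = i * (W + 1) + W + 1 := by push_cast; ring
      have hlt : i * (W + 1) + (y - s'.iarr 2 (↑(i + 1) * (W + 1) + y) * w (i + 1)) <
          (↑(i + 1) + 1) * (W + 1) := by omega
      obtain ⟨e1, _, e3⟩ := he _ hlt
      exact ⟨k1, k2, k3, by rw [e1]; exact k4, by rw [e3]; exact k5⟩
  · obtain ⟨e1, _, e3⟩ := he (i * (W + 1) + y) (by omega)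
    rw [e3]
    exact h.int y h0 h1 (e1 ▸ h2)

/-- Contents of the registers that do not change while the layers are computed. -/
structure MainRegs (E : Env) (K n : ℕ) (W : ℤ) (s : State) : Prop where
  r0 : s.ireg 0 = n
  r1 : s.ireg 1 = W
  r2 : s.ireg 2 = E.inp.par
  r4 : s.ireg 4 = 2 ^ K

theorem MainRegs.of_frame {P : Prog} {n : ℕ} (h : MainRegs E K n W s) (hf : Frame P s s')
    (hP : (P.writesI 0 || P.writesI 1 || P.writesI 2 || P.writesI 4) = false) :
    MainRegs E K n W s' := by
  simp only [Bool.or_eq_false_iff] at hP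
  exact ⟨(hf.ireg 0 hP.1.1.1).trans h.r0, (hf.ireg 1 hP.1.1.2).trans h.r1,
    (hf.ireg 2 hP.1.2).trans h.r2, (hf.ireg 4 hP.2).trans h.r4⟩

/-- The data of the item `r3`: weight, and the numbers `⌊W / w⌋ + 1` and `min u ⌊W / w⌋ + 1`. -/
def loadItem : Prog :=
  .setReg 6 (.input 0 (.reg 3) (.const 0)) ;;
  .setReg 7 (.reg 1 /ᵢ .reg 6 +ᵢ .const 1) ;;
  .ite (.input 1 (.reg 3) (.const 0) +ᵢ .const 1 ≤ᵢ .reg 7)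
    (.setReg 8 (.input 1 (.reg 3) (.const 0) +ᵢ .const 1)) (.setReg 8 (.reg 7))

/-- Result of `loadItem`. -/
structure ItemLoaded (E : Env) (K n : ℕ) (W : ℤ) (w u : ℕ → ℤ) (i : ℕ) (s : State) : Prop
    extends MainRegs E K n W s where
  r3 : s.ireg 3 = i
  r6 : s.ireg 6 = w i
  r7 : s.ireg 7 = W / w i + 1
  r8 : s.ireg 8 = min (u i) (W / w i) + 1

/-- The assumptions on the input and the bounds. -/
structure Setup (E : Env) (K n : ℕ) (W : ℤ) (w u : ℕ → ℤ) (g : ℕ → ℤ → ℝ) (M : Set ℕ) :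
    Prop where
  valid : E.Valid
  two_le : 2 ≤ W
  le_pow : 2 * W ≤ 2 ^ K
  pow_lt : (2 : ℤ) ^ K < 4 * W
  pow_le : 4 * 2 ^ K ≤ (E.b : ℤ)
  size_le : (n + 1) * (W + 1) ≤ (E.b : ℤ)
  weight : ∀ i < n, E.inp.itab 0 i 0 = w i
  upper : ∀ i < n, E.inp.itab 1 i 0 = u i
  weight_pos : ∀ i < n, 1 ≤ w i
  upper_pos : ∀ i < n, 1 ≤ u i
  value : ∀ i < n, ∀ t, 0 ≤ t → t ≤ u i → ∀ m ∈ M, IsIntLE m (g i t)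
  vok : ∀ v, (∀ m ∈ M, IsIntLE (n * m) v) → E.VOk v

variable {n : ℕ}

theorem Setup.itemBounds (h : Setup E K n W w u g M) {i : ℕ} (hi : i < n) :
    ItemBounds E K W (w i) := ⟨h.two_le, h.weight_pos i hi, h.le_pow, h.pow_le⟩

theorem loadItem_spec (h : Setup E K n W w u g M) {i : ℕ} (hi : i < n)
    (hr : MainRegs E K n W s) (h3 : s.ireg 3 = i) :
    wp E loadItem s fun T s' => T ≤ 30 ∧ ItemLoaded E K n W w u i s' := by
  obtain ⟨r0, r1, r2, r4⟩ := hr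
  have hw := h.valid.itab 0 i 0
  have hu := h.valid.itab 1 i 0
  rw [h.weight i hi] at hw
  rw [h.upper i hi] at hu
  have w1 := h.weight_pos i hi
  have u1 := h.upper_pos i hi
  have d1 : W / w i ≤ W := Int.ediv_le_self _ (by have := h.two_le; omega)
  have d2 : 0 ≤ W / w i := Int.ediv_nonneg (by have := h.two_le; omega) (by omega)
  have b1 := h.le_pow
  have b2 := h.pow_le
  have b3 := h.two_le
  simp [loadItem, r1, h3, h.weight i hi, h.upper i hi, hw]
  refine ⟨fun _ => by rw [abs_of_nonneg (by omega)]; omega, fun hle => ⟨fun _ => ?_, ?_⟩,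
    fun hlt => ⟨fun _ => by rw [abs_of_nonneg (by omega)]; omega, ?_⟩⟩
  · rw [abs_of_nonneg (by omega)]; omega
  · exact ⟨⟨by simpa using r0, by simpa using r1, by simpa using r2, by simpa using r4⟩,
      by simpa using h3, by simp, by simp, by simp; omega⟩
  · exact ⟨⟨by simpa using r0, by simpa using r1, by simpa using r2, by simpa using r4⟩,
      by simpa using h3, by simp, by simp, by simp; omega⟩

/-- The program `FE` puts the values of the summand `g i` and the end points of its pieces into the
memory; it takes at most `ft` steps. -/
structure FrontEnd (E : Env) (K n : ℕ) (W : ℤ) (w u : ℕ → ℤ) (g : ℕ → ℤ → ℝ) (FE : Prog)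
    (ft np : ℕ) (lin : Prop) : Prop where
  regs : ∀ k < 9, FE.writesI k = false
  arrs : (FE.writesIA 1 || FE.writesIA 2 || FE.writesVA 0) = false
  np_le : np ≤ E.b
  spec : ∀ i < n, ∀ s, ItemLoaded E K n W w u i s → wp E FE s fun T s' => T ≤ ft ∧
    (∀ t, 0 ≤ t → t < min (u i) (W / w i) + 1 → s'.varr 1 t = g i t) ∧ s'.ireg 9 ≤ np ∧
    IsPartition (s'.varr 1) (min (u i) (W / w i) + 1) (s'.ireg 9) (s'.iarr 4) lin

theorem ItemLoaded.of_frame {P : Prog} {i : ℕ} (h : ItemLoaded E K n W w u i s)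
    (hf : Frame P s s') (hP : ∀ k < 9, P.writesI k = false) : ItemLoaded E K n W w u i s' :=
  ⟨⟨(hf.ireg 0 (hP 0 (by omega))).trans h.r0, (hf.ireg 1 (hP 1 (by omega))).trans h.r1,
    (hf.ireg 2 (hP 2 (by omega))).trans h.r2, (hf.ireg 4 (hP 4 (by omega))).trans h.r4⟩,
    (hf.ireg 3 (hP 3 (by omega))).trans h.r3, (hf.ireg 6 (hP 6 (by omega))).trans h.r6,
    (hf.ireg 7 (hP 7 (by omega))).trans h.r7, (hf.ireg 8 (hP 8 (by omega))).trans h.r8⟩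

/-- The first layer. -/
def firstLayer : Prog :=
  .setReg 13 (.const 0) ;;
  .while (.reg 13 +ᵢ .const 1 ≤ᵢ .reg 8)
    (.setArr 1 (.reg 13 *ᵢ .reg 6) (.const 1) ;;
     .setArr 2 (.reg 13 *ᵢ .reg 6) (.reg 13) ;;
     .setVArr 0 (.reg 13 *ᵢ .reg 6) (.get 1 (.reg 13)) ;;
     .setReg 13 (.reg 13 +ᵢ .const 1))

/-- With one item, a sum determines the number of copies, so nothing has to be compared and `O(W)`
steps suffice. -/
theorem firstLayer_spec (h : Setup E K n W w u g M) (hn : 0 < n) (hr : ItemLoaded E K n W w u 0 s)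
    (hF : ∀ t, 0 ≤ t → t < min (u 0) (W / w 0) + 1 → s.varr 1 t = g 0 t)
    (hs : ∀ z, s.iarr 1 z = 0) :
    wp E firstLayer s fun T s' => T ≤ 50 * 2 ^ K ∧ LayerOk W w u g M 0 s' ∧
      ∀ z, W + 1 ≤ z → s'.iarr 1 z = 0 := by
  have hE := h.valid
  have w1 := h.weight_pos 0 hn
  have u1 := h.upper_pos 0 hn
  have d1 : W / w 0 ≤ W := Int.ediv_le_self _ (by have := h.two_le; omega)
  have d2 : 0 ≤ W / w 0 := Int.ediv_nonneg (by have := h.two_le; omega) (by omega)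
  have d3 : W / w 0 * w 0 ≤ W := Int.ediv_mul_le _ (by omega)
  have b1 := h.le_pow
  have b2 := h.pow_le
  have b3 := h.two_le
  generalize hX : min (u 0) (W / w 0) = X at *
  simp only [firstLayer, wp_seq, wp_setReg]
  refine ⟨rfl, fun _ => by simp, ?_⟩
  refine wp_call (wp_while hE 30 (fun ρ s' => 0 ≤ s'.ireg 13 ∧ X + 1 = ρ + s'.ireg 13 ∧
    (∀ z, s'.iarr 1 z = 0 ∨ (s'.iarr 1 z = 1 ∧ 0 ≤ s'.iarr 2 z ∧ s'.iarr 2 z ≤ X ∧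
      z = s'.iarr 2 z * w 0 ∧ s'.varr 0 z = g 0 (s'.iarr 2 z))) ∧
    ∀ t, 0 ≤ t → t < s'.ireg 13 → s'.iarr 1 (t * w 0) = 1 ∧ s'.varr 0 (t * w 0) = g 0 t)
    (ρ := (X + 1).toNat) rfl ?_ ?_) ?_
  · refine ⟨by simp, by simp; omega, fun z => .inl (hs z), fun t h1 h2 => ?_⟩
    simp at h2
    omega
  · rintro ρ s' hf hg ⟨i1, i2, i3, i4⟩ hc
    have e8 : s'.ireg 8 = X + 1 := (hf.ireg 8 rfl).trans (hr.r8.trans (by rw [hX]))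
    have e6 : s'.ireg 6 = w 0 := (hf.ireg 6 rfl).trans hr.r6
    have e1 : s'.varr 1 = s.varr 1 := hf.varr 1 rfl
    generalize hk : s'.ireg 13 = k at *
    have hk' : |k| ≤ (E.b : ℤ) := hk ▸ hg.ireg 13
    have hvk := hg.varr 1 k
    simp [e8, hk] at hc
    rw [e1, hF k i1 (by omega)] at hvk
    simp [e6, hk, hk', e1, hF k i1 (by omega), hvk]
    have b0 := hE.two_le
    have hinj : ∀ t, t * w 0 = k * w 0 → t = k := fun t ht => by
      rcases mul_eq_mul_right_iff.1 ht with h | h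
      · exact h
      · omega
    refine ⟨by omega, fun _ => by rw [abs_of_nonneg (by omega)]; omega, by omega, by omega,
      by omega, fun z => ?_, fun t h1 h2 => ?_⟩
    · by_cases hz : z = k * w 0
      · subst hz
        right
        simp [i1]
        omega
      · simpa [Function.update_apply, hz] using i3 z
    · by_cases ht : t = k
      · subst ht
        simp
      · have hne : t * w 0 ≠ k * w 0 := fun h => ht (hinj t h)
        simpa [Function.update_apply, hne, ht] using i4 t h1 (by omega)
  · rintro T s' ⟨h1, h2, ρ', h3, h4, h5, h6⟩ hf
    have e8 : s'.ireg 8 = X + 1 := (hf.ireg 8 rfl).trans (hr.r8.trans (by rw [hX]))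
    simp [e8] at h1 h2 ⊢
    refine ⟨?_, ⟨fun y hy0 hyW => ?_, fun y x hy0 hyW hx => ?_, fun y hy0 hyW h1 m hm => ?_⟩,
      fun z hz => ?_⟩
    · have hW : (X + 1).toNat ≤ 2 ^ K := by zify; omega
      have hK1 : 1 ≤ 2 ^ K := Nat.one_le_two_pow
      omega
    · simp only [Nat.cast_zero, zero_mul, zero_add]
      rcases h5 y with h7 | ⟨h7, h8, h9, h10, h11⟩
      · exact .inl h7
      · exact .inr ⟨h7, h8, by omega, h10, h11⟩
    · obtain ⟨hx1, hx2⟩ := hx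
      obtain ⟨x1, x2⟩ := hx1 0 le_rfl
      simp at hx2 ⊢
      have : x 0 ≤ W / w 0 := by
        rw [Int.le_ediv_iff_mul_le (by omega)]
        linarith [mul_comm (w 0) (x 0)]
      obtain ⟨k1, k2⟩ := h6 (x 0) x1 (by omega)
      rw [mul_comm, hx2] at k1 k2
      exact ⟨k1, k2.ge⟩
    · simp only [Nat.cast_zero, zero_mul, zero_add] at h1 ⊢
      rcases h5 y with h7 | ⟨h7, h8, h9, h10, h11⟩
      · omega
      · rw [h11, one_mul]
        exact h.value 0 hn _ h8 (by omega) m hm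
    · rcases h5 z with h7 | ⟨h7, h8, h9, h10, h11⟩
      · exact h7
      · have : s'.iarr 2 z * w 0 ≤ W / w 0 * w 0 :=
          mul_le_mul_of_nonneg_right (by omega) (by omega)
        omega

/-- The layer of the item `r3 > 0`, followed by an increment of `r3`. -/
def nextLayer (FE : Prog) : Prog :=
  loadItem ;; FE ;; .setReg 5 (.reg 3 *ᵢ (.reg 1 +ᵢ .const 1)) ;; convItem ;;
    .setReg 3 (.reg 3 +ᵢ .const 1)

/-- Bellman's principle: the last coordinate of a partial solution is split off, and the rest is
dominated by an entry of the preceding layer. The size of the values grows by one summand `m` per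
layer. -/
theorem layerOk_succ (h : Setup E K n W w u g M) {i : ℕ} (hi : i + 1 < n)
    (hL : LayerOk W w u g M i s)
    (hF : ∀ t, 0 ≤ t → t < min (u (i + 1)) (W / w (i + 1)) + 1 → s.varr 1 t = g (i + 1) t)
    (heq : ∀ z < ((i : ℤ) + 1) * (W + 1), RowEq s s' z)
    (hs : ∀ y, 0 ≤ y → y ≤ W → RowSound (Step W (w (i + 1)) ((i + 1) * (W + 1))
      (min (u (i + 1)) (W / w (i + 1)) + 1) s y) ((i + 1) * (W + 1) + y) s')
    (hge : ∀ y, 0 ≤ y → y ≤ W → ∀ t v, Step W (w (i + 1)) ((i + 1) * (W + 1))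
      (min (u (i + 1)) (W / w (i + 1)) + 1) s y t v → RowGe ((i + 1) * (W + 1) + y) v s') :
    LayerOk W w u g M (i + 1) s' := by
  have w1 := h.weight_pos (i + 1) hi
  have hbase : ((i : ℤ) + 1) * (W + 1) - W - 1 = i * (W + 1) := by ring
  have e : ((i : ℤ) + 1) * (W + 1) = i * (W + 1) + W + 1 := by ring
  have hc : ((i + 1 : ℕ) : ℤ) = (i : ℤ) + 1 := by push_cast; ring
  refine ⟨fun y h0 h1 => ?_, fun y x h0 h1 hx => ?_, fun y h0 h1 h2 m hm => ?_⟩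
  · rw [hc]
    rcases hs y h0 h1 with h2 | ⟨h2, k1, k2, k3, k4, k5⟩
    · exact .inl h2
    refine .inr ⟨h2, ?_⟩
    rw [hF _ k1 k2, hbase] at k5
    unfold PrevFlag at k4
    rw [hbase] at k4
    generalize s'.iarr 2 ((i + 1) * (W + 1) + y) = t at *
    have htw : 0 ≤ t * w (i + 1) := mul_nonneg k1 (by omega)
    obtain ⟨e1, _, e3⟩ := heq (i * (W + 1) + (y - t * w (i + 1))) (by omega)
    refine ⟨k1, by omega, k3, ?_, by rw [e3]; exact k5⟩
    rw [e1]
    rcases hL.sound (y - t * w (i + 1)) k3 (by omega) with h6 | h6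
    · omega
    · exact h6.1
  · obtain ⟨x1, x2⟩ := hx
    obtain ⟨x3, x4⟩ := x1 (i + 1) le_rfl
    have hsum : 0 ≤ ∑ j ∈ Finset.range (i + 1), w j * x j := Finset.sum_nonneg fun j hj => by
      have hj' := Finset.mem_range.1 hj
      exact mul_nonneg (by have := h.weight_pos j (by omega); omega) (x1 j (by omega)).1
    rw [Finset.sum_range_succ] at x2 ⊢
    -- The other items have nonnegative weight, so replacing the upper bound by `min u ⌊W / w⌋`
    -- loses no solution.
    have hle : x (i + 1) ≤ W / w (i + 1) := by
      rw [Int.le_ediv_iff_mul_le (by omega)]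
      linarith [mul_comm (w (i + 1)) (x (i + 1))]
    have htw : 0 ≤ x (i + 1) * w (i + 1) := mul_nonneg x3 (by omega)
    have hpart : PartFeasible w u i (y - x (i + 1) * w (i + 1)) x :=
      ⟨fun j hj => x1 j (by omega), by linarith [mul_comm (w (i + 1)) (x (i + 1))]⟩
    have hy' : 0 ≤ y - x (i + 1) * w (i + 1) := by
      rw [← hpart.2]
      exact hsum
    obtain ⟨f1, f2⟩ := hL.ge _ x hy' (by omega) hpart
    rw [hc]
    have := hge y h0 h1 (x (i + 1)) _ ⟨x3, by omega, hy', by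
      unfold PrevFlag
      rw [hbase, f1], rfl⟩
    rw [hbase, hF _ x3 (by omega)] at this
    exact ⟨this.1, le_trans (by linarith) this.2⟩
  · rw [hc] at h2 ⊢
    rcases hs y h0 h1 with h3 | ⟨_, k1, k2, k3, k4, k5⟩
    · omega
    rw [hF _ k1 k2, hbase] at k5
    unfold PrevFlag at k4
    rw [hbase] at k4
    generalize s'.iarr 2 ((i + 1) * (W + 1) + y) = t at *
    have htw : 0 ≤ t * w (i + 1) := mul_nonneg k1 (by omega)
    rw [k5]
    refine ((hL.int _ k3 (by omega) ?_ m hm).add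
      (h.value (i + 1) hi t k1 (by omega) m hm)).mono (by rw [Nat.add_mul (i + 1), one_mul])
    rcases hL.sound (y - t * w (i + 1)) k3 (by omega) with h6 | h6
    · omega
    · exact h6.1

theorem nextLayer_spec (h : Setup E K n W w u g M) {FE : Prog} {ft np δ : ℕ} {lin : Prop}
    (hFE : FrontEnd E K n W w u g FE ft np lin) (hδ : K + 1 ≤ δ ∨ lin) (hδ1 : 1 ≤ δ) {i : ℕ}
    (hi : i + 1 < n) (hr : MainRegs E K n W s) (h3 : s.ireg 3 = (i : ℤ) + 1)
    (hL : ∀ j ≤ i, LayerOk W w u g M j s)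
    (hs : ∀ z, ((i : ℤ) + 1) * (W + 1) ≤ z → s.iarr 1 z = 0) :
    wp E (nextLayer FE) s fun T s' =>
      T ≤ ft + 50 + 900 * ((np + 1) * (2 ^ K * ((K + 1) * δ))) ∧
      s'.ireg 3 = (i : ℤ) + 2 ∧ MainRegs E K n W s' ∧ (∀ j ≤ i + 1, LayerOk W w u g M j s') ∧
      ∀ z, ((i : ℤ) + 2) * (W + 1) ≤ z → s'.iarr 1 z = 0 := by
  have w1 := h.weight_pos (i + 1) hi
  have b3 := h.two_le
  have d1 : W / w (i + 1) ≤ W := Int.ediv_le_self _ (by omega)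
  have hbase : ((i : ℤ) + 1) * (W + 1) - W - 1 = i * (W + 1) := by ring
  have e : ((i : ℤ) + 1) * (W + 1) = i * (W + 1) + W + 1 := by ring
  have e' : ((i : ℤ) + 2) * (W + 1) = (i + 1) * (W + 1) + W + 1 := by ring
  have hc : ((i + 1 : ℕ) : ℤ) = (i : ℤ) + 1 := by push_cast; ring
  have hsize : ((i : ℤ) + 1) * (W + 1) ≤ E.b := by
    refine le_trans ?_ h.size_le
    exact mul_le_mul_of_nonneg_right (by omega) (by omega)
  have hn : (n : ℤ) ≤ E.b := by
    have := h.size_le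
    nlinarith
  have hpos : 0 ≤ ((i : ℤ) + 1) * (W + 1) := mul_nonneg (by omega) (by omega)
  simp only [nextLayer, wp_seq, wp_setReg]
  refine wp_call (loadItem_spec h hi hr (h3.trans hc.symm)) ?_
  rintro T1 s1 ⟨a1, a2⟩ f1
  refine wp_call (hFE.spec (i + 1) hi s1 a2) ?_
  rintro T2 s2 ⟨c1, c2, c3, c4⟩ f2
  have l2 := a2.of_frame f2 hFE.regs
  have q2 : ∀ z, RowEq s s2 z := fun z =>
    (RowEq.of_frame f1 rfl z).trans (RowEq.of_frame f2 hFE.arrs z)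
  simp [l2.r3, l2.r1]
  refine ⟨fun _ => by rwa [← abs_mul, abs_of_nonneg hpos], ?_⟩
  have hL2 : ∀ j ≤ i, LayerOk W w u g M j (s2.setI 5 (((i : ℤ) + 1) * (W + 1))) := fun j hj =>
    (hL j hj).congr (fun k hk => h.weight_pos k (by omega)) fun z _ => (q2 z).trans ⟨rfl, rfl, rfl⟩
  refine wp_call (convItem_spec h.valid (δ := δ) (lin := lin) (W := W) (w := w (i + 1))
    (base := (i + 1) * (W + 1)) (X := min (u (i + 1)) (W / w (i + 1)) + 1) (np := s2.ireg 9)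
    (h.itemBounds hi) ⟨?_, ?_, ?_, ?_, ?_⟩ (by omega) rfl ?_ c4 hδ hδ1
    (fun y t v hy0 hyW hv => ?_) (fun y hy0 hyW => ?_)) ?_
  · simpa using l2.r1
  · simpa using l2.r4
  · simp
  · simpa using l2.r6
  · simpa using l2.r7
  · have := hFE.np_le
    omega
  · obtain ⟨k1, k2, k3, k4, k5⟩ := hv
    have htw : 0 ≤ t * w (i + 1) := mul_nonneg k1 (by omega)
    unfold PrevFlag at k4
    rw [hbase] at k4 k5
    simp only [State.setI_varr, c2 t k1 k2] at k5
    refine h.vok v fun m hm => ?_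
    rw [k5]
    refine (((hL2 i le_rfl).int _ k3 (by omega) ?_ m hm).add
      (h.value (i + 1) hi t k1 (by omega) m hm)).mono ?_
    · rcases (hL2 i le_rfl).sound (y - t * w (i + 1)) k3 (by omega) with h6 | h6
      · omega
      · exact h6.1
    -- An entry of layer `i + 1` is a sum of `i + 2 ≤ n` summands.
    · calc (i + 1) * m + m = (i + 2) * m := by ring
        _ ≤ n * m := Nat.mul_le_mul_right _ hi
  · simp only [State.setI_iarr]
    rw [(q2 _).1]
    exact hs _ (by omega)
  · rintro T3 s3 ⟨g1, g2, g3, g4⟩ f3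
    have hL3 : ∀ j ≤ i, LayerOk W w u g M j s3 := fun j hj => (hL2 j hj).congr
      (fun k hk => h.weight_pos k (by omega)) fun z hz => g4 z (.inl (hz.trans_le
        (mul_le_mul_of_nonneg_right (by omega) (by omega))))
    have e3 : s3.ireg 3 = (i : ℤ) + 1 := (f3.ireg 3 rfl).trans (by simpa using l2.r3)
    have hr3 : MainRegs E K n W s3 := MainRegs.of_frame
      (s := s2.setI 5 (((i : ℤ) + 1) * (W + 1)))
      ⟨by simpa using l2.r0, by simpa using l2.r1, by simpa using l2.r2, by simpa using l2.r4⟩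
      f3 rfl
    simp [e3]
    refine ⟨fun _ => by rw [abs_of_nonneg (by omega)]; omega, ?_, by ring,
      ⟨by simpa using hr3.r0, by simpa using hr3.r1, by simpa using hr3.r2, by simpa using hr3.r4⟩,
      fun j hj => ?_, fun z hz => ?_⟩
    · have : 1 ≤ 2 ^ K * ((K + 1) * δ) := Nat.mul_pos (by positivity) (Nat.mul_pos (by omega) hδ1)
      have h5 : (s2.ireg 9).toNat + 1 ≤ np + 1 := by omega
      have := Nat.mul_le_mul_right (2 ^ K * ((K + 1) * δ)) h5
      omega
    · refine LayerOk.congr (s := s3) (fun k hk => h.weight_pos k (by omega)) ?_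
        fun z _ => ⟨rfl, rfl, rfl⟩
      rcases Nat.le_succ_iff.1 hj with hj | rfl
      · exact hL3 j hj
      · exact layerOk_succ h hi (hL2 i le_rfl) c2 (fun z hz => g4 z (.inl hz)) g2 g3
    · rw [(g4 z (by omega)).1]
      simp only [State.setI_iarr]
      rw [(q2 z).1]
      exact hs z (by omega)

end

end Knap

/-! ### The complete algorithm -/

namespace Knap

noncomputable section

variable {E : Env} {K n : ℕ} {s s' : State} {W : ℤ} {w u : ℕ → ℤ} {g : ℕ → ℤ → ℝ} {M : Set ℕ}

/-- Computation of a power of two that is at least `2 * W`. -/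
def findSize : Prog :=
  .setReg 4 (.const 1) ;;
  .while (.reg 4 +ᵢ .const 1 ≤ᵢ .const 2 *ᵢ .reg 1) (.setReg 4 (.const 2 *ᵢ .reg 4))

/-- The bounds `2 * W ≤ 2 ^ K < 4 * W` determine `K`, so the doubling stops exactly at `2 ^ K`. -/
theorem findSize_spec (h : Setup E K n W w u g M) (h1 : s.ireg 1 = W) :
    wp E findSize s fun T s' => T ≤ 20 * 2 ^ K ∧ s'.ireg 4 = 2 ^ K := by
  have hE := h.valid
  have hb := hE.two_le
  have b1 := h.le_pow
  have b2 := h.pow_le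
  have b3 := h.two_le
  have b4 := h.pow_lt
  simp only [findSize, wp_seq, wp_setReg]
  refine ⟨rfl, fun _ => by simp; omega, ?_⟩
  refine wp_call (wp_while hE 6 (fun ρ s' => ∃ j, s'.ireg 4 = 2 ^ j ∧ j + ρ = K)
    (ρ := K) rfl ⟨0, by simp⟩ ?_) ?_
  · rintro ρ s' hf hg ⟨j, i1, i2⟩ hc
    have e1 : s'.ireg 1 = W := (hf.ireg 1 rfl).trans h1
    simp [e1, i1] at hc
    have hjK : j < K := by
      by_contra hjK
      obtain rfl : j = K := by omega
      omega
    have : (2 : ℤ) ^ (j + 1) ≤ 2 ^ K := pow_le_pow_right₀ (by norm_num) (by omega)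
    simp [i1]
    exact ⟨fun _ => by rw [← pow_succ']; omega, by omega, j + 1, by ring, by omega⟩
  · rintro T s' ⟨c1, c2, ρ', j, i1, i2⟩ hf
    have e1 : s'.ireg 1 = W := (hf.ireg 1 rfl).trans h1
    simp [e1, i1] at c1 c2 ⊢
    have hK : K < 2 ^ K := Nat.lt_two_pow_self
    refine ⟨by omega, ?_⟩
    rcases eq_or_ne j K with rfl | hjK
    · rfl
    · have : (2 : ℤ) ^ (j + 1) ≤ 2 ^ K := pow_le_pow_right₀ (by norm_num) (by omega)
      rw [pow_succ] at this
      omega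

/-- Computation of all layers. -/
def allLayers (FE : Prog) : Prog :=
  findSize ;; .setReg 3 (.const 0) ;; loadItem ;; FE ;; firstLayer ;;
  .setReg 3 (.const 1) ;; .while (.reg 3 +ᵢ .const 1 ≤ᵢ .reg 0) (nextLayer FE)

theorem allLayers_spec (h : Setup E K n W w u g M) {FE : Prog} {ft np δ : ℕ} {lin : Prop}
    (hFE : FrontEnd E K n W w u g FE ft np lin) (hδ : K + 1 ≤ δ ∨ lin) (hδ1 : 1 ≤ δ)
    (hn : 1 ≤ n) (h0 : s.ireg 0 = n) (h1 : s.ireg 1 = W) (h2 : s.ireg 2 = E.inp.par)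
    (hs : ∀ z, s.iarr 1 z = 0) :
    wp E (allLayers FE) s fun T s' =>
      T ≤ 200 * 2 ^ K + ft + (n - 1) * (ft + 1000 * ((np + 1) * (2 ^ K * ((K + 1) * δ)))) ∧
      MainRegs E K n W s' ∧ ∀ j < n, LayerOk W w u g M j s' := by
  have hE := h.valid
  have hb := hE.two_le
  have b3 := h.two_le
  simp only [allLayers, wp_seq, wp_setReg]
  refine wp_call (findSize_spec h h1) ?_
  rintro T1 s1 ⟨a1, a2⟩ f1
  have m1 : MainRegs E K n W (s1.setI 3 0) :=
    ⟨by simpa [f1.ireg 0 rfl] using h0, by simpa [f1.ireg 1 rfl] using h1,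
      by simpa [f1.ireg 2 rfl] using h2, by simpa using a2⟩
  refine ⟨rfl, fun _ => by simp, wp_call (loadItem_spec h hn m1 (by simp)) ?_⟩
  rintro T2 s2 ⟨c1, c2⟩ f2
  refine wp_call (hFE.spec 0 hn s2 c2) ?_
  rintro T3 s3 ⟨d1, d2, d3, d4⟩ f3
  have l3 := c2.of_frame f3 hFE.regs
  refine wp_call (firstLayer_spec h hn l3 d2 fun z => ?_) ?_
  · rw [((RowEq.of_frame f2 rfl z).trans (RowEq.of_frame f3 hFE.arrs z)).1]
    simp [f1.iarr 1 rfl, hs]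
  rintro T4 s4 ⟨g1, g2, g3⟩ f4
  refine ⟨rfl, fun _ => by simp; omega, ?_⟩
  have m4 : MainRegs E K n W s4 := l3.toMainRegs.of_frame f4 rfl
  refine wp_mono (wp_while hE (ft + 50 + 900 * ((np + 1) * (2 ^ K * ((K + 1) * δ))))
    (fun ρ s' => MainRegs E K n W s' ∧ ∃ i : ℕ, s'.ireg 3 = (i : ℤ) + 1 ∧ i + 1 + ρ = n ∧
      (∀ j ≤ i, LayerOk W w u g M j s') ∧ ∀ z, ((i : ℤ) + 1) * (W + 1) ≤ z → s'.iarr 1 z = 0)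
    (ρ := n - 1) rfl ?_ ?_) ?_
  · refine ⟨⟨by simpa using m4.r0, by simpa using m4.r1, by simpa using m4.r2,
      by simpa using m4.r4⟩, 0, by simp, by omega, fun j hj => ?_, fun z hz => ?_⟩
    · obtain rfl : j = 0 := by omega
      exact g2.congr (fun k hk => h.weight_pos k (by omega)) fun z _ => ⟨rfl, rfl, rfl⟩
    · exact g3 z (by simpa using hz)
  · rintro ρ s' hf hg ⟨i1, i, i2, i3, i4, i5⟩ hc
    simp [i1.r0, i2] at hc
    have hi : i + 1 < n := by omega
    refine wp_mono (nextLayer_spec h hFE hδ hδ1 hi i1 i2 i4 i5) ?_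
    rintro T s'' ⟨k1, k2, k3, k4, k5⟩
    refine ⟨k1, by omega, k3, i + 1, by rw [k2]; push_cast; ring, by omega, k4, fun z hz => ?_⟩
    exact k5 z (by push_cast at hz; linarith)
  · rintro T s' ⟨k1, k2, ρ', i1, i, i2, i3, i4, i5⟩
    simp [i1.r0, i2] at k1 k2 ⊢
    refine ⟨?_, i1, fun j hj => i4 j (by omega)⟩
    have hX : 1 ≤ (np + 1) * (2 ^ K * ((K + 1) * δ)) := Nat.mul_pos (by omega)
      (Nat.mul_pos (by positivity) (Nat.mul_pos (by omega) hδ1))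
    have hK1 : 4 ≤ 2 ^ K := by
      have := h.le_pow
      zify
      omega
    generalize (np + 1) * (2 ^ K * ((K + 1) * δ)) = X at *
    have := Nat.mul_le_mul_left (n - 1)
      (show ft + 50 + 900 * X + 1 + 5 ≤ ft + 1000 * X by omega)
    omega

/-- One step of `readSolution`. -/
def readStep : Prog :=
  .setReg 3 (.reg 3 -ᵢ .const 1) ;;
  .setReg 14 (.get 2 (.reg 3 *ᵢ (.reg 1 +ᵢ .const 1) +ᵢ .reg 13)) ;;
  .setArr 0 (.reg 3) (.reg 14) ;;
  .setReg 13 (.reg 13 -ᵢ .reg 14 *ᵢ .input 0 (.reg 3) (.const 0))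

/-- Reconstruction of an optimal solution from the layers. -/
def readSolution : Prog :=
  .setReg 3 (.reg 0) ;; .setReg 13 (.reg 1) ;; .while (.const 1 ≤ᵢ .reg 3) readStep

/-- The value of the last layer at the sum `y`, or `0` if there is no layer. -/
def layerValue (W : ℤ) (s : State) : ℕ → ℤ → ℝ
  | 0, _ => 0
  | i + 1, y => s.varr 0 (i * (W + 1) + y)

/-- The last layer has an entry at the sum `y`; without layers, `y = 0`. -/
def LayerHit (W : ℤ) (s : State) : ℕ → ℤ → Prop
  | 0, y => y = 0
  | i + 1, y => s.iarr 1 (i * (W + 1) + y) = 1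

/-- Backtracking along the links: the choice stored for the remaining sum fixes one coordinate and
leads to an attained entry of the preceding layer, while the value already collected plus the value
of the remaining entry stays constant. -/
theorem readSolution_spec (h : Setup E K n W w u g M) (hn : 1 ≤ n) (hr : MainRegs E K n W s)
    (hL : ∀ j < n, LayerOk W w u g M j s) (hhit : LayerHit W s n W) :
    wp E readSolution s fun T s' => T ≤ 50 * n + 10 ∧
      (∀ j < n, 0 ≤ s'.iarr 0 j ∧ s'.iarr 0 j ≤ u j) ∧
      ∑ j ∈ Finset.range n, w j * s'.iarr 0 j = W ∧
      ∑ j ∈ Finset.range n, g j (s'.iarr 0 j) = layerValue W s n W := by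
  have hE := h.valid
  have b3 := h.two_le
  have hsize := h.size_le
  have hnb : (n : ℤ) + W ≤ E.b := by nlinarith
  simp only [readSolution, wp_seq, wp_setReg]
  refine ⟨rfl, fun _ => by simp [hr.r0]; omega, rfl, fun _ => by
    simp [hr.r1]; rw [abs_of_nonneg (by omega)]; omega, ?_⟩
  -- The number `i` of remaining iterations is also the number of items whose multiplicity is still
  -- open.
  refine wp_call (wp_while hE 40 (fun i s' => i ≤ n ∧ s'.ireg 3 = i ∧ 0 ≤ s'.ireg 13 ∧
    s'.ireg 13 ≤ W ∧ LayerHit W s i (s'.ireg 13) ∧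
    (∀ j, i ≤ j → j < n → 0 ≤ s'.iarr 0 j ∧ s'.iarr 0 j ≤ u j) ∧
    ∑ j ∈ Finset.Ico i n, w j * s'.iarr 0 j + s'.ireg 13 = W ∧
    ∑ j ∈ Finset.Ico i n, g j (s'.iarr 0 j) + layerValue W s i (s'.ireg 13) =
      layerValue W s n W) (ρ := n) rfl ?_ ?_) ?_
  · refine ⟨le_rfl, by simp [hr.r0], by simp [hr.r1]; omega, by simp [hr.r1],
      by simpa [hr.r1] using hhit, fun j _ _ => by omega, by simp [hr.r1], by simp [hr.r1]⟩
  · rintro i s' hf hg ⟨i1, i2, i3, i4, i5, i6, i7, i8⟩ hc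
    simp [i2] at hc
    obtain ⟨i, rfl⟩ : ∃ k, i = k + 1 := ⟨i - 1, by omega⟩
    have e1 : s'.ireg 1 = W := (hf.ireg 1 rfl).trans (by simpa using hr.r1)
    have ea2 : s'.iarr 2 = s.iarr 2 := hf.iarr 2 rfl
    generalize hy : s'.ireg 13 = y at *
    have hw := h.weight i (by omega)
    have hw1 := h.weight_pos i (by omega)
    simp only [LayerHit] at i5
    rcases (hL i (by omega)).sound y i3 i4 with h6 | ⟨_, h7⟩
    · omega
    have hkey : 0 ≤ s.iarr 2 (i * (W + 1) + y) ∧ s.iarr 2 (i * (W + 1) + y) ≤ u i ∧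
        0 ≤ y - s.iarr 2 (i * (W + 1) + y) * w i ∧
        LayerHit W s i (y - s.iarr 2 (i * (W + 1) + y) * w i) ∧
        layerValue W s (i + 1) y = layerValue W s i (y - s.iarr 2 (i * (W + 1) + y) * w i) +
          g i (s.iarr 2 (i * (W + 1) + y)) := by
      rcases i with _ | i
      · obtain ⟨k1, k2, k3, k4⟩ := h7
        refine ⟨k1, k2, by omega, ?_, ?_⟩
        · simp only [LayerHit]; omega
        · simp only [layerValue, zero_add]; exact k4
      · obtain ⟨k1, k2, k3, k4, k5⟩ := h7
        exact ⟨k1, k2, k3, k4, k5⟩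
    have hchb : |s.iarr 2 (i * (W + 1) + y)| ≤ (E.b : ℤ) := by
      rw [← ea2]; exact hg.iarr _ _
    have hiw : ((i + 1 : ℕ) : ℤ) - 1 = i := by push_cast; ring
    simp only [readStep, wp_seq, wp_setReg, wp_setArr]
    simp [i2, e1, hy, ea2, hw, hchb]
    generalize s.iarr 2 (i * (W + 1) + y) = t at *
    obtain ⟨k1, k2, k3, k4, k5⟩ := hkey
    have htw : 0 ≤ t * w i := mul_nonneg k1 (by omega)
    refine ⟨fun _ => by omega, fun _ => by rw [abs_of_nonneg k3]; omega, by omega, by omega,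
      by omega, k4, fun j hj1 hj2 => ?_, ?_, ?_⟩
    · rcases eq_or_ne j i with rfl | hj
      · simp [k1, k2]
      · have hj' : (j : ℤ) ≠ i := by omega
        simpa [Function.update_apply, hj'] using i6 j (by omega) hj2
    · rw [← Finset.insert_Ico_add_one_left_eq_Ico (by omega : i < n),
        Finset.sum_insert (by simp)]
      rw [Finset.sum_congr rfl (g := fun j : ℕ => w j * s'.iarr 0 j)]
      · simp
        linarith [mul_comm (w i) t]
      · intro j hj
        have hj' : (j : ℤ) ≠ i := by have := (Finset.mem_Ico.1 hj).1; omega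
        simp [hj']
    · rw [← Finset.insert_Ico_add_one_left_eq_Ico (by omega : i < n),
        Finset.sum_insert (by simp)]
      rw [Finset.sum_congr rfl (g := fun j : ℕ => g j (s'.iarr 0 j))]
      · simp
        linarith
      · intro j hj
        have hj' : (j : ℤ) ≠ i := by have := (Finset.mem_Ico.1 hj).1; omega
        simp [hj']
  · rintro T s' ⟨h1, h2, i, i1, i2, i3, i4, i5, i6, i7, i8⟩ hf
    simp [i2] at h1 h2 ⊢
    obtain rfl : i = 0 := by omega
    simp only [LayerHit] at i5
    rw [i5, add_zero, ← Finset.range_eq_Ico] at i7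
    simp only [layerValue, add_zero, ← Finset.range_eq_Ico] at i8
    exact ⟨by omega, fun j hj => i6 j (by omega) hj, i7, i8⟩

/-- The sign of the objective of the equivalent maximization problem. -/
def Sense.sign : Sense → ℤ
  | .max => 1
  | .min => -1

theorem Sense.sign_mul_sign (sense : Sense) : (sense.sign : ℝ) * sense.sign = 1 := by
  cases sense <;> simp [Sense.sign]

/-- Multiplication by the sign. -/
def Sense.signed : Sense → VExpr → VExpr
  | .max, e => e
  | .min, e => .ofInt (.const 0) -ʳ e

theorem Sense.eval_signed (sense : Sense) (inp : Input) (s : State) (e : VExpr) :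
    (sense.signed e).eval inp s = sense.sign * e.eval inp s := by
  cases sense <;> simp [Sense.sign, Sense.signed]

/-- Subtraction from the converted constant `0` adds three operations, whence `37 = 40 - 3`. -/
theorem Sense.ok_signed (sense : Sense) {e : VExpr} (he : e.small = true) (hc : e.cost ≤ 37) :
    (sense.signed e).ok = true := by
  cases sense <;> simp [Sense.signed, he]
  · exact decide_eq_true (by omega)
  · omega

theorem Sense.cost_signed_le (sense : Sense) (e : VExpr) :
    (sense.signed e).cost ≤ e.cost + 3 := by
  cases sense <;> simp [Sense.signed]; omega

theorem IsIntLE.sign_mul {m : ℕ} {v : ℝ} (h : IsIntLE m v) (sense : Sense) :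
    IsIntLE m (sense.sign * v) := by
  cases sense
  · simpa [Sense.sign] using h
  · simpa [Sense.sign] using h.neg

/-- The complete algorithm, with the program `FE` for the reading of the summands. -/
def solver (sense : Sense) (FE : Prog) : Prog :=
  allLayers FE ;;
  .setReg 5 ((.reg 0 -ᵢ .const 1) *ᵢ (.reg 1 +ᵢ .const 1)) ;;
  .ite (.const 1 ≤ᵢ .get 1 (.reg 5 +ᵢ .reg 1))
    (readSolution ;; .setVReg 0 (sense.signed (.get 0 (.reg 5 +ᵢ .reg 1))) ;;
     .setReg 0 (.const 1))
    (.setReg 0 (.const 0))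

/-- The result of `solver` is correct. -/
def Correct (sense : Sense) (n : ℕ) (W : ℤ) (w u : ℕ → ℤ) (g : ℕ → ℤ → ℝ) (s : State) : Prop :=
  (s.ireg 0 = 1 ∧ PartFeasible w u (n - 1) W (fun j => s.iarr 0 j) ∧
    (∀ x, PartFeasible w u (n - 1) W x →
      ∑ j ∈ Finset.range n, g j (x j) ≤ ∑ j ∈ Finset.range n, g j (s.iarr 0 j)) ∧
    s.vreg 0 = sense.sign * ∑ j ∈ Finset.range n, g j (s.iarr 0 j)) ∨
  (s.ireg 0 = 0 ∧ ∀ x, ¬ PartFeasible w u (n - 1) W x)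

/-- The first item enters the time without the factor for convolutions. The flag of the last layer
at `W` decides feasibility. -/
theorem solver_spec (h : Setup E K n W w u g M) {FE : Prog} {ft np δ : ℕ} {lin : Prop}
    (hFE : FrontEnd E K n W w u g FE ft np lin) (hδ : K + 1 ≤ δ ∨ lin) (hδ1 : 1 ≤ δ)
    (hn : 1 ≤ n) (h0 : s.ireg 0 = n) (h1 : s.ireg 1 = W) (h2 : s.ireg 2 = E.inp.par)
    (hs : ∀ z, s.iarr 1 z = 0) (sense : Sense) :
    wp E (solver sense FE) s fun T s' =>
      T ≤ 300 * 2 ^ K + ft +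
        (n - 1) * (ft + 1100 * ((np + 1) * (2 ^ K * ((K + 1) * δ)))) ∧
      Correct sense n W w u g s' := by
  have hE := h.valid
  have hb := hE.two_le
  have b3 := h.two_le
  have hK1 : 4 ≤ 2 ^ K := by
    have := h.le_pow
    zify
    omega
  simp only [solver, wp_seq, wp_setReg]
  refine wp_call (allLayers_spec h hFE hδ hδ1 hn h0 h1 h2 hs) ?_
  rintro T1 s1 ⟨a1, a2, a3⟩ f1
  have hX : 1 ≤ (np + 1) * (2 ^ K * ((K + 1) * δ)) := Nat.mul_pos (by omega)
    (Nat.mul_pos (by positivity) (Nat.mul_pos (by omega) hδ1))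
  generalize (np + 1) * (2 ^ K * ((K + 1) * δ)) = X at *
  -- The reconstruction costs `50` for each item after the first, absorbed by `100 * X` as `X ≥ 1`,
  -- and a constant, absorbed by `100 * 2 ^ K`.
  have htime : ∀ T2, T2 ≤ 50 * n + 50 → T1 + T2 ≤
      300 * 2 ^ K + ft + (n - 1) * (ft + 1100 * X) := by
    intro T2 hT2
    have := Nat.mul_le_mul_left (n - 1) (show ft + 1000 * X + 50 ≤ ft + 1100 * X by omega)
    rw [Nat.mul_add] at this
    omega
  obtain ⟨m, rfl⟩ : ∃ m, n = m + 1 := ⟨n - 1, by omega⟩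
  have hm : ((m + 1 : ℕ) : ℤ) - 1 = m := by push_cast; ring
  have hLm := a3 m (by omega)
  have hpos : 0 ≤ (m : ℤ) * (W + 1) := mul_nonneg (by omega) (by omega)
  have hsize : (m : ℤ) * (W + 1) ≤ E.b := le_trans
    (mul_le_mul_of_nonneg_right (by push_cast; omega) (by omega)) h.size_le
  refine ⟨rfl, fun _ => ?_, ?_⟩
  · simp only [IExpr.eval, a2.r0, a2.r1, hm]
    rwa [abs_of_nonneg hpos]
  simp only [IExpr.eval, a2.r0, a2.r1, hm]
  have a2' : MainRegs E K (m + 1) W (s1.setI 5 (m * (W + 1))) :=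
    ⟨by simpa using a2.r0, by simpa using a2.r1, by simpa using a2.r2, by simpa using a2.r4⟩
  simp only [wp_ite, wp_seq, wp_setReg, wp_setVReg, Cond.Holds, IExpr.eval, State.setI_iarr,
    a2'.r1]
  simp only [State.setI_ireg, if_true]
  refine ⟨rfl, fun hflag => ?_, fun hflag => ⟨rfl, fun _ => by simp, ?_⟩⟩
  · have hhit : s1.iarr 1 (m * (W + 1) + W) = 1 := by
      rcases hLm.sound W (by omega) le_rfl with h6 | h6
      · omega
      · exact h6.1
    refine wp_call (readSolution_spec h hn a2' (fun j hj => (a3 j hj).congr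
      (fun k hk => h.weight_pos k (by omega)) fun z _ => ⟨rfl, rfl, rfl⟩) hhit) ?_
    rintro T2 s2 ⟨c1, c2, c3, c4⟩ f2
    have e5 : s2.ireg 5 = m * (W + 1) := (f2.ireg 5 rfl).trans (by simp)
    have e1 : s2.ireg 1 = W := (f2.ireg 1 rfl).trans a2'.r1
    have ev : s2.varr 0 = s1.varr 0 := f2.varr 0 rfl
    have hcost := sense.cost_signed_le (.get 0 (.reg 5 +ᵢ .reg 1))
    refine ⟨sense.ok_signed rfl (by simp), fun hg m' hm' => ?_, rfl,
      fun _ => by simp; omega, ?_, ?_⟩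
    · rw [Sense.eval_signed]
      exact (hg.varr _ _ m' hm').sign_mul sense
    · simp at hcost ⊢
      exact htime _ (by omega)
    · left
      refine ⟨by simp, ⟨fun j hj => c2 j (by omega), c3⟩, fun x hx => ?_, ?_⟩
      · have := (hLm.ge W x (by omega) le_rfl hx).2
        simp only [State.setI_iarr, State.setV_iarr]
        rw [c4]
        exact this
      · simp only [State.setI_vreg, State.setV_vreg, State.setI_iarr, State.setV_iarr, if_true,
          Sense.eval_signed]
        rw [c4]
        simp [e5, e1, ev, layerValue]
  · refine ⟨htime _ (by simp), .inr ⟨by simp, fun x hx => hflag ?_⟩⟩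
    rw [(hLm.ge W x (by omega) le_rfl hx).1]

end

end Knap

namespace Knap

noncomputable section

/-! ## Reading the summands -/

variable {E : Env} {K n : ℕ} {s s' : State} {W : ℤ} {w u : ℕ → ℤ} {M : Set ℕ}

/-- The entries `r13, ..., r12 - 1` of the value array `1` get the values of `e`, which are
prepared by `P`. -/
def fillLoop (P : Prog) (e : VExpr) : Prog :=
  .while (.reg 13 +ᵢ .const 1 ≤ᵢ .reg 12)
    (P ;; .setVArr 1 (.reg 13) e ;; .setReg 13 (.reg 13 +ᵢ .const 1))

/-- The behaviour of `P` is required only in states that agree with `s` on everything the loop does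
not write, so a caller may use the registers that identify the item. -/
theorem fillLoop_spec (hE : E.Valid) {P : Prog} {e : VExpr} {a l : ℤ} {g : ℤ → ℝ} {tp : ℕ}
    (h13 : s.ireg 13 = a) (h12 : s.ireg 12 = l) (ha : 0 ≤ a) (he : e.ok = true)
    (hw : (P.writesI 12 || P.writesI 13 || P.writesVA 1) = false)
    (hP : ∀ t s', a ≤ t → t < l → Frame (fillLoop P e) s s' → s'.ireg 13 = t →
      wp E P s' fun T s'' => T ≤ tp ∧ e.eval E.inp s'' = g t)
    (hV : ∀ t, a ≤ t → t < l → E.VOk (g t)) :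
    wp E (fillLoop P e) s fun T s' => T ≤ (l - a).toNat * (tp + e.cost + 12) + 6 ∧
      s'.ireg 13 = max a l ∧ (∀ t, a ≤ t → t < l → s'.varr 1 t = g t) ∧
      ∀ t, t < a → s'.varr 1 t = s.varr 1 t := by
  simp only [Bool.or_eq_false_iff] at hw
  refine wp_call (wp_while hE (tp + e.cost + 6) (fun ρ s' => a ≤ s'.ireg 13 ∧
    max a l = ρ + s'.ireg 13 ∧ (∀ t, a ≤ t → t < s'.ireg 13 → s'.varr 1 t = g t) ∧
    ∀ t, t < a → s'.varr 1 t = s.varr 1 t) (ρ := (l - a).toNat) rfl ?_ ?_) ?_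
  · exact ⟨h13.ge, by omega, fun t h1 h2 => by omega, fun _ _ => rfl⟩
  · rintro ρ s' hf hg ⟨i1, i2, i3, i4⟩ hc
    have e12 : s'.ireg 12 = l := by
      refine (hf.ireg 12 ?_).trans h12
      simp [Prog.writesI, hw.1.1]
    have hlb : |l| ≤ (E.b : ℤ) := e12 ▸ hg.ireg 12
    have hlb' := abs_le.1 hlb
    simp only [Cond.Holds, IExpr.eval, e12] at hc
    simp only [wp_seq, wp_setVArr, wp_setReg]
    refine wp_call (hP _ s' i1 (by omega) ⟨hf.1, hf.2, hf.3⟩ rfl) ?_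
    rintro T s'' ⟨c1, c2⟩ f
    have e13 : s''.ireg 13 = s'.ireg 13 := f.ireg 13 hw.1.2
    have ev : s''.varr 1 = s'.varr 1 := f.varr 1 hw.2
    rw [c2]
    refine ⟨by simpa [IExpr.ok] using he, fun _ => hV _ i1 (by omega), rfl, fun _ => ?_, ?_⟩
    · simp [e13]
      rw [abs_of_nonneg (by omega)]
      omega
    · simp [e13, ev]
      refine ⟨by omega, by omega, by omega, by omega, fun t h1 h2 => ?_, fun t h1 => ?_⟩
      · rw [Function.update_apply]
        split_ifs with h
        · rw [h]
        · exact i3 t h1 (by omega)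
      · rw [Function.update_of_ne (by omega)]
        exact i4 t h1
  · rintro T s' ⟨h1, h2, ρ', h3, h4, h5, h6⟩ hf
    have e12 : s'.ireg 12 = l := by
      refine (hf.ireg 12 ?_).trans h12
      simp [fillLoop, Prog.writesI, hw.1.1]
    simp at h1
    simp only [Cond.Holds, IExpr.eval, e12] at h2
    refine ⟨?_, by omega, fun t k1 k2 => h5 t k1 (by omega), h6⟩
    rw [show tp + e.cost + 6 + 1 + 5 = tp + e.cost + 12 by ring] at h1
    omega

theorem Setup.loaded {g : ℕ → ℤ → ℝ} (h : Setup E K n W w u g M) {i : ℕ} (hi : i < n) :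
    1 ≤ min (u i) (W / w i) + 1 ∧ min (u i) (W / w i) + 1 ≤ W + 1 := by
  have w1 := h.weight_pos i hi
  have u1 := h.upper_pos i hi
  have d1 : W / w i ≤ W := Int.ediv_le_self _ (by have := h.two_le; omega)
  have d2 : 0 ≤ W / w i := Int.ediv_nonneg (by have := h.two_le; omega) (by omega)
  omega

theorem Setup.vok_value {g : ℕ → ℤ → ℝ} (h : Setup E K n W w u g M) {i : ℕ} (hi : i < n) {t : ℤ}
    (h0 : 0 ≤ t) (ht : t < min (u i) (W / w i) + 1) : E.VOk (g i t) := by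
  refine h.vok _ fun m hm => (h.value i hi t h0 (by omega) m hm).mono ?_
  exact Nat.le_mul_of_pos_left _ (by omega)

/-! ### Oracles -/

/-- One piece; the values are given by an oracle. -/
def oracleFront (sense : Sense) : Prog :=
  .setReg 13 (.const 0) ;; .setReg 12 (.reg 8) ;;
  fillLoop .skip (sense.signed (.input 0 (.reg 3) (.reg 13))) ;;
  .setReg 9 (.const 1) ;; .setArr 4 (.const 0) (.const 0) ;; .setArr 4 (.const 1) (.reg 8)

theorem ConvexPiece.neg {F : ℤ → ℝ} {a e : ℤ} (h : ConvexPiece (fun t => -F t) a e) :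
    ConcavePiece F a e := fun t t' d h1 h2 h3 h4 => by
  have := h t t' d h1 h2 h3 h4
  linarith

/-- Nonnegative second differences make the unit increments monotone (`hG`); comparing increments at
distance `d` and adding them up from `t` to `t'` gives convexity. -/
theorem convexPiece_of_local {F : ℤ → ℝ} {a e : ℤ}
    (h : ∀ y, a < y → y + 1 < e → F y + F y ≤ F (y + 1) + F (y - 1)) : ConvexPiece F a e := by
  have hG : ∀ y, a ≤ y → ∀ z, y ≤ z → z + 1 < e → F (y + 1) - F y ≤ F (z + 1) - F z := by
    intro y hy z hz
    induction z, hz using Int.leInduction with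
    | base => exact fun _ => le_rfl
    | succ z hz ih =>
      intro hze
      have h1 := ih (by omega)
      have h2 := h (z + 1) (by omega) hze
      rw [add_sub_cancel_right] at h2
      linarith
  intro t t' d h1 h2 h3
  induction t', h2 using Int.leInduction with
  | base => intro _; simp
  | succ z hz ih =>
    intro hze
    have k1 := ih (by omega)
    have k2 := hG z (by omega) (z + d) (by omega) (by omega)
    rw [show z + 1 + d = z + d + 1 by ring]
    linarith

theorem concavePiece_of_local {F : ℤ → ℝ} {a e : ℤ}
    (h : ∀ y, a < y → y + 1 < e → F (y + 1) + F (y - 1) ≤ F y + F y) : ConcavePiece F a e :=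
  ConvexPiece.neg (convexPiece_of_local fun y h1 h2 => by have := h y h1 h2; linarith)

/-- Concave summands stay concave for maximization and become convex for minimization; in both cases
the whole range is one piece. -/
theorem oracleFront_spec {g : ℕ → ℤ → ℝ} (h : Setup E K n W w u g M) (sense : Sense)
    (hg : ∀ i < n, ∀ t, 0 ≤ t → t ≤ u i → sense.sign * E.inp.vtab 0 i t = g i t)
    (hc : (∀ i < n, ∀ y, 0 < y → y < u i → g i y + g i y ≤ g i (y + 1) + g i (y - 1)) ∨
      (∀ i < n, ∀ y, 0 < y → y < u i → g i (y + 1) + g i (y - 1) ≤ g i y + g i y)) :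
    FrontEnd E K n W w u g (oracleFront sense) (30 * 2 ^ K) 1 False := by
  have hE := h.valid
  have hb := hE.two_le
  refine ⟨by cases sense <;> decide, by cases sense <;> rfl, by omega, fun i hi s hr => ?_⟩
  obtain ⟨X1, X2⟩ := h.loaded hi
  have b1 := h.le_pow
  have b2 := h.pow_le
  have h2 := h.two_le
  have r8 := hr.r8
  have r3 := hr.r3
  have hvok : ∀ t, 0 ≤ t → t < min (u i) (W / w i) + 1 → E.VOk (g i t) :=
    fun t => h.vok_value hi
  have hXu : min (u i) (W / w i) + 1 ≤ u i + 1 := by omega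
  generalize min (u i) (W / w i) + 1 = X at *
  have hcost := sense.cost_signed_le (.input 0 (.reg 3) (.reg 13))
  simp at hcost
  simp only [oracleFront, wp_seq, wp_setReg, wp_setArr]
  refine ⟨rfl, fun _ => by simp, rfl,
    fun _ => by simp [r8]; rw [abs_of_nonneg (by omega)]; omega, ?_⟩
  refine wp_call (fillLoop_spec hE (a := 0) (l := X) (g := g i) (tp := 1) (by simp) (by simp [r8])
    le_rfl (sense.ok_signed rfl (by simp)) rfl (fun t s' ht0 ht hf e13 => ?_)
    (fun t ht0 ht => hvok t ht0 ht)) ?_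
  · have e3 : s'.ireg 3 = i := (hf.ireg 3 (by cases sense <;> rfl)).trans (by simpa using r3)
    simp only [wp_skip, le_refl, true_and, Sense.eval_signed, VExpr.eval, IExpr.eval, e13, e3]
    exact hg i hi t ht0 (by omega)
  · rintro T s1 ⟨a1, a2, a3, a4⟩ f1
    have e8 : s1.ireg 8 = X := (f1.ireg 8 (by cases sense <;> rfl)).trans (by simpa using r8)
    simp [e8]
    refine ⟨fun _ => by omega, fun _ => by rw [abs_of_nonneg (by omega)]; omega, ?_, a3, ?_⟩
    · have h5 : (X - 0).toNat ≤ 2 ^ K := by zify; omega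
      have := Nat.mul_le_mul h5
        (show 1 + (sense.signed (.input 0 (.reg 3) (.reg 13))).cost + 12 ≤ 19 by omega)
      have hK1 : 4 ≤ 2 ^ K := by zify; omega
      omega
    · refine ⟨by omega, by simp, by simp, fun k k0 k1 => ?_, fun k k0 k1 => ?_, fun hf => hf.elim⟩
      · obtain rfl | rfl : k = 0 ∨ k = 1 := by omega
        · simp; omega
        · simpa using by omega
      · obtain rfl : k = 0 := by omega
        simp
        refine hc.imp (fun hc => convexPiece_of_local fun y y1 y2 => ?_)
          (fun hc => concavePiece_of_local fun y y1 y2 => ?_)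
        · rw [a3 y (by omega) (by omega), a3 _ (by omega) (by omega), a3 _ (by omega) (by omega)]
          exact hc i hi y y1 (by omega)
        · rw [a3 y (by omega) (by omega), a3 _ (by omega) (by omega), a3 _ (by omega) (by omega)]
          exact hc i hi y y1 (by omega)

/-! ### Piecewise linear functions -/

/-- One step of `plinFront`. -/
def plinStep (sense : Sense) : Prog :=
  .ite (.input 2 (.reg 3) (.reg 10 +ᵢ .const 1) ≤ᵢ .reg 8)
    (.setReg 12 (.input 2 (.reg 3) (.reg 10 +ᵢ .const 1))) (.setReg 12 (.reg 8)) ;;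
  fillLoop .skip (sense.signed (.input 0 (.reg 3) (.reg 10) *ʳ .ofInt (.reg 13) +ʳ
    .input 1 (.reg 3) (.reg 10))) ;;
  .setReg 10 (.reg 10 +ᵢ .const 1) ;; .setArr 4 (.reg 10) (.reg 12)

/-- Values and pieces of a piecewise linear function. -/
def plinFront (sense : Sense) : Prog :=
  .setReg 13 (.const 0) ;; .setReg 10 (.const 0) ;; .setArr 4 (.const 0) (.const 0) ;;
  .while (.reg 10 +ᵢ .const 1 ≤ᵢ .reg 2) (plinStep sense) ;; .setReg 9 (.reg 2)

/-- All end points are cut at `X = min u ⌊W / w⌋ + 1`. Pieces beyond `X` become empty, and since `t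
p > u`, the last end point becomes `X`. -/
theorem plinFront_spec {g : ℕ → ℤ → ℝ} (h : Setup E K n W w u g M) (sense : Sense) {p : ℕ}
    {t : ℕ → ℕ → ℤ} {α β : ℕ → ℕ → ℝ} (hpar : E.inp.par = p) (hpb : p + 1 ≤ E.b)
    (ht0 : ∀ i < n, t i 0 = 0) (htp : ∀ i < n, u i < t i p)
    (htm : ∀ i < n, ∀ k < p, t i k ≤ t i (k + 1))
    (ht : ∀ i < n, ∀ k ≤ p, E.inp.itab 2 i k = t i k)
    (hα : ∀ i < n, ∀ k < p, E.inp.vtab 0 i k = α i k)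
    (hβ : ∀ i < n, ∀ k < p, E.inp.vtab 1 i k = β i k)
    (hg : ∀ i < n, ∀ k < p, ∀ x, x ≤ u i → t i k ≤ x → x < t i (k + 1) →
      g i x = sense.sign * (α i k * x + β i k)) :
    FrontEnd E K n W w u g (plinFront sense) (100 * (p * 2 ^ K)) p True := by
  have hE := h.valid
  have hb := hE.two_le
  refine ⟨by cases sense <;> decide, by cases sense <;> rfl, by omega, fun i hi s hr => ?_⟩
  obtain ⟨X1, X2⟩ := h.loaded hi
  have b1 := h.le_pow
  have b2 := h.pow_le
  have h2 := h.two_le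
  have r8 := hr.r8
  have r3 := hr.r3
  have r2 := hr.r2.trans hpar
  have hvok : ∀ t, 0 ≤ t → t < min (u i) (W / w i) + 1 → E.VOk (g i t) :=
    fun t => h.vok_value hi
  have hXu : min (u i) (W / w i) + 1 ≤ u i + 1 := by omega
  generalize min (u i) (W / w i) + 1 = X at *
  have ht0' : ∀ k ≤ p, 0 ≤ t i k := by
    intro k
    induction k with
    | zero => exact fun _ => (ht0 i hi).ge
    | succ k ih => exact fun hk => (ih (by omega)).trans (htm i hi k (by omega))
  have hp1 : 1 ≤ p := by
    rcases Nat.eq_zero_or_pos p with rfl | hp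
    · have := htp i hi
      have := ht0 i hi
      have := h.upper_pos i hi
      omega
    · exact hp
  simp only [plinFront, wp_seq, wp_setReg, wp_setArr]
  refine ⟨rfl, fun _ => by simp, rfl, fun _ => by simp, rfl, fun _ => by simp, ?_⟩
  refine wp_call (wp_while hE (2 ^ K * 36 + 40) (fun ρ s' => ∃ k : ℕ, k + ρ = p ∧
    s'.ireg 10 = k ∧ s'.ireg 13 = min (t i k) X ∧
    (∀ j ≤ k, s'.iarr 4 j = min (t i j) X) ∧
    ∀ x, 0 ≤ x → x < min (t i k) X → s'.varr 1 x = g i x) (ρ := p)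
    (by rfl) ?_ ?_) ?_
  · refine ⟨0, by simp, by simp, by simp [ht0 i hi]; omega, fun j hj => ?_, fun x x0 x1 => ?_⟩
    · obtain rfl : j = 0 := by omega
      simp [ht0 i hi]
      omega
    · rw [ht0 i hi] at x1
      omega
  · rintro ρ s' hf hgood ⟨k, i1, i2, i3, i4, i5⟩ hcond
    have e2 : s'.ireg 2 = p := (hf.ireg 2 (by cases sense <;> rfl)).trans (by simpa using r2)
    have e3 : s'.ireg 3 = i := (hf.ireg 3 (by cases sense <;> rfl)).trans (by simpa using r3)
    have e8 : s'.ireg 8 = X := (hf.ireg 8 (by cases sense <;> rfl)).trans (by simpa using r8)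
    simp [e2, i2] at hcond
    have hk : k < p := by omega
    have tk := ht i hi (k + 1) hk
    push_cast at tk
    have m1 := htm i hi k hk
    have tk0 := ht0' k hk.le
    have hcost := sense.cost_signed_le (.input 0 (.reg 3) (.reg 10) *ʳ .ofInt (.reg 13) +ʳ
      .input 1 (.reg 3) (.reg 10))
    simp at hcost
    -- Common continuation of the two branches, which differ only in how register `12` receives the
    -- right end of the piece.
    have main : ∀ s1 : State, (∀ k, k ≠ 12 → s1.ireg k = s'.ireg k) → s1.iarr = s'.iarr →
        s1.varr = s'.varr → s1.ireg 12 = min (t i (k + 1)) X →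
        wp E (fillLoop .skip (sense.signed (.input 0 (.reg 3) (.reg 10) *ʳ .ofInt (.reg 13) +ʳ
          .input 1 (.reg 3) (.reg 10))) ;;
          .setReg 10 (.reg 10 +ᵢ .const 1) ;; .setArr 4 (.reg 10) (.reg 12)) s1 fun T s'' =>
          T ≤ 2 ^ K * 36 + 20 ∧ ∃ k' : ℕ, k' + (ρ - 1) = p ∧
    s''.ireg 10 = k' ∧ s''.ireg 13 = min (t i k') X ∧
    (∀ j ≤ k', s''.iarr 4 j = min (t i j) X) ∧
    ∀ x, 0 ≤ x → x < min (t i k') X → s''.varr 1 x = g i x := by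
      intro s1 q1 q2 q3 q4
      simp only [wp_seq, wp_setReg, wp_setArr]
      refine wp_call (fillLoop_spec hE (a := min (t i k) X) (l := min (t i (k + 1)) X) (g := g i)
        (tp := 1) (by rw [q1 _ (by omega), i3]) q4 (by omega)
        (sense.ok_signed rfl (by simp)) rfl (fun x s2 x0 x1 hf2 e13 => ?_)
        (fun x x0 x1 => hvok x (by omega) (by omega))) ?_
      · have f3 : s2.ireg 3 = i :=
          (hf2.ireg 3 (by cases sense <;> rfl)).trans ((q1 3 (by omega)).trans e3)
        have f10 : s2.ireg 10 = k :=
          (hf2.ireg 10 (by cases sense <;> rfl)).trans ((q1 10 (by omega)).trans i2)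
        simp only [wp_skip, le_refl, true_and, Sense.eval_signed, VExpr.eval, IExpr.eval, e13, f3,
          f10, hα i hi k hk, hβ i hi k hk]
        exact (hg i hi k hk x (by omega) (by omega) (by omega)).symm
      · rintro T s2 ⟨a1, a2, a3, a4⟩ f2
        have f10 : s2.ireg 10 = k :=
          (f2.ireg 10 (by cases sense <;> rfl)).trans ((q1 10 (by omega)).trans i2)
        have f12 : s2.ireg 12 = min (t i (k + 1)) X :=
          (f2.ireg 12 (by cases sense <;> rfl)).trans q4
        have f4 : s2.iarr 4 = s'.iarr 4 :=
          (f2.iarr 4 (by cases sense <;> rfl)).trans (by rw [q2])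
        rw [q3] at a4
        simp [f10, f12, f4, -lt_inf_iff]
        refine ⟨fun _ => by rw [abs_of_nonneg (by omega)]; omega,
          fun _ => by rw [abs_of_nonneg (by omega)]; omega, ?_,
          k + 1, by omega, by push_cast; rfl, by omega, fun j hj => ?_, fun x x0 x1 => ?_⟩
        · have h5 : (min (t i (k + 1)) X - min (t i k) X).toNat ≤ 2 ^ K := by zify; omega
          have := Nat.mul_le_mul h5 (show 1 + (sense.signed (.input 0 (.reg 3) (.reg 10) *ʳ
            .ofInt (.reg 13) +ʳ .input 1 (.reg 3) (.reg 10))).cost + 12 ≤ 36 by omega)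
          omega
        · rw [Function.update_apply]
          split_ifs with hj'
          · obtain rfl : j = k + 1 := by omega
            rfl
          · exact i4 j (by omega)
        · by_cases hx : x < min (t i k) X
          · rw [a4 x hx]
            exact i5 x x0 hx
          · exact a3 x (by omega) (by omega)
    simp only [plinStep, wp_seq (P := .ite _ _ _), wp_ite, wp_setReg, Cond.Holds, IExpr.eval, e3,
      i2, tk, e8]
    refine ⟨rfl, fun hle => ⟨rfl, fun _ => ?_, ?_⟩, fun hle => ⟨rfl, fun _ => ?_, ?_⟩⟩
    · rw [abs_of_nonneg (by omega)]
      omega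
    · refine wp_mono (main _ (fun k hk => by simp [hk]) rfl rfl ?_) ?_
      · simp
        omega
      · rintro T s'' ⟨c1, c2⟩
        simp [-lt_inf_iff]
        exact ⟨by omega, by omega, c2⟩
    · rw [abs_of_nonneg (by omega)]
      omega
    · refine wp_mono (main _ (fun k hk => by simp [hk]) rfl rfl ?_) ?_
      · simp
        omega
      · rintro T s'' ⟨c1, c2⟩
        simp [-lt_inf_iff]
        exact ⟨by omega, by omega, c2⟩
  · rintro T s' ⟨c1, c2, ρ', k, i1, i2, i3, i4, i5⟩ hf
    have e2 : s'.ireg 2 = p := (hf.ireg 2 (by cases sense <;> rfl)).trans (by simpa using r2)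
    simp [e2, i2] at c1 c2
    obtain rfl : k = p := by omega
    have hX : min (t i k) X = X := by
      have := htp i hi
      omega
    rw [hX] at i5
    simp [e2]
    refine ⟨fun _ => by omega, ?_, i5, ?_⟩
    · have hK1 : 4 ≤ 2 ^ K := by zify; omega
      have : k * (2 ^ K * 36 + 40 + 1 + 5) ≤ k * (2 ^ K * 60) := Nat.mul_le_mul_left _ (by omega)
      have : 1 * 4 ≤ k * 2 ^ K := Nat.mul_le_mul hp1 hK1
      rw [show k * (2 ^ K * 60) = 60 * (k * 2 ^ K) by ring] at *
      omega
    · have hpc : ∀ j : ℤ, 0 ≤ j → j < k →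
          ConvexPiece (s'.varr 1) (s'.iarr 4 j) (s'.iarr 4 (j + 1)) ∧
          ConcavePiece (s'.varr 1) (s'.iarr 4 j) (s'.iarr 4 (j + 1)) := by
        intro j j0 j1
        obtain ⟨j, rfl⟩ := Int.eq_ofNat_of_zero_le j0
        have hj : j < k := by omega
        have tj0 := ht0' j hj.le
        have q := i4 (j + 1) hj
        push_cast at q
        rw [i4 j hj.le, q]
        have hval : ∀ x, min (t i j) X ≤ x → x < min (t i (j + 1)) X →
            s'.varr 1 x = sense.sign * (α i j * x + β i j) := fun x x0 x1 => by
          rw [i5 x (by omega) (by omega)]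
          exact hg i hi j hj x (by omega) (by omega) (by omega)
        constructor
        -- Second differences of an affine function vanish, so the piece is both convex and concave.
        · refine convexPiece_of_local fun y y1 y2 => le_of_eq ?_
          rw [hval y (by omega) (by omega), hval _ (by omega) (by omega),
            hval _ (by omega) (by omega)]
          push_cast
          ring
        · refine concavePiece_of_local fun y y1 y2 => le_of_eq ?_
          rw [hval y (by omega) (by omega), hval _ (by omega) (by omega),
            hval _ (by omega) (by omega)]
          push_cast
          ring
      refine ⟨by omega, ?_, by rw [i4 k le_rfl, hX], fun j j0 j1 => ?_,
        fun j j0 j1 => .inl (hpc j j0 j1).1, fun _ => hpc⟩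
      · have := i4 0 (by omega)
        rw [Nat.cast_zero, ht0 i hi] at this
        omega
      · obtain ⟨j, rfl⟩ := Int.eq_ofNat_of_zero_le j0
        rw [i4 j (by omega)]
        have := ht0' j (by omega)
        omega

end

end Knap

namespace Knap

noncomputable section

/-! ### Polynomials -/

variable {E : Env} {K n : ℕ} {s s' : State} {W : ℤ} {w u : ℕ → ℤ} {M : Set ℕ}

/-- Evaluation of the polynomial with number `r3` at `r13`. -/
def horner : Prog :=
  .setReg 14 (.reg 2 +ᵢ .const 1) ;; .setVReg 1 (.ofInt (.const 0)) ;;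
  .while (.const 1 ≤ᵢ .reg 14)
    (.setReg 14 (.reg 14 -ᵢ .const 1) ;;
     .setVReg 1 (.reg 1 *ʳ .ofInt (.reg 13) +ʳ .input 0 (.reg 3) (.reg 14)))

/-- The intermediate results of the evaluation of a polynomial. -/
def hornerSum (c : ℕ → ℝ) (d : ℕ) (x : ℝ) (k : ℕ) : ℝ :=
  ∑ j ∈ Finset.Ico k (d + 1), c j * x ^ (j - k)

theorem hornerSum_last (c : ℕ → ℝ) (d : ℕ) (x : ℝ) : hornerSum c d x (d + 1) = 0 := by
  simp only [hornerSum, Finset.Ico_self, Finset.sum_empty]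

theorem hornerSum_zero (c : ℕ → ℝ) (d : ℕ) (x : ℝ) :
    hornerSum c d x 0 = ∑ j ∈ Finset.range (d + 1), c j * x ^ j := by
  simp only [hornerSum, Finset.range_eq_Ico, Nat.sub_zero]

theorem hornerSum_succ (c : ℕ → ℝ) {d k : ℕ} (hk : k ≤ d) (x : ℝ) :
    hornerSum c d x k = hornerSum c d x (k + 1) * x + c k := by
  rw [hornerSum, hornerSum, ← Finset.insert_Ico_add_one_left_eq_Ico (by omega : k < d + 1),
    Finset.sum_insert (by simp), Finset.sum_mul, add_comm]
  congr 1
  · refine Finset.sum_congr rfl fun j hj => ?_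
    have := (Finset.mem_Ico.1 hj).1
    rw [mul_assoc, ← pow_succ]
    congr 2
    omega
  · simp

/-- All intermediate results of Horner's scheme are stored, so each of them has to obey the bounds.
-/
theorem horner_spec (hE : E.Valid) {d i : ℕ} {x : ℤ} {c : ℕ → ℝ} (hd : d + 1 ≤ E.b)
    (h2 : s.ireg 2 = d) (h3 : s.ireg 3 = i) (h13 : s.ireg 13 = x)
    (hc : ∀ k ≤ d, E.inp.vtab 0 i k = c k)
    (hv : ∀ k ≤ d + 1, E.VOk (hornerSum c d x k)) :
    wp E horner s fun T s' => T ≤ 30 * (d + 1) ∧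
      s'.vreg 1 = ∑ j ∈ Finset.range (d + 1), c j * (x : ℝ) ^ j := by
  have hb := hE.two_le
  simp only [horner, wp_seq, wp_setReg, wp_setVReg]
  refine ⟨rfl, fun _ => by simp [h2]; rw [abs_of_nonneg (by omega)]; omega, rfl, fun _ => ?_, ?_⟩
  · have := hv (d + 1) le_rfl
    rw [hornerSum_last] at this
    simpa using this
  refine wp_mono (wp_while hE 13 (fun ρ s' => ρ ≤ d + 1 ∧ s'.ireg 14 = ρ ∧
    s'.vreg 1 = hornerSum c d x ρ) (ρ := d + 1) rfl ?_ ?_) ?_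
  · exact ⟨le_rfl, by simp [h2], by simp [hornerSum_last]⟩
  · rintro ρ s' hf hg ⟨i1, i2, i3⟩ hcond
    have e3 : s'.ireg 3 = i := (hf.ireg 3 rfl).trans (by simpa using h3)
    have e13 : s'.ireg 13 = x := (hf.ireg 13 rfl).trans (by simpa using h13)
    simp [i2] at hcond
    obtain ⟨k, rfl⟩ : ∃ k, ρ = k + 1 := ⟨ρ - 1, by omega⟩
    have hk : k ≤ d := by omega
    have hs := hornerSum_succ c hk (x : ℝ)
    have hvk := hv k (by omega)
    have hck := hc k hk
    have ek : ((k + 1 : ℕ) : ℤ) - 1 = k := by push_cast; ring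
    simp [i2, e3, e13, i3, hck, ← hs]
    exact ⟨fun _ => by omega, fun _ => hvk, by omega⟩
  · rintro T s' ⟨c1, c2, ρ', i1, i2, i3⟩
    simp [i2] at c1 c2
    subst c2
    rw [i3, hornerSum_zero]
    simp
    omega

/-- The second difference. -/
def secondDiff (F : ℤ → ℝ) (y : ℤ) : ℝ := F (y + 1) + F (y - 1) - (F y + F y)

/-- The function `F` changes its curvature at most `d` times between `0` and `X - 1`. -/
def FewTurns (F : ℤ → ℝ) (X : ℤ) (d : ℕ) : Prop :=
  ∃ N : ℤ → ℕ, (∀ y, N y ≤ d) ∧ ∀ y x, 0 < y → y < x → x + 1 < X →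
    secondDiff F y * secondDiff F x < 0 → N y < N x

/-- The second difference of `q` is a polynomial `Q` of degree at most `d`. Between two points where
its signs are opposite it has a root, so the number `N y` of distinct roots below `y` increases
strictly there, and it never exceeds `d`. -/
theorem fewTurns_of_eval {F : ℤ → ℝ} {X : ℤ} {d : ℕ} (q : Polynomial ℝ) (hq : q.natDegree ≤ d)
    (hF : ∀ x, 0 ≤ x → x < X → F x = q.eval (x : ℝ)) : FewTurns F X d := by
  let Q : Polynomial ℝ := q.comp (.X + .C 1) + q.comp (.X + .C (-1)) - (q + q)
  have hQ : Q.natDegree ≤ d := by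
    refine (Polynomial.natDegree_sub_le_of_le (Polynomial.natDegree_add_le_of_degree_le
      (n := d) ?_ ?_) (Polynomial.natDegree_add_le_of_degree_le hq hq)).trans_eq (max_self d)
    · rw [Polynomial.natDegree_comp, Polynomial.natDegree_X_add_C, mul_one]
      exact hq
    · rw [Polynomial.natDegree_comp, Polynomial.natDegree_X_add_C, mul_one]
      exact hq
  have hD : ∀ y, 0 < y → y + 1 < X → secondDiff F y = Q.eval (y : ℝ) := by
    intro y h0 h1
    rw [secondDiff, hF _ (by omega) h1, hF _ (by omega) (by omega), hF _ (by omega) (by omega)]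
    simp [Q, sub_eq_add_neg]
  refine ⟨fun y => (Q.roots.toFinset.filter fun r : ℝ => r < (y : ℝ)).card, fun y => ?_,
    fun y x h0 h1 h2 h3 => ?_⟩
  · exact (Finset.card_filter_le _ _).trans
      ((Multiset.toFinset_card_le _).trans ((Polynomial.card_roots' _).trans hQ))
  · rw [hD y h0 (by omega), hD x (by omega) h2] at h3
    -- The zero polynomial has an empty root multiset, but it does not take values of opposite
    -- signs.
    have hQ0 : Q ≠ 0 := by
      rintro h
      simp [h] at h3
    have hyx : (y : ℝ) < x := by exact_mod_cast h1
    obtain ⟨r, ⟨hr1, hr2⟩, hr3⟩ : ∃ r ∈ Set.Icc (y : ℝ) x, Q.eval r = 0 := by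
      have hcont : ContinuousOn (fun r => Q.eval r) (Set.Icc (y : ℝ) x) :=
        Q.continuous.continuousOn
      rcases mul_neg_iff.1 h3 with ⟨h4, h5⟩ | ⟨h4, h5⟩
      · exact intermediate_value_Icc' hyx.le hcont ⟨h5.le, h4.le⟩
      · exact intermediate_value_Icc hyx.le hcont ⟨h4.le, h5.le⟩
    have hry : r ≠ y := by
      rintro rfl
      simp [hr3] at h3
    have hrx : r ≠ x := by
      rintro rfl
      simp [hr3] at h3
    refine Finset.card_lt_card ⟨fun z hz => ?_, fun hsub => ?_⟩
    · simp only [Finset.mem_filter] at hz ⊢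
      exact ⟨hz.1, hz.2.trans hyx⟩
    · have := hsub (Finset.mem_filter.2 ⟨Multiset.mem_toFinset.2
        ((Polynomial.mem_roots hQ0).2 hr3), lt_of_le_of_ne hr2 hrx⟩)
      exact absurd (Finset.mem_filter.1 this).2 hr1.not_gt

/-- State of the search for the pieces when the points below `x` have been treated: there are `np`
complete pieces, and `sg` is the direction of the curvature in the current piece. -/
structure ScanInv (F : ℤ → ℝ) (N : ℤ → ℕ) (X : ℤ) (tb : ℤ → ℤ) (np : ℕ) (sg x : ℤ) : Prop where
  pos : 1 ≤ x
  le : x ≤ X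
  zero : tb 0 = 0
  mem : ∀ k : ℤ, 0 ≤ k → k ≤ np → 0 ≤ tb k ∧ tb k ≤ x
  piece : ∀ k : ℤ, 0 ≤ k → k < np →
    ConvexPiece F (tb k) (tb (k + 1)) ∨ ConcavePiece F (tb k) (tb (k + 1))
  sg_mem : sg = 0 ∨ sg = 1 ∨ sg = -1
  curv : ∀ τ : ℤ, τ = 1 ∨ τ = -1 → 0 ≤ sg * τ → ∀ y, tb np < y → y < x → 0 ≤ τ * secondDiff F y
  strict : sg ≠ 0 → ∃ y, 0 < y ∧ y < x ∧ 0 < sg * secondDiff F y ∧ np ≤ N y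
  none : sg = 0 → np = 0

namespace ScanInv

variable {F : ℤ → ℝ} {N : ℤ → ℕ} {X : ℤ} {tb : ℤ → ℤ} {np : ℕ} {sg x τ : ℤ}

/-- Zero curvature is compatible with both directions. -/
theorem step_zero (h : ScanInv F N X tb np sg x) (hx : x + 1 < X) (h0 : secondDiff F x = 0) :
    ScanInv F N X tb np sg (x + 1) := by
  refine ⟨by have := h.pos; omega, hx.le, h.zero, fun k k0 k1 => ?_, h.piece, h.sg_mem,
    fun τ hτ hs y y0 y1 => ?_, fun hs => ?_, h.none⟩
  · have := h.mem k k0 k1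
    omega
  · rcases eq_or_ne y x with rfl | hy
    · simp [h0]
    · exact h.curv τ hτ hs y y0 (by omega)
  · obtain ⟨y, h1, h2, h3⟩ := h.strict hs
    exact ⟨y, h1, by omega, h3⟩

theorem step_same (h : ScanInv F N X tb np sg x) (hx : x + 1 < X) (hτ : τ = 1 ∨ τ = -1)
    (h0 : 0 < τ * secondDiff F x) (hs : 0 ≤ sg * τ) : ScanInv F N X tb np τ (x + 1) := by
  refine ⟨by have := h.pos; omega, hx.le, h.zero, fun k k0 k1 => ?_, h.piece, .inr hτ,
    fun τ' hτ' hs' y y0 y1 => ?_, fun _ => ?_, fun h0 => by omega⟩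
  · have := h.mem k k0 k1
    omega
  · obtain rfl : τ' = τ := by
      rcases hτ with rfl | rfl <;> rcases hτ' with rfl | rfl <;> simp at hs' ⊢
    rcases eq_or_ne y x with rfl | hy
    · exact h0.le
    · exact h.curv _ hτ hs y y0 (by omega)
  · rcases eq_or_ne sg 0 with hsg | hsg
    · exact ⟨x, by have := h.pos; omega, by omega, h0, by simp [h.none hsg]⟩
    · obtain rfl : sg = τ := by
        rcases hτ with rfl | rfl <;> rcases h.sg_mem with rfl | rfl | rfl <;> simp at hs hsg ⊢
      obtain ⟨y, h1, h2, h3⟩ := h.strict hsg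
      exact ⟨y, h1, by omega, h3⟩

/-- A piece that ends before `e ≤ x + 1` involves the second differences at points below `x` only,
and these have the sign `sg`. As long as no sign has occurred (`sg = 0`), the piece counts as
convex. -/
theorem piece_last (h : ScanInv F N X tb np sg x) {e : ℤ} (he : e ≤ x + 1) :
    ConvexPiece F (tb np) e ∨ ConcavePiece F (tb np) e := by
  by_cases hs : 0 ≤ sg
  · refine .inl (convexPiece_of_local fun y y0 y1 => ?_)
    have := h.curv 1 (.inl rfl) (by simpa using hs) y y0 (by omega)
    simp [secondDiff] at this
    linarith
  · refine .inr (concavePiece_of_local fun y y0 y1 => ?_)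
    have := h.curv (-1) (.inr rfl) (by omega) y y0 (by omega)
    simp [secondDiff] at this
    linarith

/-- The current piece is closed after the point `x`: the offending second difference at `x` involves
`x + 1`, which is already in the next piece. The opposite signs at an earlier point and at `x` make
`N` grow, which pays for the new piece. -/
theorem step_turn (hN : ∀ y x, 0 < y → y < x → x + 1 < X →
      secondDiff F y * secondDiff F x < 0 → N y < N x)
    (h : ScanInv F N X tb np sg x) (hx : x + 1 < X) (hτ : τ = 1 ∨ τ = -1)
    (h0 : 0 < τ * secondDiff F x) (hs : sg * τ < 0) :
    ScanInv F N X (Function.update tb (np + 1) (x + 1)) (np + 1) τ (x + 1) := by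
  have hpos := h.pos
  have hsg : sg = -τ := by
    rcases hτ with rfl | rfl <;> rcases h.sg_mem with rfl | rfl | rfl <;> simp at hs ⊢
  refine ⟨by omega, hx.le, ?_, fun k k0 k1 => ?_, fun k k0 k1 => ?_, .inr hτ,
    fun τ' hτ' hs' y y0 y1 => ?_, fun _ => ?_, fun h0 => by omega⟩
  · rw [Function.update_of_ne (by omega)]
    exact h.zero
  · rw [Function.update_apply]
    split_ifs with hk
    · omega
    · have := h.mem k k0 (by push_cast at k1; omega)
      omega
  · rw [Function.update_of_ne (by push_cast at k1; omega)]
    rcases eq_or_ne k np with rfl | hk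
    · rw [Function.update_self]
      exact h.piece_last le_rfl
    · rw [Function.update_of_ne (by omega)]
      exact h.piece k k0 (by push_cast at k1; omega)
  · push_cast at y0
    rw [Function.update_self] at y0
    omega
  · obtain ⟨y, h1, h2, h3, h4⟩ := h.strict (by rcases hτ with rfl | rfl <;> omega)
    refine ⟨x, by omega, by omega, h0, ?_⟩
    have := hN y x h1 h2 hx (by
      rw [hsg] at h3
      rcases hτ with rfl | rfl
      · simp at h3 h0
        exact mul_neg_of_neg_of_pos h3 h0
      · simp at h3 h0
        exact mul_neg_of_pos_of_neg h3 h0)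
    omega

/-- Every closed piece has been paid for by an increase of `N`. -/
theorem np_le {d : ℕ} (hN : ∀ y, N y ≤ d) (h : ScanInv F N X tb np sg x) : np ≤ d := by
  rcases eq_or_ne sg 0 with hs | hs
  · simp [h.none hs]
  · obtain ⟨y, _, _, _, h4⟩ := h.strict hs
    exact h4.trans (hN y)

end ScanInv

/-- The curvature at `r13` has the direction `τ`. -/
def scanMark (τ : ℤ) : Prog :=
  .ite (.reg 10 *ᵢ .const τ +ᵢ .const 1 ≤ᵢ .const 0)
    (.setReg 9 (.reg 9 +ᵢ .const 1) ;; .setArr 4 (.reg 9) (.reg 13 +ᵢ .const 1)) .skip ;;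
  .setReg 10 (.const τ) ;; .setReg 13 (.reg 13 +ᵢ .const 1)

/-- One step of the search for the pieces. -/
def scanStep : Prog :=
  .ite (.get 1 (.reg 13) +ʳ .get 1 (.reg 13) ≤ʳ
      .get 1 (.reg 13 +ᵢ .const 1) +ʳ .get 1 (.reg 13 -ᵢ .const 1))
    (.ite (.get 1 (.reg 13 +ᵢ .const 1) +ʳ .get 1 (.reg 13 -ᵢ .const 1) ≤ʳ
        .get 1 (.reg 13) +ʳ .get 1 (.reg 13))
      (.setReg 13 (.reg 13 +ᵢ .const 1)) (scanMark 1))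
    (scanMark (-1))

/-- Greedy decomposition of the function in the value array `1` into convex and concave pieces. -/
def scan : Prog :=
  .setReg 9 (.const 0) ;; .setReg 10 (.const 0) ;; .setReg 13 (.const 1) ;;
  .setArr 4 (.const 0) (.const 0) ;;
  .while (.reg 13 +ᵢ .const 2 ≤ᵢ .reg 8) scanStep ;;
  .setReg 9 (.reg 9 +ᵢ .const 1) ;; .setArr 4 (.reg 9) (.reg 8)

theorem scanMark_spec (hE : E.Valid) {N : ℤ → ℕ} {X τ sg x : ℤ} {np : ℕ}
    (hN : ∀ y x, 0 < y → y < x → x + 1 < X →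
      secondDiff (s.varr 1) y * secondDiff (s.varr 1) x < 0 → N y < N x)
    (hX : X + np + 1 ≤ E.b) (h9 : s.ireg 9 = np) (h10 : s.ireg 10 = sg) (h13 : s.ireg 13 = x)
    (h : ScanInv (s.varr 1) N X (s.iarr 4) np sg x) (hx : x + 1 < X) (hτ : τ = 1 ∨ τ = -1)
    (h0 : 0 < τ * secondDiff (s.varr 1) x) :
    wp E (scanMark τ) s fun T s' => T ≤ 30 ∧ s'.varr 1 = s.varr 1 ∧ s'.ireg 13 = x + 1 ∧
      ∃ np' : ℕ, s'.ireg 9 = np' ∧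
        ScanInv (s'.varr 1) N X (s'.iarr 4) np' (s'.ireg 10) (x + 1) := by
  have hpos := h.pos
  have hb := hE.two_le
  have hτb : |τ| ≤ (E.b : ℤ) := by
    rcases hτ with rfl | rfl <;> simp <;> omega
  have hc : (Cond.ok (.reg 10 *ᵢ .const τ +ᵢ .const 1 ≤ᵢ .const 0)) = true := by
    rcases hτ with rfl | rfl <;> rfl
  have hc' : τ.natAbs ≤ 2 := by
    rcases hτ with rfl | rfl <;> simp
  simp only [scanMark, wp_seq, wp_ite, wp_setReg, wp_setArr, wp_skip]
  refine ⟨hc, fun hs => ?_, fun hs => ?_⟩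
  · simp [h10] at hs
    simp [h9, h13, hτb]
    have hturn := h.step_turn hN hx hτ h0 (by omega)
    refine ⟨fun _ => by rw [abs_of_nonneg (by omega)]; omega,
      fun _ => by rw [abs_of_nonneg (by omega)]; omega, hc',
      fun _ => by rw [abs_of_nonneg (by omega)]; omega, np + 1, by simp, hturn⟩
  · simp [h10] at hs
    simp [h9, h13, hτb]
    exact ⟨hc', fun _ => by rw [abs_of_nonneg (by omega)]; omega,
      h.step_same hx hτ h0 (by omega)⟩

/-- At most `d` pieces are closed during the scan, and the piece that is still open at the end is
the last of at most `d + 1`. -/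
theorem scan_spec (hE : E.Valid) {X : ℤ} {d : ℕ} (hX1 : 1 ≤ X) (hX : X + d + 1 ≤ E.b)
    (h8 : s.ireg 8 = X) (hF : FewTurns (s.varr 1) X d) :
    wp E scan s fun T s' => T ≤ X.toNat * 100 + 50 ∧ s'.varr 1 = s.varr 1 ∧
      s'.ireg 9 ≤ d + 1 ∧ IsPartition (s'.varr 1) X (s'.ireg 9) (s'.iarr 4) False := by
  have hb := hE.two_le
  obtain ⟨N, hN1, hN⟩ := hF
  generalize hG : s.varr 1 = F at *
  simp only [scan, wp_seq, wp_setReg, wp_setArr]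
  refine ⟨rfl, fun _ => by simp, rfl, fun _ => by simp, rfl, fun _ => by simp; omega, rfl,
    fun _ => by simp, ?_⟩
  refine wp_call (wp_while hE 90 (fun ρ s' => s'.varr 1 = F ∧ s'.ireg 13 + ρ = X ∧ ∃ np : ℕ,
    s'.ireg 9 = np ∧ ScanInv F N X (s'.iarr 4) np (s'.ireg 10) (s'.ireg 13))
    (ρ := (X - 1).toNat) rfl ?_ ?_) ?_
  · refine ⟨by simpa using hG, by simp; omega, 0, by simp, ⟨by simp, by simpa, by simp,
      fun k k0 k1 => ?_, fun k k0 k1 => ?_, by simp, fun τ _ _ y y0 y1 => ?_, by simp, by simp⟩⟩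
    · obtain rfl : k = 0 := by simpa using le_antisymm k1 k0
      simp
    · simp at k1
      omega
    · simp at y0 y1
      omega
  · rintro ρ s' hf hg ⟨i1, i2, np, i3, i4⟩ hcond
    have e8 : s'.ireg 8 = X := (hf.ireg 8 rfl).trans (by simpa using h8)
    generalize hx : s'.ireg 13 = x at *
    simp [hx, e8] at hcond
    have hpos := i4.pos
    have hnp := i4.np_le hN1
    have main : ∀ τ : ℤ, τ = 1 ∨ τ = -1 → 0 < τ * secondDiff F x →
        wp E (scanMark τ) s' fun T s'' => T ≤ 30 ∧ 1 ≤ ρ ∧ s''.varr 1 = F ∧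
        s''.ireg 13 + ((ρ - 1 : ℕ) : ℤ) = X ∧ ∃ np : ℕ,
        s''.ireg 9 = np ∧ ScanInv F N X (s''.iarr 4) np (s''.ireg 10) (s''.ireg 13) := by
      intro τ hτ h0
      subst i1
      refine wp_mono (scanMark_spec hE hN (by omega) i3 rfl hx i4 (by omega) hτ h0) ?_
      rintro T s'' ⟨c1, c2, c3, np', c4, c5⟩
      exact ⟨c1, by omega, c2, by omega, np', c4, by rw [c3, ← c2]; exact c5⟩
    simp only [scanStep, wp_ite, wp_setReg]
    simp [i1, hx]
    refine ⟨fun h1 => ⟨fun h2 => ?_, fun h2 => ?_⟩, fun h1 => ?_⟩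
    · refine ⟨fun _ => by rw [abs_of_nonneg (by omega)]; omega, by omega, by omega, np, i3, ?_⟩
      refine i4.step_zero (by omega) ?_
      rw [secondDiff]
      linarith
    · refine wp_mono (main 1 (.inl rfl) ?_) ?_
      · rw [secondDiff]
        push_cast
        linarith
      · rintro T s'' ⟨c1, c2⟩
        exact ⟨by omega, c2⟩
    · refine wp_mono (main (-1) (.inr rfl) ?_) ?_
      · rw [secondDiff]
        push_cast
        linarith
      · rintro T s'' ⟨c1, c2⟩
        exact ⟨by omega, c2⟩
  · rintro T s' ⟨c1, c2, ρ', i1, i2, np, i3, i4⟩ hf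
    have e8 : s'.ireg 8 = X := (hf.ireg 8 rfl).trans (by simpa using h8)
    have hpos := i4.pos
    have hle := i4.le
    have hnp := i4.np_le hN1
    simp [e8] at c1 c2
    simp [e8, i3, i1]
    refine ⟨fun _ => by rw [abs_of_nonneg (by omega)]; omega,
      fun _ => by rw [abs_of_nonneg (by omega)]; omega, by omega, by omega, ?_⟩
    refine ⟨by omega, ?_, by simp, fun k k0 k1 => ?_, fun k k0 k1 => ?_, fun hf => hf.elim⟩
    · rw [Function.update_of_ne (by omega)]
      exact i4.zero
    · rw [Function.update_apply]
      split_ifs with hk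
      · omega
      · have := i4.mem k k0 (by omega)
        omega
    · rw [Function.update_of_ne (by omega)]
      rcases eq_or_ne k np with rfl | hk
      · rw [Function.update_self]
        exact i4.piece_last (by omega)
      · rw [Function.update_of_ne (by omega)]
        exact i4.piece k k0 (by omega)

/-- Values and pieces of a polynomial. -/
def polyFront (sense : Sense) : Prog :=
  .setReg 13 (.const 0) ;; .setReg 12 (.reg 8) ;;
  fillLoop horner (sense.signed (.reg 1)) ;; scan

theorem polyFront_spec {g : ℕ → ℤ → ℝ} (h : Setup E K n W w u g M) (sense : Sense) {d : ℕ}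
    {c : ℕ → ℕ → ℝ} (hpar : E.inp.par = d) (hdb : W + d + 2 ≤ E.b)
    (hc : ∀ i < n, ∀ k ≤ d, E.inp.vtab 0 i k = c i k)
    (hv : ∀ i < n, ∀ x : ℤ, 0 ≤ x → x ≤ u i → ∀ k ≤ d + 1, E.VOk (hornerSum (c i) d x k))
    (hg : ∀ i < n, ∀ x : ℤ, 0 ≤ x → x ≤ u i →
      g i x = sense.sign * ∑ j ∈ Finset.range (d + 1), c i j * (x : ℝ) ^ j)
    (ht : ∀ i < n, FewTurns (g i) (u i + 1) d) :
    FrontEnd E K n W w u g (polyFront sense) (200 * ((d + 1) * 2 ^ K)) (d + 1) False := by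
  have hE := h.valid
  have hb := hE.two_le
  have h2 := h.two_le
  refine ⟨by cases sense <;> decide, by cases sense <;> rfl, by omega, fun i hi s hr => ?_⟩
  obtain ⟨X1, X2⟩ := h.loaded hi
  have b1 := h.le_pow
  have b2 := h.pow_le
  have r8 := hr.r8
  have r3 := hr.r3
  have r2 := hr.r2.trans hpar
  have hvok : ∀ t, 0 ≤ t → t < min (u i) (W / w i) + 1 → E.VOk (g i t) :=
    fun t => h.vok_value hi
  have hXu : min (u i) (W / w i) + 1 ≤ u i + 1 := by omega
  generalize min (u i) (W / w i) + 1 = X at *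
  have hcost := sense.cost_signed_le (.reg 1)
  simp at hcost
  simp only [polyFront, wp_seq, wp_setReg]
  refine ⟨rfl, fun _ => by simp, rfl,
    fun _ => by simp [r8]; rw [abs_of_nonneg (by omega)]; omega, ?_⟩
  refine wp_call (fillLoop_spec hE (a := 0) (l := X) (g := g i) (tp := 30 * (d + 1)) (by simp)
    (by simp [r8]) le_rfl (sense.ok_signed rfl (by simp)) rfl (fun t s' ht0 ht hf e13 => ?_)
    (fun t ht0 ht => hvok t ht0 ht)) ?_
  · have e3 : s'.ireg 3 = i := (hf.ireg 3 (by cases sense <;> rfl)).trans (by simpa using r3)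
    have e2 : s'.ireg 2 = d := (hf.ireg 2 (by cases sense <;> rfl)).trans (by simpa using r2)
    refine wp_mono (horner_spec hE (by omega) e2 e3 e13 (hc i hi) (hv i hi t ht0 (by omega))) ?_
    rintro T s'' ⟨c1, c2⟩
    refine ⟨c1, ?_⟩
    rw [hg i hi t ht0 (by omega), Sense.eval_signed, VExpr.eval, c2]
  · rintro T s1 ⟨a1, a2, a3, a4⟩ f1
    have e8 : s1.ireg 8 = X := (f1.ireg 8 (by cases sense <;> rfl)).trans (by simpa using r8)
    -- The array agrees with `g i` below `X ≤ u i + 1`, and the second differences in question use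
    -- no other entries.
    have hturn : FewTurns (s1.varr 1) X d := by
      obtain ⟨N, hN1, hN2⟩ := ht i hi
      have hD : ∀ y, 0 < y → y + 1 < X → secondDiff (s1.varr 1) y = secondDiff (g i) y := by
        intro y y0 y1
        rw [secondDiff, a3 _ (by omega) y1, a3 _ (by omega) (by omega),
          a3 _ (by omega) (by omega), secondDiff]
      refine ⟨N, hN1, fun y x h0 h1 h2 h3 => hN2 y x h0 h1 (by omega) ?_⟩
      rwa [← hD y h0 (by omega), ← hD x (by omega) h2]
    refine wp_mono (scan_spec hE X1 (by omega) e8 hturn) ?_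
    rintro T2 s2 ⟨c1, c2, c3, c4⟩
    refine ⟨?_, fun t t0 t1 => by rw [c2]; exact a3 t t0 t1, by push_cast; exact c3, c4⟩
    have h5 : (X - 0).toNat ≤ 2 ^ K := by zify; omega
    have h6 : X.toNat ≤ 2 ^ K := by zify; omega
    have := Nat.mul_le_mul h5 (show 30 * (d + 1) + (sense.signed (.reg 1)).cost + 12 ≤
      50 * (d + 1) by omega)
    have hK1 : 4 ≤ 2 ^ K := by zify; omega
    have h7 : 1 * 2 ^ K ≤ (d + 1) * 2 ^ K := Nat.mul_le_mul_right _ (by omega)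
    rw [show 2 ^ K * (50 * (d + 1)) = 50 * ((d + 1) * 2 ^ K) by ring] at this
    simp
    omega

end

end Knap

namespace Knap

noncomputable section

/-! ## Problems as inputs of the machine -/

theorem table_apply {n : ℕ} {R : Type} [Zero R] {len : Fin n → ℕ} {g : Fin n → ℕ → R} {i j : ℕ}
    (hi : i < n) (hj : j < len ⟨i, hi⟩) : table len g i j = g ⟨i, hi⟩ j := by
  have h : 0 ≤ (i : ℤ) ∧ (i : ℤ) < n := by omega
  simp [table, hi, hj]

theorem table_rec {n : ℕ} {R : Type} [Zero R] {len : Fin n → ℕ} {g : Fin n → ℕ → R} {p : R → Prop}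
    (h0 : p 0) (h : ∀ i, ∀ j < len i, p (g i j)) (i j : ℤ) : p (table len g i j) := by
  rw [table]
  split_ifs with h1 h2
  · exact h _ _ (by omega)
  · exact h0
  · exact h0

namespace Problem

variable {n : ℕ} (Q : Problem n)

/-- The weights, as a sequence. -/
def weightAt (i : ℕ) : ℤ := if h : i < n then Q.w ⟨i, h⟩ else 1

/-- The upper bounds, as a sequence. -/
def upperAt (i : ℕ) : ℤ := if h : i < n then Q.u ⟨i, h⟩ else 1

/-- The summands of the objective that is to be maximized, as a sequence. -/
def signedAt (sense : Sense) (i : ℕ) (t : ℤ) : ℝ :=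
  if h : i < n then sense.sign * Q.f ⟨i, h⟩ t else 0

variable {Q}

theorem weightAt_of_lt {i : ℕ} (h : i < n) : Q.weightAt i = Q.w ⟨i, h⟩ := dif_pos h

theorem upperAt_of_lt {i : ℕ} (h : i < n) : Q.upperAt i = Q.u ⟨i, h⟩ := dif_pos h

theorem signedAt_of_lt {sense : Sense} {i : ℕ} (h : i < n) (t : ℤ) :
    Q.signedAt sense i t = sense.sign * Q.f ⟨i, h⟩ t := dif_pos h

variable (Q) in
/-- The exponent of the least power of two that is at least `2 * W`. -/
def logSize : ℕ := Nat.clog 2 (2 * Q.W)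

theorem two_mul_le_pow_logSize : 2 * Q.W ≤ 2 ^ Q.logSize := Nat.le_pow_clog (by norm_num) _

theorem pow_logSize_lt : 2 ^ Q.logSize < 4 * Q.W := by
  have hW := Q.W_pos
  have h := Nat.pow_pred_clog_lt_self (b := 2) (by norm_num) (x := 2 * Q.W) (by omega)
  have hpos : 0 < Q.logSize := Nat.clog_pos (by norm_num) (by omega)
  rw [← logSize] at h
  obtain ⟨k, hk⟩ : ∃ k, Q.logSize = k + 1 := ⟨Q.logSize - 1, by omega⟩
  rw [hk] at h ⊢
  simp at h
  rw [pow_succ]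
  omega

theorem partFeasible_iff (hn : 1 ≤ n) (x : ℕ → ℤ) :
    PartFeasible Q.weightAt Q.upperAt (n - 1) Q.W x ↔ Q.Feasible fun i => x i := by
  rw [PartFeasible, Feasible, Nat.sub_add_cancel hn, Finset.sum_range, and_comm]
  refine and_congr ?_ ⟨fun h i => ?_, fun h j hj => ?_⟩
  · simp [weightAt]
  · have := h i (by omega)
    rwa [upperAt_of_lt i.2] at this
  · have hj' : j < n := by omega
    rw [upperAt_of_lt hj']
    exact h ⟨j, hj'⟩

theorem sum_signedAt (sense : Sense) (x : ℕ → ℤ) :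
    ∑ j ∈ Finset.range n, Q.signedAt sense j (x j) =
      sense.sign * Q.objective fun i => x i := by
  rw [Finset.sum_range, objective, Finset.mul_sum]
  exact Finset.sum_congr rfl fun i _ => signedAt_of_lt i.2 _

/-- Optimality and value are transferred from the signed objective; the sign is removed by
multiplying with it once more. -/
theorem isAnswer_of_correct (hn : 1 ≤ n) {sense : Sense} {s : State}
    (h : Correct sense n Q.W Q.weightAt Q.upperAt (Q.signedAt sense) s) :
    IsAnswer Q sense s := by
  have key : ∀ y : Fin n → ℤ, Q.Feasible y → ∃ x : ℕ → ℤ, (fun i : Fin n => x i) = y ∧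
      PartFeasible Q.weightAt Q.upperAt (n - 1) Q.W x := by
    intro y hy
    refine ⟨fun j => if h : j < n then y ⟨j, h⟩ else 0, by simp, ?_⟩
    rw [partFeasible_iff hn]
    simpa using hy
  rcases h with ⟨h1, h2, h3, h4⟩ | ⟨h1, h2⟩
  · refine .inl ⟨h1, ⟨(partFeasible_iff hn _).1 h2, fun y hy => ?_⟩, ?_⟩
    · obtain ⟨x, rfl, hx⟩ := key y hy
      have := h3 x hx
      rw [sum_signedAt, sum_signedAt sense fun j => s.iarr 0 j] at this
      cases sense <;> simpa [Sense.sign] using this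
    · rw [h4, sum_signedAt sense fun j => s.iarr 0 j, ← mul_assoc, sense.sign_mul_sign, one_mul]
  · refine .inr ⟨h1, ?_⟩
    rintro ⟨y, hy⟩
    obtain ⟨x, rfl, hx⟩ := key y hy
    exact h2 x hx

end Problem

variable {n : ℕ}

/-- Bounds for the numbers in the computation, where the input integers are bounded by `B`, and the
input values by the elements of `M`. -/
def inputEnv (n : ℕ) (inp : Input) (B : ℕ) (M : Set ℕ) : Env where
  inp := inp
  b := 16 * B ^ 2
  V := (fun m => n * m) '' M

/-- The input `inp` describes the problem `Q`; the integers are bounded by `B`, and the values by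
the elements of `M`. -/
structure Describes (Q : Problem n) (inp : Input) (B : ℕ) (M : Set ℕ) : Prop where
  one_le : 1 ≤ n
  two_le : 2 ≤ Q.W
  n_eq : inp.n = n
  W_eq : inp.W = Q.W
  weight : ∀ i : Fin n, inp.itab 0 i 0 = Q.w i
  upper : ∀ i : Fin n, inp.itab 1 i 0 = Q.u i
  n_le : n ≤ B
  W_le : Q.W ≤ B
  par_le : |inp.par| ≤ (B : ℤ)
  itab_le : ∀ a i j, |inp.itab a i j| ≤ (B : ℤ)
  le_bound : ∀ m ∈ M, B ^ 6 ≤ m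
  vtab_le : ∀ m ∈ M, ∀ a i j, IsIntLE m (inp.vtab a i j)
  value_le : ∀ m ∈ M, ∀ i, ∀ x : ℤ, 0 ≤ x → x ≤ Q.u i → IsIntLE m (Q.f i x)

namespace Describes

variable {Q : Problem n} {inp : Input} {B : ℕ} {M : Set ℕ}

/-- Values may be converted integers, so each value bound has to dominate the integer bound: `16 * B
^ 2 ≤ B ^ 6 ≤ m` as `B ≥ 2`. -/
theorem valid (h : Describes Q inp B M) : (inputEnv n inp B M).Valid := by
  have hB : 2 ≤ B := h.two_le.trans h.W_le
  have hB2 : B ≤ 16 * B ^ 2 := by nlinarith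
  refine ⟨by simp only [inputEnv]; omega, fun a i j => ?_, fun a i j => ?_, ?_⟩
  · exact (h.itab_le a i j).trans (by simp only [inputEnv]; exact_mod_cast hB2)
  · rintro _ ⟨m, hm, rfl⟩
    exact (h.vtab_le m hm a i j).mono (Nat.le_mul_of_pos_left _ h.one_le)
  · rintro _ ⟨m, hm, rfl⟩
    refine (le_trans ?_ (h.le_bound m hm)).trans (Nat.le_mul_of_pos_left _ h.one_le)
    have : 2 ^ 4 ≤ B ^ 4 := Nat.pow_le_pow_left hB 4
    calc 16 * B ^ 2 ≤ B ^ 4 * B ^ 2 := Nat.mul_le_mul_right _ (by omega)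
      _ = B ^ 6 := by ring

/-- The bound `16 * B ^ 2` for stored integers has to dominate the shifted tree positions, through
`4 * 2 ^ K ≤ 16 * W`, and the addresses in the layers, through `(n + 1) * (W + 1)`. -/
theorem setup (h : Describes Q inp B M) (sense : Sense) :
    Setup (inputEnv n inp B M) Q.logSize n Q.W Q.weightAt Q.upperAt (Q.signedAt sense) M := by
  have hB : 2 ≤ B := h.two_le.trans h.W_le
  have hW := h.W_le
  have hn := h.n_le
  have h1 := Q.two_mul_le_pow_logSize
  have h2 := Q.pow_logSize_lt
  refine ⟨h.valid, by exact_mod_cast h.two_le, by exact_mod_cast h1, by exact_mod_cast h2,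
    ?_, ?_, fun i hi => ?_, fun i hi => ?_, fun i hi => ?_, fun i hi => ?_,
    fun i hi t t0 t1 m hm => ?_, fun v hv => ?_⟩
  · have : 4 * 2 ^ Q.logSize ≤ 16 * B ^ 2 := by nlinarith
    simp only [inputEnv]
    exact_mod_cast this
  · have : (n + 1) * (Q.W + 1) ≤ 16 * B ^ 2 := by nlinarith
    simp only [inputEnv]
    exact_mod_cast this
  · rw [Problem.weightAt_of_lt hi]
    exact h.weight ⟨i, hi⟩
  · rw [Problem.upperAt_of_lt hi]
    exact h.upper ⟨i, hi⟩
  · rw [Problem.weightAt_of_lt hi]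
    exact_mod_cast Q.w_pos _
  · rw [Problem.upperAt_of_lt hi]
    exact_mod_cast Q.u_pos _
  · rw [Problem.upperAt_of_lt hi] at t1
    rw [Problem.signedAt_of_lt hi]
    exact (h.value_le m hm _ t t0 t1).sign_mul sense
  · rintro _ ⟨m, hm, rfl⟩
    exact hv m hm

theorem good_init (h : Describes Q inp B M) : (inputEnv n inp B M).Good inp.init := by
  have hB : 2 ≤ B := h.two_le.trans h.W_le
  have hW := h.W_le
  have hn := h.n_le
  have hp := h.par_le
  have hB2 : (B : ℤ) ≤ 16 * B ^ 2 := by nlinarith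
  refine ⟨fun k => ?_, fun a i => ?_, fun k m _ => ?_, fun a i m _ => ?_⟩
  · simp only [inputEnv, Input.init, h.n_eq, h.W_eq]
    push_cast
    split_ifs
    · rw [abs_of_nonneg (by omega)]
      omega
    · rw [abs_of_nonneg (by omega)]
      omega
    · omega
    · simp
  · simp [Input.init]
  · exact IsIntLE.zero m
  · exact IsIntLE.zero m

/-- Here `240 = 6 * 40`: stored integers are at most `16 * B ^ 2 ≤ B ^ 6`, and evaluation takes at
most the 40th power. -/
theorem exists_exec (h : Describes Q inp B M) {sense : Sense} {FE : Prog} {ft np δ : ℕ}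
    {lin : Prop} (hFE : FrontEnd (inputEnv n inp B M) Q.logSize n Q.W Q.weightAt Q.upperAt
      (Q.signedAt sense) FE ft np lin) (hδ : Q.logSize + 1 ≤ δ ∨ lin) (hδ1 : 1 ≤ δ)
    {iok : ℤ → Prop} {vok : ℝ → Prop} (hi : ∀ z : ℤ, |z| ≤ (B : ℤ) ^ 240 → iok z)
    (hv : ∀ v, (∀ m ∈ M, IsIntLE ((n * m) ^ 40) v) → vok v) :
    ∃ T s, Exec inp iok vok (solver sense FE) inp.init T s ∧ IsAnswer Q sense s ∧
      T ≤ 300 * 2 ^ Q.logSize + ft + (n - 1) * (ft + 1100 * ((np + 1) * (2 ^ Q.logSize *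
        ((Q.logSize + 1) * δ)))) := by
  have hB : 2 ≤ B := h.two_le.trans h.W_le
  obtain ⟨T, s, h1, _, h2, h3⟩ := terminates_of_wp h.valid
    (solver_spec (h.setup sense) hFE hδ hδ1 h.one_le (s := inp.init)
      (by simp [Input.init, h.n_eq]) (by simp [Input.init, h.W_eq]) rfl (fun _ => rfl) sense)
    h.good_init
  refine ⟨T, s, h1.mono (fun z hz => hi z (hz.trans ?_))
    (fun v hvm => hv v fun m hm => hvm _ ⟨m, hm, rfl⟩),
    Problem.isAnswer_of_correct h.one_le h3, h2⟩
  · have h16 : 16 * B ^ 2 ≤ B ^ 6 := by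
      have : 2 ^ 4 ≤ B ^ 4 := Nat.pow_le_pow_left hB 4
      calc 16 * B ^ 2 ≤ B ^ 4 * B ^ 2 := Nat.mul_le_mul_right _ (by omega)
        _ = B ^ 6 := by ring
    have := Nat.pow_le_pow_left h16 40
    rw [← pow_mul] at this
    simp only [inputEnv]
    exact_mod_cast this

end Describes

/-! ## Running times -/

/-- From `2 ^ K < 4 * W` and `log 2 ≤ log W` one gets `(K + 1) * log 2 ≤ 4 * log W`, and `4 / 0.69 <
6`. -/
theorem logSize_le {Q : Problem n} (hW : 2 ≤ Q.W) : (Q.logSize : ℝ) + 1 ≤ 6 * Real.log Q.W := by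
  have h2 : 0.69 < Real.log 2 := lt_trans (by norm_num) Real.log_two_gt_d9
  have h1 : Real.log 2 ≤ Real.log Q.W := Real.log_le_log (by norm_num) (by exact_mod_cast hW)
  have h3 : Real.log ((2 : ℝ) ^ Q.logSize) ≤ Real.log (2 ^ 2 * Q.W) := by
    refine Real.log_le_log (by positivity) ?_
    have := Q.pow_logSize_lt.le
    norm_num
    exact_mod_cast this
  have hW0 : (0 : ℝ) < Q.W := by exact_mod_cast Q.W_pos
  rw [Real.log_mul (by positivity) hW0.ne', Real.log_pow, Real.log_pow] at h3
  push_cast at h3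
  nlinarith

theorem pow_logSize_le {Q : Problem n} : (2 : ℝ) ^ Q.logSize ≤ 4 * Q.W := by
  exact_mod_cast Q.pow_logSize_lt.le

theorem le_log {W : ℕ} (hW : 2 ≤ W) : 0.69 < Real.log W :=
  lt_of_lt_of_le (lt_trans (by norm_num) Real.log_two_gt_d9)
    (Real.log_le_log (by norm_num) (by exact_mod_cast hW))

/-- The extra factor `(W / w) ^ e` is at least `1`. This is the only link between the near-linear
running time and the exponents of the theorem. -/
theorem le_rpow_mul_rpow {W w e : ℝ} (he : 0 ≤ e) (hw : 0 < w) (hwW : w ≤ W) :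
    W ≤ W ^ (1 + e) * w ^ (-e) := by
  have hW : 0 < W := hw.trans_le hwW
  rw [Real.rpow_add hW, Real.rpow_one, mul_assoc]
  refine le_mul_of_one_le_right hW.le ?_
  rw [Real.rpow_neg hw.le, ← div_eq_mul_inv, one_le_div (by positivity)]
  exact Real.rpow_le_rpow hw.le hwW he

/-- The first bound uses `w = 1` in `le_rpow_mul_rpow`; the second applies it to the weight of each
of the `n - 1` items after the first. -/
theorem time_le {Q : Problem n} (hn : 1 ≤ n) (hW : 2 ≤ Q.W) {T a D e C : ℝ} (he : 0 ≤ e)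
    (hD : 0 ≤ D) (ha : 0 ≤ a) (hC : 5 * a ≤ C)
    (hT : T ≤ a * (D * Q.W) + (n - 1) * (a * (D * (Q.W * Real.log Q.W ^ 2)))) :
    T ≤ C * (D * n * (Q.W : ℝ) ^ (1 + e) * Real.log Q.W ^ 2) ∧
      ((∀ i, Q.w i ≤ Q.W) → T ≤ C * (D * (Q.W + (Q.W : ℝ) ^ (1 + e) *
        (∑ i ∈ Finset.univ.filter (fun i : Fin n => 0 < i.val), (Q.w i : ℝ) ^ (-e)) *
          Real.log Q.W ^ 2))) := by
  have hL : 1 ≤ 4 * Real.log Q.W ^ 2 := by nlinarith [le_log hW]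
  have hL0 : 0 ≤ Real.log Q.W ^ 2 := sq_nonneg _
  have hW1 : (1 : ℝ) ≤ Q.W := by exact_mod_cast Q.W_pos
  have hn1 : (1 : ℝ) ≤ n := by exact_mod_cast hn
  generalize Real.log Q.W ^ 2 = L at *
  constructor
  · have h1 : (Q.W : ℝ) ≤ (Q.W : ℝ) ^ (1 + e) := by
      simpa using le_rpow_mul_rpow he one_pos hW1
    have h2 : (Q.W : ℝ) ≤ 4 * (n * (Q.W ^ (1 + e) * L)) := by
      calc (Q.W : ℝ) ≤ Q.W * (4 * L) := le_mul_of_one_le_right (by positivity) hL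
        _ ≤ Q.W ^ (1 + e) * (4 * L) := by gcongr
        _ ≤ n * (Q.W ^ (1 + e) * (4 * L)) := le_mul_of_one_le_left (by positivity) hn1
        _ = _ := by ring
    calc T ≤ a * (D * Q.W) + (n - 1) * (a * (D * (Q.W * L))) := hT
      _ ≤ a * (D * (4 * (n * (Q.W ^ (1 + e) * L)))) + n * (a * (D * (Q.W ^ (1 + e) * L))) := by
        gcongr
        linarith
      _ = 5 * a * (D * n * Q.W ^ (1 + e) * L) := by ring
      _ ≤ _ := by gcongr
  · intro hw
    have h1 : ((n : ℝ) - 1) * Q.W ≤ Q.W ^ (1 + e) *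
        ∑ i ∈ Finset.univ.filter (fun i : Fin n => 0 < i.val), (Q.w i : ℝ) ^ (-e) := by
      have hcard : (Finset.univ.filter fun i : Fin n => 0 < i.val).card = n - 1 := by
        obtain ⟨m, rfl⟩ : ∃ m, n = m + 1 := ⟨n - 1, by omega⟩
        rw [Fin.card_filter_univ_succ]
        simp
      rw [Finset.mul_sum]
      calc ((n : ℝ) - 1) * Q.W
          = ∑ _i ∈ Finset.univ.filter (fun i : Fin n => 0 < i.val), (Q.W : ℝ) := by
            rw [Finset.sum_const, hcard, nsmul_eq_mul, Nat.cast_sub hn, Nat.cast_one]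
        _ ≤ _ := Finset.sum_le_sum fun i _ => le_rpow_mul_rpow he
            (by exact_mod_cast Q.w_pos i) (by exact_mod_cast hw i)
    have h2 : 0 ≤ (n - 1 : ℝ) * Q.W := mul_nonneg (by linarith) (by positivity)
    generalize (Q.W : ℝ) ^ (1 + e) *
      ∑ i ∈ Finset.univ.filter (fun i : Fin n => 0 < i.val), (Q.w i : ℝ) ^ (-e) = S at *
    calc T ≤ a * (D * Q.W) + (n - 1) * (a * (D * (Q.W * L))) := hT
      _ = a * (D * (Q.W + (n - 1) * Q.W * L)) := by ring
      _ ≤ C * (D * (Q.W + S * L)) := by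
        gcongr
        · linarith
        · linarith

/-- With `l = log₂ d ≥ 0`, one has `σ - 1 = l ^ 2 / (1 + l)`. Hence the exponent `(σ - 1) / σ` is
nonnegative. -/
theorem one_le_sigma {d : ℕ} (hd : 1 ≤ d) : 1 ≤ sigma d := by
  have h : 0 ≤ Real.logb 2 d := Real.logb_nonneg (by norm_num) (by exact_mod_cast hd)
  rw [sigma]
  generalize Real.logb 2 d = l at *
  have : l + 1 / (1 + l) - 1 = l ^ 2 / (1 + l) := by
    field_simp
    ring
  have : 0 ≤ l ^ 2 / (1 + l) := by positivity
  linarith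

end

end Knap

namespace Knap

noncomputable section

variable {n : ℕ}

/-- The constants arise from `2 ^ K ≤ 4 * W` and `K + 1 ≤ 6 * log W`: `1200 = 300 * 4` and `158400 =
1100 * 4 * 36`. The factor `3` compensates for `log W < 1`, since `1 ≤ 3 * (log W) ^ 2`. -/
theorem time_le_of_front {Q : Problem n} (hn : 1 ≤ n) (hW : 2 ≤ Q.W) {T ft np : ℕ} {D α β : ℝ}
    (hD : 1 ≤ D) (hβ : 0 ≤ β) (hft : (ft : ℝ) ≤ α * (D * Q.W)) (hnp : (np : ℝ) + 1 ≤ β * D)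
    (hT : T ≤ 300 * 2 ^ Q.logSize + ft + (n - 1) * (ft + 1100 * ((np + 1) * (2 ^ Q.logSize *
      ((Q.logSize + 1) * (Q.logSize + 1)))))) :
    (T : ℝ) ≤ (1200 + 3 * α + 158400 * β) * (D * Q.W) +
      (n - 1) * ((1200 + 3 * α + 158400 * β) * (D * (Q.W * Real.log Q.W ^ 2))) := by
  have hL : 1 ≤ 3 * Real.log Q.W ^ 2 := by nlinarith [le_log hW]
  have hL0 : 0 ≤ Real.log Q.W := by linarith [le_log hW]
  have hT' : (T : ℝ) ≤ 300 * 2 ^ Q.logSize + ft + ((n - 1 : ℕ) : ℝ) * (ft + 1100 * ((np + 1) *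
      (2 ^ Q.logSize * ((Q.logSize + 1) * (Q.logSize + 1))))) := by exact_mod_cast hT
  rw [Nat.cast_sub hn, Nat.cast_one] at hT'
  have hn1 : (0 : ℝ) ≤ n - 1 := by
    have : (1 : ℝ) ≤ n := by exact_mod_cast hn
    linarith
  have hW0 : (0 : ℝ) ≤ Q.W := by positivity
  have h1 := pow_logSize_le (Q := Q)
  have h2 := logSize_le hW
  have hx : (Q.W : ℝ) ≤ D * Q.W := le_mul_of_one_le_left hW0 hD
  have hft0 : (0 : ℝ) ≤ α * (D * Q.W) := le_trans (by positivity) hft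
  have hDW : 0 ≤ D * Q.W := hW0.trans hx
  refine hT'.trans (add_le_add ?_ (mul_le_mul_of_nonneg_left ?_ hn1))
  · nlinarith
  · have h3 : 1100 * (((np : ℝ) + 1) * (2 ^ Q.logSize * ((Q.logSize + 1) * (Q.logSize + 1)))) ≤
        1100 * ((β * D) * (4 * Q.W * (6 * Real.log Q.W * (6 * Real.log Q.W)))) := by gcongr
    have h4 : (ft : ℝ) ≤ α * (D * Q.W) * (3 * Real.log Q.W ^ 2) :=
      hft.trans (le_mul_of_one_le_right hft0 hL)
    have h5 : 0 ≤ D * (Q.W * Real.log Q.W ^ 2) := by positivity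
    linarith

/-! ## Bounds for the input -/

theorem Problem.exists_intsLE (Q : Problem n) (m : ℕ) : ∃ B, Q.IntsLE m B := by
  refine ⟨n + Q.W + m + (Finset.univ.sup Q.w + Finset.univ.sup Q.u), by omega, by omega, by omega,
    fun i => ?_⟩
  have h1 := Finset.le_sup (f := Q.w) (Finset.mem_univ i)
  have h2 := Finset.le_sup (f := Q.u) (Finset.mem_univ i)
  omega

theorem Problem.IntsLE.mono {Q : Problem n} {m B B' : ℕ} (h : Q.IntsLE m B) (hB : B ≤ B') :
    Q.IntsLE m B' :=
  ⟨h.1.trans hB, h.2.1.trans hB, h.2.2.1.trans hB,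
    fun i => ⟨(h.2.2.2 i).1.trans hB, (h.2.2.2 i).2.trans hB⟩⟩

theorem PiecewiseLinear.exists_endsLE {p : ℕ} (D : PiecewiseLinear n p) : ∃ B, D.EndsLE B := by
  refine ⟨Finset.univ.sup fun i => (Finset.range (p + 1)).sup fun k => (D.t i k).natAbs,
    fun i k hk => ?_⟩
  have h1 := Finset.le_sup (f := fun k => (D.t i k).natAbs)
    (Finset.mem_range.2 (by omega : k < p + 1))
  have h2 := Finset.le_sup
    (f := fun i => (Finset.range (p + 1)).sup fun k => (D.t i k).natAbs) (Finset.mem_univ i)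
  have := h1.trans h2
  rw [Int.abs_eq_natAbs]
  exact_mod_cast this

theorem Problem.IntsLE.weight_table_le {Q : Problem n} {m B : ℕ} (h : Q.IntsLE m B) (i j : ℤ) :
    |table (fun _ => 1) (fun i _ => (Q.w i : ℤ)) i j| ≤ (B : ℤ) :=
  table_rec (p := fun z : ℤ => |z| ≤ (B : ℤ)) (by simp)
    (fun i _ _ => by simpa using (h.2.2.2 i).1) i j

theorem Problem.IntsLE.upper_table_le {Q : Problem n} {m B : ℕ} (h : Q.IntsLE m B) (i j : ℤ) :
    |table (fun _ => 1) (fun i _ => (Q.u i : ℤ)) i j| ≤ (B : ℤ) :=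
  table_rec (p := fun z : ℤ => |z| ≤ (B : ℤ)) (by simp)
    (fun i _ _ => by simpa using (h.2.2.2 i).2) i j

theorem PiecewiseLinear.EndsLE.mono {p : ℕ} {D : PiecewiseLinear n p} {B B' : ℕ}
    (h : D.EndsLE B) (hB : B ≤ B') : D.EndsLE B' :=
  fun i k hk => (h i k hk).trans (by exact_mod_cast hB)

/-! ## Oracles -/

/-- The set of value bounds runs over all admissible `B'`, so one execution serves them all; it is
empty if the values are not integers. The minimality of `B` makes the integer bound fit below each
of them. -/
theorem oracle_describes {Q : Problem n} (hn : 1 ≤ n) (hW : 2 ≤ Q.W) {B : ℕ} (hB : Q.IntsLE 0 B)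
    (hmin : ∀ B', Q.IntsLE 0 B' → B ≤ B') :
    Describes Q (oracleInput Q) B {m | ∃ B', Q.IntsLE 0 B' ∧ Q.ValuesLE B' ∧ m = B' ^ 6} := by
  have hw := hB.weight_table_le
  have hu := hB.upper_table_le
  refine ⟨hn, hW, rfl, rfl, fun i => ?_, fun i => ?_, hB.1, hB.2.1, by simp [oracleInput],
    fun a i j => ?_, ?_, ?_, ?_⟩
  · simpa [oracleInput] using table_apply (len := fun _ => 1) (g := fun i _ => (Q.w i : ℤ)) i.2
      (j := 0) one_pos
  · simpa [oracleInput] using table_apply (len := fun _ => 1) (g := fun i _ => (Q.u i : ℤ)) i.2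
      (j := 0) one_pos
  · simp only [oracleInput]
    split_ifs
    · exact hw i j
    · exact hu i j
    · simp
  · rintro _ ⟨B', h1, h2, rfl⟩
    exact Nat.pow_le_pow_left (hmin B' h1) 6
  · rintro _ ⟨B', h1, h2, rfl⟩ a i j
    simp only [oracleInput]
    split_ifs
    · refine table_rec (p := IsIntLE (B' ^ 6)) (IsIntLE.zero _) (fun i j hj => ?_) i j
      exact (h2 i j (by omega) (by omega)).mono (Nat.le_self_pow (by norm_num) _)
    · exact IsIntLE.zero _
  · rintro _ ⟨B', h1, h2, rfl⟩ i x x0 x1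
    exact (h2 i x x0 x1).mono (Nat.le_self_pow (by norm_num) _)

theorem IsIntLE.of_pow {n B m C : ℕ} {v : ℝ} (hn : n ≤ B) (hB : 2 ≤ B) (hm : 40 * (m + 1) ≤ C)
    (h : IsIntLE ((n * B ^ m) ^ 40) v) : IsIntLE (B ^ C) v := by
  refine h.mono ?_
  calc (n * B ^ m) ^ 40 ≤ (B * B ^ m) ^ 40 := Nat.pow_le_pow_left (Nat.mul_le_mul_right _ hn) _
    _ = B ^ (40 * (m + 1)) := by ring
    _ ≤ B ^ C := Nat.pow_le_pow_right (by omega) hm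

theorem exists_oracle_solver (sense : Sense) : ∃ (P : Prog) (C : ℕ), ∀ (n : ℕ) (K : Problem n),
    1 ≤ n → 2 ≤ K.W → K.IsConcave →
    ∃ (T : ℕ) (s : State),
      Exec (oracleInput K)
        (fun z => ∀ B : ℕ, K.IntsLE 0 B → |z| ≤ (B : ℤ) ^ C)
        (fun v => ∀ B : ℕ, K.IntsLE 0 B → K.ValuesLE B → IsIntLE (B ^ C) v)
        P (oracleInput K).init T s ∧
      IsAnswer K sense s ∧
      (T : ℝ) ≤ C * (n * (K.W : ℝ) ^ (4 / 3 : ℝ) * Real.log K.W ^ 2) ∧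
      ((∀ i, K.w i ≤ K.W) →
        (T : ℝ) ≤ C * (K.W + (K.W : ℝ) ^ (4 / 3 : ℝ) *
          (∑ i ∈ Finset.univ.filter (fun i : Fin n => 0 < i.val), (K.w i : ℝ) ^ (-(1 / 3) : ℝ)) *
          Real.log K.W ^ 2)) := by
  -- The same `C` bounds the exponents of the number sizes, `240` and `40 * (6 + 1) = 280`, and the
  -- factor `5 * (1200 + 3 * 120 + 158400 * 2)` in the time.
  obtain ⟨C, hC⟩ : ∃ C, C = 3000000 := ⟨_, rfl⟩
  refine ⟨solver sense (oracleFront sense), C, fun n Q hn hW hconc => ?_⟩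
  classical
  have hex := Q.exists_intsLE 0
  have hB := Nat.find_spec hex
  have hmin : ∀ B', Q.IntsLE 0 B' → Nat.find hex ≤ B' := fun B' h => Nat.find_le h
  have hD := oracle_describes hn hW hB hmin
  have hFE := oracleFront_spec (hD.setup sense) sense (fun i hi t t0 t1 => ?_) ?_
  · have hiok : ∀ z : ℤ, |z| ≤ (Nat.find hex : ℤ) ^ 240 →
        ∀ B : ℕ, Q.IntsLE 0 B → |z| ≤ (B : ℤ) ^ C := by
      intro z hz B hB'
      refine hz.trans ?_
      have h1 : Nat.find hex ^ 240 ≤ B ^ C := (Nat.pow_le_pow_left (hmin B hB') _).trans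
        (Nat.pow_le_pow_right (by have := hB'.2.1; omega) (by omega))
      exact_mod_cast h1
    have hvok : ∀ v, (∀ m ∈ {m | ∃ B', Q.IntsLE 0 B' ∧ Q.ValuesLE B' ∧ m = B' ^ 6},
        IsIntLE ((n * m) ^ 40) v) →
        ∀ B : ℕ, Q.IntsLE 0 B → Q.ValuesLE B → IsIntLE (B ^ C) v := by
      intro v hv B hB' hV
      exact IsIntLE.of_pow hB'.1 (hW.trans hB'.2.1) (m := 6) (by omega) (hv _ ⟨B, hB', hV, rfl⟩)
    obtain ⟨T, s, h1, h2, h3⟩ := hD.exists_exec hFE (δ := Q.logSize + 1) (.inl le_rfl) (by omega)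
      hiok hvok
    refine ⟨T, s, h1, h2, ?_⟩
    have ht := time_le_of_front hn hW (D := 1) (α := 120) (β := 2) le_rfl (by norm_num)
      (by have := pow_logSize_le (Q := Q); push_cast; linarith) (by norm_num) h3
    have := time_le (C := C) hn hW (e := 1 / 3) (by norm_num) zero_le_one (by norm_num)
      (by rw [hC]; norm_num) ht
    norm_num at this ⊢
    exact this
  · rw [Problem.upperAt_of_lt hi] at t1
    rw [Problem.signedAt_of_lt hi]
    obtain ⟨t, rfl⟩ := Int.eq_ofNat_of_zero_le t0
    have := table_apply (len := fun i => Q.u i + 1) (g := fun i x => Q.f i (x : ℤ)) hi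
      (j := t) (by omega)
    simp only [inputEnv, oracleInput, if_true]
    rw [this]
  · have key : ∀ (i : ℕ) (hi : i < n) (y : ℤ), 0 < y → y < Q.upperAt i →
        Q.f ⟨i, hi⟩ (y + 1) + Q.f ⟨i, hi⟩ (y - 1) ≤ Q.f ⟨i, hi⟩ y + Q.f ⟨i, hi⟩ y := by
      intro i hi y y0 y1
      rw [Problem.upperAt_of_lt hi] at y1
      linarith [hconc ⟨i, hi⟩ y y0 y1]
    cases sense
    · refine .inr fun i hi y y0 y1 => ?_
      simpa [Problem.signedAt_of_lt hi, Sense.sign] using key i hi y y0 y1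
    · refine .inl fun i hi y y0 y1 => ?_
      have := key i hi y y0 y1
      simp only [Problem.signedAt_of_lt hi, Sense.sign]
      push_cast
      linarith

/-! ## Piecewise linear functions -/

theorem plin_describes {Q : Problem n} {p : ℕ} {D : PiecewiseLinear n p} (hn : 1 ≤ n)
    (hW : 2 ≤ Q.W) (hrep : D.Represents Q) {B : ℕ} (hB : Q.IntsLE p B) (hB' : D.EndsLE B)
    (hmin : ∀ B', Q.IntsLE p B' → D.EndsLE B' → B ≤ B') :
    Describes Q (plinInput Q D) B
      {m | ∃ B', Q.IntsLE p B' ∧ D.EndsLE B' ∧ D.CoeffsLE B' ∧ m = B' ^ 6} := by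
  have hw := hB.weight_table_le
  have hu := hB.upper_table_le
  refine ⟨hn, hW, rfl, rfl, fun i => ?_, fun i => ?_, hB.1, hB.2.1, ?_,
    fun a i j => ?_, ?_, ?_, ?_⟩
  · simpa [plinInput] using table_apply (len := fun _ => 1) (g := fun i _ => (Q.w i : ℤ)) i.2
      (j := 0) one_pos
  · simpa [plinInput] using table_apply (len := fun _ => 1) (g := fun i _ => (Q.u i : ℤ)) i.2
      (j := 0) one_pos
  · simpa [plinInput] using hB.2.2.1
  · simp only [plinInput]
    split_ifs
    · exact hw i j
    · exact hu i j
    · exact table_rec (p := fun z : ℤ => |z| ≤ (B : ℤ)) (by simp)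
        (fun i k hk => hB' i k (by omega)) i j
    · simp
  · rintro _ ⟨B', h1, h2, _, rfl⟩
    exact Nat.pow_le_pow_left (hmin B' h1 h2) 6
  · rintro _ ⟨B', _, _, h3, rfl⟩ a i j
    have hle : B' ≤ B' ^ 6 := Nat.le_self_pow (by norm_num) _
    simp only [plinInput]
    split_ifs
    · exact table_rec (p := IsIntLE (B' ^ 6)) (IsIntLE.zero _)
        (fun i j hj => (h3 i j hj).1.mono hle) i j
    · exact table_rec (p := IsIntLE (B' ^ 6)) (IsIntLE.zero _)
        (fun i j hj => (h3 i j hj).2.mono hle) i j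
    · exact IsIntLE.zero _
  · rintro _ ⟨B', h1, _, h3, rfl⟩ i x x0 x1
    obtain ⟨t0, tp, ht⟩ := hrep i
    -- The end points start at `0 ≤ x` and finish beyond `u i ≥ x`, so some piece contains `x`.
    have hk : ∃ k < p, D.t i k ≤ x ∧ x < D.t i (k + 1) := by
      by_contra! hcon
      have : ∀ k ≤ p, D.t i k ≤ x := by
        intro k
        induction k with
        | zero => exact fun _ => by omega
        | succ k ih => exact fun hk => hcon k hk (ih (by omega))
      have := this p le_rfl
      omega
    obtain ⟨k, hkp, k0, k1⟩ := hk
    rw [(ht k hkp).2 x x1 k0 k1]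
    have hx : IsIntLE B' (x : ℝ) := IsIntLE.intCast (by
      have := (h1.2.2.2 i).2
      rw [abs_of_nonneg x0]
      omega)
    refine (((h3 i k hkp).1.mul hx).add (h3 i k hkp).2).mono ?_
    have hB2 : 2 ≤ B' := hW.trans h1.2.1
    have : 2 ^ 4 ≤ B' ^ 4 := Nat.pow_le_pow_left hB2 4
    calc B' * B' + B' ≤ 2 ^ 4 * B' ^ 2 := by nlinarith
      _ ≤ B' ^ 4 * B' ^ 2 := Nat.mul_le_mul_right _ this
      _ = B' ^ 6 := by ring

theorem exists_plin_solver (sense : Sense) :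
    ∃ (P : Prog) (C : ℕ), ∀ (n p : ℕ) (K : Problem n) (D : PiecewiseLinear n p),
      1 ≤ n → 2 ≤ K.W → D.Represents K →
      ∃ (T : ℕ) (s : State),
        Exec (plinInput K D)
          (fun z => ∀ B : ℕ, K.IntsLE p B → D.EndsLE B → |z| ≤ (B : ℤ) ^ C)
          (fun v => ∀ B : ℕ, K.IntsLE p B → D.EndsLE B → D.CoeffsLE B → IsIntLE (B ^ C) v)
          P (plinInput K D).init T s ∧
        IsAnswer K sense s ∧
        (T : ℝ) ≤ C * (p * n * K.W * Real.log K.W) := by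
  obtain ⟨C, hC⟩ : ∃ C, C = 3000000 := ⟨_, rfl⟩
  refine ⟨solver sense (plinFront sense), C, fun n p Q D hn hW hrep => ?_⟩
  classical
  have hex : ∃ B, Q.IntsLE p B ∧ D.EndsLE B := by
    obtain ⟨B, hB⟩ := Q.exists_intsLE p
    obtain ⟨B', hB'⟩ := D.exists_endsLE
    exact ⟨max B B', hB.mono (le_max_left _ _), hB'.mono (le_max_right _ _)⟩
  obtain ⟨hB, hBe⟩ := Nat.find_spec hex
  have hmin : ∀ B', Q.IntsLE p B' → D.EndsLE B' → Nat.find hex ≤ B' :=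
    fun B' h h' => Nat.find_le ⟨h, h'⟩
  have hD := plin_describes hn hW hrep hB hBe hmin
  have hB2 : 2 ≤ Nat.find hex := hW.trans hB.2.1
  have hp1 : 1 ≤ p := by
    rcases Nat.eq_zero_or_pos p with rfl | hp
    · have := hrep ⟨0, hn⟩
      omega
    · exact hp
  have hFE := plinFront_spec (hD.setup sense) sense (p := p)
    (t := fun i k => if h : i < n then D.t ⟨i, h⟩ k else 0)
    (α := fun i k => if h : i < n then D.α ⟨i, h⟩ k else 0)
    (β := fun i k => if h : i < n then D.β ⟨i, h⟩ k else 0) rfl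
    (by have := hB.2.2.1; simp only [inputEnv]; nlinarith)
    (fun i hi => ?_) (fun i hi => ?_) (fun i hi k hk => ?_) (fun i hi k hk => ?_)
    (fun i hi k hk => ?_) (fun i hi k hk => ?_) (fun i hi k hk x x1 k0 k1 => ?_)
  · have hiok : ∀ z : ℤ, |z| ≤ (Nat.find hex : ℤ) ^ 240 →
        ∀ B : ℕ, Q.IntsLE p B → D.EndsLE B → |z| ≤ (B : ℤ) ^ C := by
      intro z hz B hB' hB''
      refine hz.trans ?_
      have h1 : Nat.find hex ^ 240 ≤ B ^ C := (Nat.pow_le_pow_left (hmin B hB' hB'') _).trans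
        (Nat.pow_le_pow_right (by have := hB'.2.1; omega) (by omega))
      exact_mod_cast h1
    have hvok : ∀ v, (∀ m ∈ {m | ∃ B', Q.IntsLE p B' ∧ D.EndsLE B' ∧ D.CoeffsLE B' ∧ m = B' ^ 6},
        IsIntLE ((n * m) ^ 40) v) →
        ∀ B : ℕ, Q.IntsLE p B → D.EndsLE B → D.CoeffsLE B → IsIntLE (B ^ C) v := by
      intro v hv B hB' hB'' hV
      exact IsIntLE.of_pow hB'.1 (hW.trans hB'.2.1) (m := 6) (by omega)
        (hv _ ⟨B, hB', hB'', hV, rfl⟩)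
    -- Affine pieces allow `δ = 1`, which saves one logarithm compared with the other two cases.
    obtain ⟨T, s, h1, h2, h3⟩ := hD.exists_exec hFE (δ := 1) (.inr trivial) le_rfl
      hiok hvok
    refine ⟨T, s, h1, h2, ?_⟩
    have hT' : (T : ℝ) ≤ 300 * 2 ^ Q.logSize + 100 * (p * 2 ^ Q.logSize) + ((n - 1 : ℕ) : ℝ) *
        (100 * (p * 2 ^ Q.logSize) + 1100 * ((p + 1) *
        (2 ^ Q.logSize * ((Q.logSize + 1) * 1)))) := by exact_mod_cast h3
    have hp : (1 : ℝ) ≤ p := by exact_mod_cast hp1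
    have hn1 : (1 : ℝ) ≤ n := by exact_mod_cast hn
    have l1 := pow_logSize_le (Q := Q)
    have l2 := logSize_le hW
    have l3 := le_log hW
    have hW0 : (0 : ℝ) ≤ Q.W := by positivity
    have h4 : (Q.W : ℝ) ≤ 2 * (Q.W * Real.log Q.W) := by nlinarith
    have h5 : (0 : ℝ) ≤ Q.W * Real.log Q.W := by nlinarith
    calc (T : ℝ) ≤ _ := hT'
      _ ≤ 300 * (4 * Q.W) + 100 * (p * (4 * Q.W)) + n *
        (100 * (p * (4 * Q.W)) + 1100 * ((p + p) * (4 * Q.W * (6 * Real.log Q.W * 1)))) := by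
        gcongr
        omega
      _ ≤ 300 * (4 * (2 * (Q.W * Real.log Q.W))) + 100 * (p * (4 * (2 * (Q.W * Real.log Q.W)))) +
        n * (100 * (p * (4 * (2 * (Q.W * Real.log Q.W)))) +
          1100 * ((p + p) * (4 * Q.W * (6 * Real.log Q.W * 1)))) := by gcongr
      _ = 2400 * (1 * (1 * (Q.W * Real.log Q.W))) + 800 * (p * (1 * (Q.W * Real.log Q.W))) +
        53600 * (p * (n * (Q.W * Real.log Q.W))) := by ring
      _ ≤ 2400 * (p * (n * (Q.W * Real.log Q.W))) + 800 * (p * (n * (Q.W * Real.log Q.W))) +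
        53600 * (p * (n * (Q.W * Real.log Q.W))) := by gcongr
      _ = 56800 * (p * n * Q.W * Real.log Q.W) := by ring
      _ ≤ C * (p * n * Q.W * Real.log Q.W) := by
        have : 0 ≤ Real.log Q.W := by linarith
        rw [hC]
        gcongr
        norm_num
  · simpa [hi] using (hrep ⟨i, hi⟩).1
  · simpa [hi, Problem.upperAt_of_lt hi] using (hrep ⟨i, hi⟩).2.1
  · simpa [hi] using ((hrep ⟨i, hi⟩).2.2 k hk).1
  · have := table_apply (len := fun _ => p + 1) (g := D.t) hi (j := k) (by omega)
    simpa [inputEnv, plinInput, hi] using this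
  · have := table_apply (len := fun _ => p) (g := D.α) hi (j := k) hk
    simpa [inputEnv, plinInput, hi] using this
  · have := table_apply (len := fun _ => p) (g := D.β) hi (j := k) hk
    simpa [inputEnv, plinInput, hi] using this
  · rw [Problem.upperAt_of_lt hi] at x1
    simp only [hi, dite_true] at k0 k1 ⊢
    rw [Problem.signedAt_of_lt hi, ((hrep ⟨i, hi⟩).2.2 k hk).2 x x1 k0 k1]

/-! ## Polynomials -/

/-- There are at most `d + 1 ≤ B ^ 2` terms of size at most `B ^ (d + 1)`, and `d + 3 ≤ 6 * d`. -/
theorem isIntLE_hornerSum {c : ℕ → ℤ} {d B : ℕ} {x : ℤ} (hd : d ≤ B) (hd1 : 1 ≤ d) (hB : 2 ≤ B)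
    (hc : ∀ k, |c k| ≤ (B : ℤ)) (hx : |x| ≤ (B : ℤ)) (k : ℕ) :
    IsIntLE (B ^ (6 * d)) (hornerSum (fun j => (c j : ℝ)) d x k) := by
  refine ⟨∑ j ∈ Finset.Ico k (d + 1), c j * x ^ (j - k), by simp [hornerSum], ?_⟩
  have hB1 : (1 : ℤ) ≤ B := by omega
  calc |∑ j ∈ Finset.Ico k (d + 1), c j * x ^ (j - k)|
      ≤ ∑ j ∈ Finset.Ico k (d + 1), |c j * x ^ (j - k)| := Finset.abs_sum_le_sum_abs _ _
    _ ≤ ∑ _j ∈ Finset.Ico k (d + 1), (B : ℤ) ^ (d + 1) := Finset.sum_le_sum fun j hj => by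
        rw [abs_mul, abs_pow]
        calc |c j| * |x| ^ (j - k) ≤ B * (B : ℤ) ^ (j - k) := by gcongr; exact hc j
          _ = (B : ℤ) ^ (j - k + 1) := by ring
          _ ≤ (B : ℤ) ^ (d + 1) := pow_le_pow_right₀ hB1 (by
            have := (Finset.mem_Ico.1 hj).2
            omega)
    _ = ((d + 1 - k : ℕ) : ℤ) * (B : ℤ) ^ (d + 1) := by simp
    _ ≤ (B : ℤ) ^ 2 * (B : ℤ) ^ (d + 1) := by
        gcongr
        have : d + 1 - k ≤ B ^ 2 := by nlinarith [Nat.sub_le (d + 1) k]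
        exact_mod_cast this
    _ = (B : ℤ) ^ (d + 3) := by ring
    _ ≤ (B : ℤ) ^ (6 * d) := pow_le_pow_right₀ hB1 (by omega)
    _ = _ := by push_cast; rfl

theorem eval_eq_sum_coeff {d : ℕ} {q : Polynomial ℤ} (hq : q.natDegree ≤ d) (x : ℤ) :
    ((q.eval x : ℤ) : ℝ) = ∑ j ∈ Finset.range (d + 1), (q.coeff j : ℝ) * (x : ℝ) ^ j := by
  rw [Polynomial.eval_eq_sum_range' (Nat.lt_succ_of_le hq)]
  push_cast
  rfl

theorem poly_describes {Q : Problem n} {d : ℕ} {q : Fin n → Polynomial ℤ} (hn : 1 ≤ n)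
    (hW : 2 ≤ Q.W) (hd : 1 ≤ d) (hrep : PolyRepresents d q Q) {B : ℕ} (hB : Q.IntsLE d B)
    (hmin : ∀ B', Q.IntsLE d B' → B ≤ B') :
    Describes Q (polyInput Q d q) B
      {m | ∃ B', Q.IntsLE d B' ∧ PolyCoeffsLE q B' ∧ m = B' ^ (6 * d)} := by
  have hw := hB.weight_table_le
  have hu := hB.upper_table_le
  refine ⟨hn, hW, rfl, rfl, fun i => ?_, fun i => ?_, hB.1, hB.2.1, ?_,
    fun a i j => ?_, ?_, ?_, ?_⟩
  · simpa [polyInput] using table_apply (len := fun _ => 1) (g := fun i _ => (Q.w i : ℤ)) i.2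
      (j := 0) one_pos
  · simpa [polyInput] using table_apply (len := fun _ => 1) (g := fun i _ => (Q.u i : ℤ)) i.2
      (j := 0) one_pos
  · simpa [polyInput] using hB.2.2.1
  · simp only [polyInput]
    split_ifs
    · exact hw i j
    · exact hu i j
    · simp
  · rintro _ ⟨B', h1, _, rfl⟩
    exact (Nat.pow_le_pow_left (hmin B' h1) 6).trans
      (Nat.pow_le_pow_right (by have := h1.2.1; omega) (by omega))
  · rintro _ ⟨B', _, h2, rfl⟩ a i j
    have hle : B' ≤ B' ^ (6 * d) := Nat.le_self_pow (by omega) _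
    simp only [polyInput]
    split_ifs
    · exact table_rec (p := IsIntLE (B' ^ (6 * d))) (IsIntLE.zero _)
        (fun i j hj => (IsIntLE.intCast (h2 i j)).mono hle) i j
    · exact IsIntLE.zero _
  · rintro _ ⟨B', h1, h2, rfl⟩ i x x0 x1
    rw [(hrep i).2 x x0 x1, eval_eq_sum_coeff (hrep i).1, ← hornerSum_zero]
    refine isIntLE_hornerSum h1.2.2.1 hd (hW.trans h1.2.1) (h2 i) ?_ 0
    have := (h1.2.2.2 i).2
    rw [abs_of_nonneg x0]
    omega

theorem exists_poly_solver (sense : Sense) :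
    ∃ (P : Prog) (C : ℕ), ∀ (n d : ℕ) (K : Problem n) (q : Fin n → Polynomial ℤ),
      1 ≤ n → 2 ≤ K.W → 1 ≤ d → PolyRepresents d q K →
      ∃ (T : ℕ) (s : State),
        Exec (polyInput K d q)
          (fun z => ∀ B : ℕ, K.IntsLE d B → |z| ≤ (B : ℤ) ^ C)
          (fun v => ∀ B : ℕ, K.IntsLE d B → PolyCoeffsLE q B → IsIntLE (B ^ (C * d)) v)
          P (polyInput K d q).init T s ∧
        IsAnswer K sense s ∧
        (T : ℝ) ≤ C * ((d : ℝ) ^ 3 * n *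
          (K.W : ℝ) ^ (1 + (sigma d - 1) / sigma d) * Real.log K.W ^ 2) ∧
        ((∀ i, K.w i ≤ K.W) →
          (T : ℝ) ≤ C * ((d : ℝ) ^ 3 * (K.W +
            (K.W : ℝ) ^ (1 + (sigma d - 1) / sigma d) *
            (∑ i ∈ Finset.univ.filter (fun i : Fin n => 0 < i.val),
              (K.w i : ℝ) ^ ((1 - sigma d) / sigma d)) *
            Real.log K.W ^ 2))) := by
  obtain ⟨C, hC⟩ : ∃ C, C = 3000000 := ⟨_, rfl⟩
  refine ⟨solver sense (polyFront sense), C, fun n d Q q hn hW hd hrep => ?_⟩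
  classical
  have hex := Q.exists_intsLE d
  have hB := Nat.find_spec hex
  have hmin : ∀ B', Q.IntsLE d B' → Nat.find hex ≤ B' := fun B' h => Nat.find_le h
  have hD := poly_describes hn hW hd hrep hB hmin
  have hB2 : 2 ≤ Nat.find hex := hW.trans hB.2.1
  have hFE := polyFront_spec (hD.setup sense) sense (d := d)
    (c := fun i k => if h : i < n then ((q ⟨i, h⟩).coeff k : ℝ) else 0) rfl
    (by
      have h1 := hB.2.2.1
      have h2 := hB.2.1
      have : Q.W + d + 2 ≤ 16 * Nat.find hex ^ 2 := by nlinarith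
      simp only [inputEnv]
      exact_mod_cast this)
    (fun i hi k hk => ?_) (fun i hi x x0 x1 k hk => ?_) (fun i hi x x0 x1 => ?_) (fun i hi => ?_)
  · have hiok : ∀ z : ℤ, |z| ≤ (Nat.find hex : ℤ) ^ 240 →
        ∀ B : ℕ, Q.IntsLE d B → |z| ≤ (B : ℤ) ^ C := by
      intro z hz B hB'
      refine hz.trans ?_
      have h1 : Nat.find hex ^ 240 ≤ B ^ C := (Nat.pow_le_pow_left (hmin B hB') _).trans
        (Nat.pow_le_pow_right (by have := hB'.2.1; omega) (by omega))
      exact_mod_cast h1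
    have hvok : ∀ v, (∀ m ∈ {m | ∃ B', Q.IntsLE d B' ∧ PolyCoeffsLE q B' ∧ m = B' ^ (6 * d)},
        IsIntLE ((n * m) ^ 40) v) →
        ∀ B : ℕ, Q.IntsLE d B → PolyCoeffsLE q B → IsIntLE (B ^ (C * d)) v := by
      intro v hv B hB' hV
      exact IsIntLE.of_pow hB'.1 (hW.trans hB'.2.1) (m := 6 * d) (by rw [hC]; omega)
        (hv _ ⟨B, hB', hV, rfl⟩)
    obtain ⟨T, s, h1, h2, h3⟩ := hD.exists_exec hFE (δ := Q.logSize + 1) (.inl le_rfl) (by omega)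
      hiok hvok
    refine ⟨T, s, h1, h2, ?_⟩
    have hd' : (1 : ℝ) ≤ d := by exact_mod_cast hd
    have hd3 : (d : ℝ) ≤ d ^ 3 := le_self_pow₀ hd' (by norm_num)
    have hσ := one_le_sigma hd
    have hW0 : (0 : ℝ) ≤ Q.W := by positivity
    -- Reading and scanning cost `200 * (d + 1) * 2 ^ K`, and there are at most `d + 1` pieces; both
    -- are linear in `d` and are estimated generously by `d ^ 3`.
    have ht := time_le_of_front hn hW (D := (d : ℝ) ^ 3) (α := 1600) (β := 3) (by linarith)
      (by norm_num) ?_ (by push_cast; linarith) h3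
    · have := time_le (C := C) hn hW (e := (sigma d - 1) / sigma d)
        (div_nonneg (by linarith) (by linarith)) (by positivity) (by norm_num)
        (by rw [hC]; norm_num) ht
      rwa [← neg_div, neg_sub] at this
    · have := pow_logSize_le (Q := Q)
      push_cast
      calc 200 * (((d : ℝ) + 1) * 2 ^ Q.logSize)
          ≤ 200 * ((d ^ 3 + d ^ 3) * (4 * Q.W)) := by
            gcongr
            linarith
        _ = _ := by ring
  · have := table_apply (len := fun _ => d + 1) (g := fun i k => (((q i).coeff k : ℤ) : ℝ)) hi
      (j := k) (by omega)
    simpa [inputEnv, polyInput, hi] using this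
  · rw [Problem.upperAt_of_lt hi] at x1
    rintro _ ⟨_, ⟨B', h1, h2, rfl⟩, rfl⟩
    simp only [hi, dite_true]
    refine (isIntLE_hornerSum h1.2.2.1 hd (hW.trans h1.2.1) (h2 ⟨i, hi⟩) ?_ k).mono
      (Nat.le_mul_of_pos_left _ hn)
    have := (h1.2.2.2 ⟨i, hi⟩).2
    rw [abs_of_nonneg x0]
    omega
  · rw [Problem.upperAt_of_lt hi] at x1
    rw [Problem.signedAt_of_lt hi, (hrep ⟨i, hi⟩).2 x x0 x1, eval_eq_sum_coeff (hrep ⟨i, hi⟩).1]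
    simp only [hi, dite_true]
  · refine fewTurns_of_eval (.C (sense.sign : ℝ) * (q ⟨i, hi⟩).map (Int.castRingHom ℝ)) ?_
      fun x x0 x1 => ?_
    · exact (Polynomial.natDegree_C_mul_le _ _).trans
        (Polynomial.natDegree_map_le.trans (hrep ⟨i, hi⟩).1)
    · rw [Problem.upperAt_of_lt hi] at x1
      rw [Problem.signedAt_of_lt hi, (hrep ⟨i, hi⟩).2 x x0 (by omega)]
      simp

end

end Knap

theorem theorem4 (sense : Knap.Sense) :
    -- piecewise linear summands with `p` pieces
    (∃ (P : Knap.Prog) (C : ℕ), ∀ (n p : ℕ) (K : Knap.Problem n) (D : Knap.PiecewiseLinear n p),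
      1 ≤ n → 2 ≤ K.W → D.Represents K →
      ∃ (T : ℕ) (s : Knap.State),
        Knap.Exec (Knap.plinInput K D)
          (fun z => ∀ B : ℕ, K.IntsLE p B → D.EndsLE B → |z| ≤ (B : ℤ) ^ C)
          (fun v => ∀ B : ℕ, K.IntsLE p B → D.EndsLE B → D.CoeffsLE B → Knap.IsIntLE (B ^ C) v)
          P (Knap.plinInput K D).init T s ∧
        Knap.IsAnswer K sense s ∧
        (T : ℝ) ≤ C * (p * n * K.W * Real.log K.W)) ∧
    -- concave summands, given by an evaluation oracle
    (∃ (P : Knap.Prog) (C : ℕ), ∀ (n : ℕ) (K : Knap.Problem n),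
      1 ≤ n → 2 ≤ K.W → K.IsConcave →
      ∃ (T : ℕ) (s : Knap.State),
        Knap.Exec (Knap.oracleInput K)
          (fun z => ∀ B : ℕ, K.IntsLE 0 B → |z| ≤ (B : ℤ) ^ C)
          (fun v => ∀ B : ℕ, K.IntsLE 0 B → K.ValuesLE B → Knap.IsIntLE (B ^ C) v)
          P (Knap.oracleInput K).init T s ∧
        Knap.IsAnswer K sense s ∧
        (T : ℝ) ≤ C * (n * (K.W : ℝ) ^ (4 / 3 : ℝ) * Real.log K.W ^ 2) ∧
        ((∀ i, K.w i ≤ K.W) →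
          (T : ℝ) ≤ C * (K.W + (K.W : ℝ) ^ (4 / 3 : ℝ) *
            (∑ i ∈ Finset.univ.filter (fun i : Fin n => 0 < i.val), (K.w i : ℝ) ^ (-(1 / 3) : ℝ)) *
            Real.log K.W ^ 2))) ∧
    -- integer polynomials of degree at most `d`
    (∃ (P : Knap.Prog) (C : ℕ), ∀ (n d : ℕ) (K : Knap.Problem n) (q : Fin n → Polynomial ℤ),
      1 ≤ n → 2 ≤ K.W → 1 ≤ d → Knap.PolyRepresents d q K →
      ∃ (T : ℕ) (s : Knap.State),
        Knap.Exec (Knap.polyInput K d q)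
          (fun z => ∀ B : ℕ, K.IntsLE d B → |z| ≤ (B : ℤ) ^ C)
          (fun v => ∀ B : ℕ, K.IntsLE d B → Knap.PolyCoeffsLE q B →
            Knap.IsIntLE (B ^ (C * d)) v)
          P (Knap.polyInput K d q).init T s ∧
        Knap.IsAnswer K sense s ∧
        (T : ℝ) ≤ C * ((d : ℝ) ^ 3 * n *
          (K.W : ℝ) ^ (1 + (Knap.sigma d - 1) / Knap.sigma d) * Real.log K.W ^ 2) ∧
        ((∀ i, K.w i ≤ K.W) →
          (T : ℝ) ≤ C * ((d : ℝ) ^ 3 * (K.W +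
            (K.W : ℝ) ^ (1 + (Knap.sigma d - 1) / Knap.sigma d) *
            (∑ i ∈ Finset.univ.filter (fun i : Fin n => 0 < i.val),
              (K.w i : ℝ) ^ ((1 - Knap.sigma d) / Knap.sigma d)) *
            Real.log K.W ^ 2)))) :=
  ⟨Knap.exists_plin_solver sense, Knap.exists_oracle_solver sense, Knap.exists_poly_solver sense⟩
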